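/- **Setting.** A parallel program $P$ has finitely many threads. Each thread has local registers, an initial label and a finite list of labelled instructions "$\ell$: inst; goto $\ell'$", where inst is a load $r\leftarrow \mathrm{mem}[e]$, a store $\mathrm{mem}[e_1]\leftarrow e_2$, a fence, an assignment $r\leftarrow e$, or an assertion of $e$, and expressions are functions on an arbitrary data domain $D\ni 0$ applied to registers; values of $D$ are also the addresses. Under SC, loads and stores act on memory directly. Under TSO, a store instruction puts an address-value pair into the FIFO buffer of its thread (action $\mathsf{isu}$), which is later removed and written to memory (action $\mathsf{st}$); a load reads the newest entry for its address in its own buffer, and memory if there is none; a fence requires an empty buffer. TSO computations start with all values $0$ and empty buffers, and end with empty buffers. The happens-before relation $\to_{hb}$ of a computation is the union of program order (by issue), store order per address, source relation (store to a load that reads from it) and conflict relation (load to a store overwriting the value it read); an issue and its store are one node. A store is delayed if its thread acts between the issue and the store. **Attacks.** An attack $A=(t_A,\mathit{stinst},\mathit{ldinst})$ in $P$ consists of a thread $t_A$ and a store instruction and a load instruction of $t_A$. It is feasible if $P$ has a TSO computation $\tau=\tau_1\cdot\mathsf{isu}_{st}\cdot\tau_2\cdot ld\cdot\tau_3\cdot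 st\cdot\tau_4$ such that (1) only $t_A$ delays stores; (2) $st$ is an instance of $\mathit{stinst}$, issued by $\mathsf{isu}_{st}$, and is the first delayed store of $t_A$; $ld$ is an instance of $\mathit{ldinst}$ executed by $t_A$, and $\tau_3$ contains no action of $t_A$; (3) for every action $a$ of $\tau_3\cdot st$ there is a happens-before path from $ld$ to $a$ through the part of $\tau$ between them, i.e. whose actions occur in this order in $\tau$ (an issue and store of a helper count as one action); (4) $\tau_4$ consists of stores of $t_A$ only (which were then issued before $ld$), and their addresses differ from that of $ld$. **Instrumented program.** $P_A$ is a program with the same threads over the extended domain consisting of $D$, auxiliary addresses/values $(d,\delta)$ and $(d,hb)$ for $d\in D$, addresses $hb$, $a_{st}$, $suc$, and constants $\mathit{true}$ and the access types $lda$, $sta$ ("no access" is $0$). Labels $\tilde\ell$ belong to a code copy; intermediate labels are fresh; memory reads within assertions and expressions go through auxiliary registers. *Attacker $t_A$:* its original code; in addition - for $\mathit{stinst}=\ell_1\!:\mathrm{mem}[e_1]\leftarrow e_2;\ \mathrm{goto}\ \ell_2$: from $\ell_1$ to $\tilde\ell_2$, $\mathrm{mem}[(e_1,\delta)]\leftarrow(e_2,\delta)$;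 $\mathrm{mem}[a_{st}]\leftarrow e_1$; - for $\mathit{ldinst}=\ell_1\!: r\leftarrow\mathrm{mem}[e];\ \mathrm{goto}\ \ell_2$: from $\tilde\ell_1$ to a final label, assert $\mathrm{mem}[(e,\delta)]=0$; $\mathrm{mem}[hb]\leftarrow \mathit{true}$; $\mathrm{mem}[(e,hb)]\leftarrow lda$; - a copy of the code on the labels $\tilde\ell$, in which stores become $\mathrm{mem}[(e_1,\delta)]\leftarrow(e_2,\delta)$, loads read $v$ if $\mathrm{mem}[(e,\delta)]=(v,\delta)$ and $\mathrm{mem}[e]$ if $\mathrm{mem}[(e,\delta)]=0$, assignments and assertions are kept, and fences are deleted. *Every other thread (helper):* - its original code, each instruction preceded by an assertion of $\mathrm{mem}[hb]=0$; - for each load, from $\ell_1$ to $\tilde\ell_2$: assert $\mathrm{mem}[(e,hb)]=sta$; the load; - for each store, from $\ell_1$ to $\tilde\ell_2$: assert $\mathrm{mem}[(e_1,hb)]\in\{lda,sta\}$; the store; $\mathrm{mem}[(e_1,hb)]\leftarrow sta$; - a copy of the code on the labels $\tilde\ell$, in which stores are followed by $\mathrm{mem}[(e_1,hb)]\leftarrow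 sta$, and loads (with the address first saved in an auxiliary register) by raising $\mathrm{mem}[(e,hb)]$ to at least $lda$ in the order $0<lda<sta$; - from each $\tilde\ell$: assert $\mathrm{mem}[(\mathrm{mem}[a_{st}],hb)]\ne 0$; $\mathrm{mem}[suc]\leftarrow \mathit{true}$. A goal configuration is a state of $P_A$ with $\mathrm{mem}[suc]=\mathit{true}$. The size of a program is the number of symbols of its text. **Theorem (Soundness and Completeness).** There is a universal constant $C$ such that, for every program $P$ and every attack $A$ in $P$: $A$ is feasible in $P$ if and only if $P_A$ reaches a goal configuration under SC semantics; and $\mathrm{size}(P_A)\le C\cdot\mathrm{size}(P)$. -/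

import Mathlib

namespace TSORobustness

/-! ### Parallel programs

`T` is the type of thread identifiers, `L` of instruction labels, `R` of register names and `D` the
data domain, whose values also serve as addresses. Register names are local to a thread: a state
holds one register file per thread, so that two threads never share a register. -/

/-- An expression `f(r₁, …, rₖ)`: a function on the data domain applied to registers. -/
structure Expr (R D : Type*) where
  args : List R
  fn : List D → D

/-- The value of an expression under a register valuation. -/
def Expr.eval {R D : Type*} (e : Expr R D) (ρ : R → D) : D := e.fn (e.args.map ρ)

inductive Inst (R D : Type*) where
  /-- `r ← mem[adr]` -/
  | load (r : R) (adr : Expr R D)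
  /-- `mem[adr] ← val` -/
  | store (adr val : Expr R D)
  | mfence
  /-- `r ← e` -/
  | assign (r : R) (e : Expr R D)
  | assert (e : Expr R D)

/-- A labelled instruction `src: inst; goto dst;`. -/
structure LInst (L R D : Type*) where
  src : L
  inst : Inst R D
  dst : L

/-- A thread: its initial label and its finite sequence of labelled instructions. Several
instructions may carry the same label. -/
structure Thread (L R D : Type*) where
  init : L
  code : List (LInst L R D)

/-- A parallel program over the (finite) set `T` of threads. -/
abbrev Program (T L R D : Type*) := T → Thread L R D

/-! ### Size of programs: the number of symbols of the source text -/

def Expr.size {R D : Type*} (e : Expr R D) : ℕ := 1 + e.args.length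

def Inst.size {R D : Type*} : Inst R D → ℕ
  | .load _ e => 2 + e.size
  | .store e₁ e₂ => 1 + e₁.size + e₂.size
  | .mfence => 1
  | .assign _ e => 2 + e.size
  | .assert e => 1 + e.size

def LInst.size {L R D : Type*} (i : LInst L R D) : ℕ := 2 + i.inst.size

def Thread.size {L R D : Type*} (th : Thread L R D) : ℕ := 1 + (th.code.map LInst.size).sum

def Program.size {T L R D : Type*} [Fintype T] (P : Program T L R D) : ℕ := ∑ t, (P t).size

/-! ### TSO semantics -/

/-- What an action does: issue a store, act locally, load value `v` from address `a`, or make the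
store of `v` to `a` visible in memory. -/
inductive ActKind (D : Type*) where
  | isu
  | loc
  | ld (a v : D)
  | st (a v : D)

/-- An action `(thread, kind)` of a computation, together with the labelled instruction that it is
an instance of. A store action leaves the buffer without executing an instruction (`none`); it is
linked to an instruction through its issue action, see `IsIssueOf`. -/
structure Event (T L R D : Type*) where
  thread : T
  kind : ActKind D
  inst : Option (LInst L R D)

/-- A TSO state. The valuation is split into registers and memory; buffers list the oldest
address-value pair first. -/
structure TSOState (T L R D : Type*) where
  pc : T → L
  reg : T → R → D
  mem : D → D
  buf : T → List (D × D)

/-- The initial TSO state: initial labels, all registers and addresses `0`, empty buffers. -/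
def TSOState.initial {T L R D : Type*} [Zero D] (P : Program T L R D) : TSOState T L R D where
  pc t := (P t).init
  reg _ _ := 0
  mem _ := 0
  buf _ := []

open Classical in
/-- The most recent value for address `a` in a buffer, if there is one. -/
noncomputable def bufLookup {D : Type*} (b : List (D × D)) (a : D) : Option D :=
  ((b.filter (fun q => decide (q.1 = a))).getLast?).map Prod.snd

open Classical in
/-- Thread `t` moves to label `ℓ`. -/
noncomputable def TSOState.goto {T L R D : Type*} (c : TSOState T L R D) (t : T) (ℓ : L) :
    TSOState T L R D :=
  { c with pc := Function.update c.pc t ℓ }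

open Classical in
/-- Register `r` of thread `t` gets value `v`. -/
noncomputable def TSOState.setReg {T L R D : Type*} (c : TSOState T L R D) (t : T) (r : R) (v : D) :
    TSOState T L R D :=
  { c with reg := Function.update c.reg t (Function.update (c.reg t) r v) }

open Classical in
/-- Address `a` gets value `v`. -/
noncomputable def TSOState.setMem {T L R D : Type*} (c : TSOState T L R D) (a v : D) :
    TSOState T L R D :=
  { c with mem := Function.update c.mem a v }

open Classical in
/-- The buffer of thread `t` is replaced by `b`. -/
noncomputable def TSOState.setBuf {T L R D : Type*} (c : TSOState T L R D) (t : T)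
    (b : List (D × D)) : TSOState T L R D :=
  { c with buf := Function.update c.buf t b }

/-- The TSO transition relation. -/
inductive TSOStep {T L R D : Type*} [Zero D] (P : Program T L R D) :
    TSOState T L R D → Event T L R D → TSOState T L R D → Prop
  | loadBuffer (c : TSOState T L R D) (t : T) (r : R) (e : Expr R D) (ℓ' : L) (v : D)
      (hin : ⟨c.pc t, .load r e, ℓ'⟩ ∈ (P t).code)
      (hv : bufLookup (c.buf t) (e.eval (c.reg t)) = some v) :
      TSOStep P c ⟨t, .ld (e.eval (c.reg t)) v, some ⟨c.pc t, .load r e, ℓ'⟩⟩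
        ((c.setReg t r v).goto t ℓ')
  | loadMemory (c : TSOState T L R D) (t : T) (r : R) (e : Expr R D) (ℓ' : L)
      (hin : ⟨c.pc t, .load r e, ℓ'⟩ ∈ (P t).code)
      (hv : bufLookup (c.buf t) (e.eval (c.reg t)) = none) :
      TSOStep P c
        ⟨t, .ld (e.eval (c.reg t)) (c.mem (e.eval (c.reg t))), some ⟨c.pc t, .load r e, ℓ'⟩⟩
        ((c.setReg t r (c.mem (e.eval (c.reg t)))).goto t ℓ')
  | issue (c : TSOState T L R D) (t : T) (e₁ e₂ : Expr R D) (ℓ' : L)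
      (hin : ⟨c.pc t, .store e₁ e₂, ℓ'⟩ ∈ (P t).code) :
      TSOStep P c ⟨t, .isu, some ⟨c.pc t, .store e₁ e₂, ℓ'⟩⟩
        ((c.setBuf t (c.buf t ++ [(e₁.eval (c.reg t), e₂.eval (c.reg t))])).goto t ℓ')
  | flush (c : TSOState T L R D) (t : T) (a v : D) (β : List (D × D))
      (hb : c.buf t = (a, v) :: β) :
      TSOStep P c ⟨t, .st a v, none⟩ ((c.setMem a v).setBuf t β)
  | mfence (c : TSOState T L R D) (t : T) (ℓ' : L)
      (hin : ⟨c.pc t, .mfence, ℓ'⟩ ∈ (P t).code) (hb : c.buf t = []) :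
      TSOStep P c ⟨t, .loc, some ⟨c.pc t, .mfence, ℓ'⟩⟩ (c.goto t ℓ')
  | assign (c : TSOState T L R D) (t : T) (r : R) (e : Expr R D) (ℓ' : L)
      (hin : ⟨c.pc t, .assign r e, ℓ'⟩ ∈ (P t).code) :
      TSOStep P c ⟨t, .loc, some ⟨c.pc t, .assign r e, ℓ'⟩⟩
        ((c.setReg t r (e.eval (c.reg t))).goto t ℓ')
  | assert (c : TSOState T L R D) (t : T) (e : Expr R D) (ℓ' : L)
      (hin : ⟨c.pc t, .assert e, ℓ'⟩ ∈ (P t).code) (hne : e.eval (c.reg t) ≠ 0) :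
      TSOStep P c ⟨t, .loc, some ⟨c.pc t, .assert e, ℓ'⟩⟩ (c.goto t ℓ')

/-- `TSORun P c τ c'`: the sequence `τ` leads from `c` to `c'`. -/
inductive TSORun {T L R D : Type*} [Zero D] (P : Program T L R D) :
    TSOState T L R D → List (Event T L R D) → TSOState T L R D → Prop
  | nil (c : TSOState T L R D) : TSORun P c [] c
  | cons {c c' c'' : TSOState T L R D} {a : Event T L R D} {τ : List (Event T L R D)}
      (h : TSOStep P c a c') (hτ : TSORun P c' τ c'') : TSORun P c (a :: τ) c''

/-- TSO computations lead from the initial state to a state with empty buffers. -/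
def IsTSOComputation {T L R D : Type*} [Zero D] (P : Program T L R D)
    (τ : List (Event T L R D)) : Prop :=
  ∃ c, TSORun P (TSOState.initial P) τ c ∧ ∀ t, c.buf t = []

/-! ### SC semantics -/

structure SCState (T L R D : Type*) where
  pc : T → L
  reg : T → R → D
  mem : D → D

def SCState.initial {T L R D : Type*} [Zero D] (P : Program T L R D) : SCState T L R D where
  pc t := (P t).init
  reg _ _ := 0
  mem _ := 0

open Classical in
noncomputable def SCState.goto {T L R D : Type*} (c : SCState T L R D) (t : T) (ℓ : L) :
    SCState T L R D :=
  { c with pc := Function.update c.pc t ℓ }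

open Classical in
noncomputable def SCState.setReg {T L R D : Type*} (c : SCState T L R D) (t : T) (r : R) (v : D) :
    SCState T L R D :=
  { c with reg := Function.update c.reg t (Function.update (c.reg t) r v) }

open Classical in
noncomputable def SCState.setMem {T L R D : Type*} (c : SCState T L R D) (a v : D) :
    SCState T L R D :=
  { c with mem := Function.update c.mem a v }

/-- The SC transition relation: loads and stores act on memory directly, fences have no effect. -/
inductive SCStep {T L R D : Type*} [Zero D] (P : Program T L R D) :
    SCState T L R D → SCState T L R D → Prop
  | load (c : SCState T L R D) (t : T) (r : R) (e : Expr R D) (ℓ' : L)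
      (hin : ⟨c.pc t, .load r e, ℓ'⟩ ∈ (P t).code) :
      SCStep P c ((c.setReg t r (c.mem (e.eval (c.reg t)))).goto t ℓ')
  | store (c : SCState T L R D) (t : T) (e₁ e₂ : Expr R D) (ℓ' : L)
      (hin : ⟨c.pc t, .store e₁ e₂, ℓ'⟩ ∈ (P t).code) :
      SCStep P c ((c.setMem (e₁.eval (c.reg t)) (e₂.eval (c.reg t))).goto t ℓ')
  | mfence (c : SCState T L R D) (t : T) (ℓ' : L)
      (hin : ⟨c.pc t, .mfence, ℓ'⟩ ∈ (P t).code) :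
      SCStep P c (c.goto t ℓ')
  | assign (c : SCState T L R D) (t : T) (r : R) (e : Expr R D) (ℓ' : L)
      (hin : ⟨c.pc t, .assign r e, ℓ'⟩ ∈ (P t).code) :
      SCStep P c ((c.setReg t r (e.eval (c.reg t))).goto t ℓ')
  | assert (c : SCState T L R D) (t : T) (e : Expr R D) (ℓ' : L)
      (hin : ⟨c.pc t, .assert e, ℓ'⟩ ∈ (P t).code) (hne : e.eval (c.reg t) ≠ 0) :
      SCStep P c (c.goto t ℓ')

def SCReachable {T L R D : Type*} [Zero D] (P : Program T L R D) (c : SCState T L R D) : Prop :=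
  Relation.ReflTransGen (SCStep P) (SCState.initial P) c

/-! ### The trace of a computation

Actions are referred to by their positions in the computation `τ`. An issue and its store form one
node of the trace; it is represented by the position of the store. -/

section Trace

variable {T L R D : Type*}

/-- Position `i` of `τ` holds an issue action of thread `t`. -/
def IssueAt (τ : List (Event T L R D)) (i : ℕ) (t : T) : Prop :=
  ∃ e, τ[i]? = some e ∧ e.thread = t ∧ e.kind = .isu

/-- Position `i` of `τ` holds a load of thread `t` from address `a`. -/
def LoadAt (τ : List (Event T L R D)) (i : ℕ) (t : T) (a : D) : Prop :=
  ∃ e v, τ[i]? = some e ∧ e.thread = t ∧ e.kind = .ld a v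

/-- Position `i` of `τ` holds a store action of thread `t` to address `a`. -/
def StoreAt (τ : List (Event T L R D)) (i : ℕ) (t : T) (a : D) : Prop :=
  ∃ e v, τ[i]? = some e ∧ e.thread = t ∧ e.kind = .st a v

/-- Position `i` of `τ` holds an action of thread `t`. -/
def ThreadAt (τ : List (Event T L R D)) (i : ℕ) (t : T) : Prop :=
  ∃ e, τ[i]? = some e ∧ e.thread = t

/-- The issue action of thread `t` at position `i` and the store action of `t` at position `s`
correspond to each other. Buffers are FIFO, so the `n`-th issue belongs to the `n`-th store. -/
def IsIssueOf (τ : List (Event T L R D)) (t : T) (i s : ℕ) : Prop :=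
  IssueAt τ i t ∧ (∃ a, StoreAt τ s t a) ∧
    {k | k < i ∧ IssueAt τ k t}.ncard = {k | k < s ∧ ∃ a, StoreAt τ k t a}.ncard

/-- Position `n` represents a node of the trace, which belongs to thread `t` and entered the program
order at position `p`: the issue for stores, the action itself otherwise. -/
def NodeAt (τ : List (Event T L R D)) (t : T) (n p : ℕ) : Prop :=
  IsIssueOf τ t p n ∨
    (n = p ∧ ThreadAt τ n t ∧ ¬ IssueAt τ n t ∧ ¬ ∃ a, StoreAt τ n t a)

/-- Program order (transitive). -/
def ProgOrder (τ : List (Event T L R D)) (m n : ℕ) : Prop :=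
  ∃ t p q, NodeAt τ t m p ∧ NodeAt τ t n q ∧ p < q

/-- Store order (transitive). -/
def StoreOrder (τ : List (Event T L R D)) (m n : ℕ) : Prop :=
  m < n ∧ ∃ a t t', StoreAt τ m t a ∧ StoreAt τ n t' a

/-- The store at `s` is visible to the load at `l` by thread `t` from address `a`: it accesses `a`
and has been performed before the load, or it is a store of `t` issued before the load. -/
def VisibleTo (τ : List (Event T L R D)) (t : T) (a : D) (l s : ℕ) : Prop :=
  (∃ t', StoreAt τ s t' a) ∧ (s < l ∨ ∃ i, IsIssueOf τ t i s ∧ StoreAt τ s t a ∧ i < l)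

/-- Source relation: the load at `l` receives its value from the store at `s`, the last visible
store to its address. A delayed store that the load read early comes after the load in `τ`. -/
def Source (τ : List (Event T L R D)) (s l : ℕ) : Prop :=
  ∃ t a, LoadAt τ l t a ∧ VisibleTo τ t a l s ∧ ∀ s', VisibleTo τ t a l s' → s' ≤ s

/-- Conflict relation: the store at `s` overwrites the value that the load at `l` reads, be it the
value of another store or the initial value. -/
def Conflict (τ : List (Event T L R D)) (l s : ℕ) : Prop :=
  (∃ s', Source τ s' l ∧ StoreOrder τ s' s) ∨
    ((∀ s', ¬ Source τ s' l) ∧ ∃ a t t', LoadAt τ l t a ∧ StoreAt τ s t' a)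

/-- The happens-before relation on the nodes of the trace of `τ`. -/
def HappensBefore (τ : List (Event T L R D)) (m n : ℕ) : Prop :=
  ProgOrder τ m n ∨ StoreOrder τ m n ∨ Source τ m n ∨ Conflict τ m n

/-- `m` happens before `n` through the part of `τ` between `m` and `n`: there is a subsequence
of this part which, with `m` in front and `n` at the end, forms a happens-before path. -/
def HappensBeforeThrough (τ : List (Event T L R D)) : ℕ → ℕ → Prop :=
  Relation.TransGen (fun m n => m < n ∧ HappensBefore τ m n)

/-- The store of thread `t` issued at `i` and performed at `s` is delayed: some action of `t` lies
between issue and store. -/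
def Delayed (τ : List (Event T L R D)) (t : T) (i s : ℕ) : Prop :=
  ∃ k, i < k ∧ k < s ∧ ThreadAt τ k t

end Trace

/-! ### Attacks and TSO witnesses -/

/-- An attack in `P`: a thread, and a store instruction `stFrom: mem[stAdr] ← stVal; goto stTo;`
and a load instruction `ldFrom: ldReg ← mem[ldAdr]; goto ldTo;` of that thread. -/
structure Attack {T L R D : Type*} (P : Program T L R D) where
  attacker : T
  stFrom : L
  stAdr : Expr R D
  stVal : Expr R D
  stTo : L
  st_mem : ⟨stFrom, .store stAdr stVal, stTo⟩ ∈ (P attacker).code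
  ldFrom : L
  ldReg : R
  ldAdr : Expr R D
  ldTo : L
  ld_mem : ⟨ldFrom, .load ldReg ldAdr, ldTo⟩ ∈ (P attacker).code

def Attack.stInst {T L R D : Type*} {P : Program T L R D} (A : Attack P) : LInst L R D :=
  ⟨A.stFrom, .store A.stAdr A.stVal, A.stTo⟩

def Attack.ldInst {T L R D : Type*} {P : Program T L R D} (A : Attack P) : LInst L R D :=
  ⟨A.ldFrom, .load A.ldReg A.ldAdr, A.ldTo⟩

/-- The sequence `τ = τ₁ · isu · τ₂ · ld · τ₃ · st · τ₄` is a TSO witness for the attack `A`.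
The hypotheses `hτ`, `hi`, `hl`, `hs` fix `τ` and the positions `i`, `l`, `s` of `isu`, `ld`, `st`. -/
structure IsTSOWitness {T L R D : Type*} [Zero D] {P : Program T L R D} (A : Attack P)
    (τ τ₁ τ₂ τ₃ τ₄ : List (Event T L R D)) (isu ld st : Event T L R D) (i l s : ℕ) : Prop where
  hτ : τ = τ₁ ++ [isu] ++ τ₂ ++ [ld] ++ τ₃ ++ [st] ++ τ₄
  hi : i = τ₁.length
  hl : l = i + 1 + τ₂.length
  hs : s = l + 1 + τ₃.length
  computation : IsTSOComputation P τ
  /-- Only the attacker delays stores. -/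
  helpers_undelayed : ∀ t p q, t ≠ A.attacker → IsIssueOf τ t p q → ¬ Delayed τ t p q
  /-- `st` is an instance of the store instruction of the attack, issued by `isu`. -/
  isu_inst : isu.inst = some A.stInst
  isu_st : IsIssueOf τ A.attacker i s
  /-- `st` is the first store of the attacker that is delayed. -/
  first_delayed : ∀ p q, p < i → IsIssueOf τ A.attacker p q → ¬ Delayed τ A.attacker p q
  /-- `ld` is an instance of the load instruction of the attack, executed by the attacker. -/
  ld_thread : ld.thread = A.attacker
  ld_inst : ld.inst = some A.ldInst
  /-- `ld` is the last action of the attacker that is overstepped by `st`. -/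
  ld_last : ∀ a ∈ τ₃, a.thread ≠ A.attacker
  /-- Every action of `τ₃ · st` is reached from `ld` by a happens-before path through the
  computation. An issue of a helper counts as one action with its store. -/
  hb_path : ∀ n, l < n → n ≤ s → (∀ t, ¬ IssueAt τ n t) → HappensBeforeThrough τ l n
  /-- `τ₄` consists of the remaining delayed stores of the attacker. -/
  rest_stores : ∀ a ∈ τ₄, a.thread = A.attacker ∧ ∃ b v, a.kind = .st b v
  /-- None of these stores has the address of `ld`. -/
  rest_addresses : ∀ a ∈ τ₄, ∀ b v b' v', a.kind = .st b v → ld.kind = .ld b' v' → b ≠ b'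

/-- An attack is feasible if it has a TSO witness. -/
def Attack.Feasible {T L R D : Type*} [Zero D] {P : Program T L R D} (A : Attack P) : Prop :=
  ∃ τ τ₁ τ₂ τ₃ τ₄ isu ld st i l s, IsTSOWitness A τ τ₁ τ₂ τ₃ τ₄ isu ld st i l s

/-! ### The instrumented program -/

/-- The data domain (and address space) of the instrumented program. -/
inductive IVal (D : Type*) where
  /-- A value or address of the original program. -/
  | val (d : D)
  /-- `(d, δ)`: the auxiliary address for the buffered stores to `d`, or `d` as buffered value. -/
  | delay (d : D)
  /-- `(d, hb)`: the auxiliary address holding the access type of `d`. -/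
  | hb (d : D)
  /-- The address `hb` of the flag that stops the original code of the helpers. -/
  | hbFlag
  /-- The address that keeps the address of the attack's store. -/
  | stAdr
  /-- The address of the success flag. -/
  | success
  /-- The value `true`. -/
  | tt
  /-- Access type: load access. -/
  | lda
  /-- Access type: store access. The access type "no access" is the value `0`. -/
  | sta

instance {D : Type*} [Zero D] : Zero (IVal D) := ⟨.val 0⟩

/-- The underlying value: strips `δ`. -/
def IVal.strip {D : Type*} [Zero D] : IVal D → D
  | .val d => d
  | .delay d => d
  | _ => 0

/-- Position in the order no access < load access < store access. -/
def IVal.rank {D : Type*} : IVal D → ℕ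
  | .lda => 1
  | .sta => 2
  | _ => 0

/-- The maximum of load access and the given access type. -/
def IVal.maxLda {D : Type*} (v : IVal D) : IVal D := if 2 ≤ v.rank then .sta else .lda

open Classical in
/-- Truth values as data: `true`, or `0` for false. -/
noncomputable def IVal.ofProp {D : Type*} [Zero D] (p : Prop) : IVal D := if p then .tt else 0

/-- Registers of the instrumented threads: the original ones and two auxiliary ones. -/
inductive IReg (R : Type*) where
  | orig (r : R)
  | aux
  | aux'

/-- Labels of the instrumented program. The last four families are the fresh intermediate labels of
the translations of the instruction `i`, respectively of the success check at `ℓ`. -/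
inductive ILabel (L R D : Type*) where
  | orig (ℓ : L)
  /-- The label `ℓ` in the code copy. -/
  | tilde (ℓ : L)
  | guard (i : LInst L R D) (k : ℕ)
  | move (i : LInst L R D) (k : ℕ)
  | copy (i : LInst L R D) (k : ℕ)
  | check (ℓ : L) (k : ℕ)

section Instrumentation

variable {T L R D : Type*} [Zero D]

/-- The original expression, over the extended data domain. -/
def Expr.lift (e : Expr R D) : Expr (IReg R) (IVal D) :=
  ⟨e.args.map .orig, fun vs => .val (e.fn (vs.map IVal.strip))⟩

/-- `(e, δ)` -/
def Expr.delay (e : Expr R D) : Expr (IReg R) (IVal D) :=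
  ⟨e.args.map .orig, fun vs => .delay (e.fn (vs.map IVal.strip))⟩

/-- `(e, hb)` -/
def Expr.hb (e : Expr R D) : Expr (IReg R) (IVal D) :=
  ⟨e.args.map .orig, fun vs => .hb (e.fn (vs.map IVal.strip))⟩

/-- A constant. -/
def cst (v : IVal D) : Expr (IReg R) (IVal D) := ⟨[], fun _ => v⟩

/-- A unary function applied to a register. -/
def app (f : IVal D → IVal D) (r : IReg R) : Expr (IReg R) (IVal D) :=
  ⟨[r], fun vs => f (vs.headD 0)⟩

/-- The truth value of a condition on a register. -/
noncomputable def test (p : IVal D → Prop) (r : IReg R) : Expr (IReg R) (IVal D) :=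
  app (fun v => IVal.ofProp (p v)) r

def Inst.lift : Inst R D → Inst (IReg R) (IVal D)
  | .load r e => .load (.orig r) e.lift
  | .store e₁ e₂ => .store e₁.lift e₂.lift
  | .mfence => .mfence
  | .assign r e => .assign (.orig r) e.lift
  | .assert e => .assert e.lift

/-- An instrumented labelled instruction. -/
abbrev ILInst (L R D : Type*) := LInst (ILabel L R D) (IReg R) (IVal D)

/-! Memory reads inside assertions and store expressions are spelled out: the value is first loaded
into an auxiliary register. -/

/-- The attacker's code: original instructions. -/
def attackerOrig (i : LInst L R D) : List (ILInst L R D) :=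
  [⟨.orig i.src, i.inst.lift, .orig i.dst⟩]

/-- The instrumented store of the attack moves the attacker to its code copy. -/
def attackerMoveStore {P : Program T L R D} (A : Attack P) : List (ILInst L R D) :=
  [⟨.orig A.stFrom, .store A.stAdr.delay A.stVal.delay, .move A.stInst 0⟩,
   ⟨.move A.stInst 0, .store (cst .stAdr) A.stAdr.lift, .tilde A.stTo⟩]

/-- The instrumented load of the attack checks that the load does not read its value early, raises
the flag `hb` and records the load access. -/
noncomputable def attackerMoveLoad {P : Program T L R D} (A : Attack P) : List (ILInst L R D) :=
  [⟨.tilde A.ldFrom, .load .aux A.ldAdr.delay, .move A.ldInst 0⟩,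
   ⟨.move A.ldInst 0, .assert (test (· = 0) .aux), .move A.ldInst 1⟩,
   ⟨.move A.ldInst 1, .store (cst .hbFlag) (cst .tt), .move A.ldInst 2⟩,
   ⟨.move A.ldInst 2, .store A.ldAdr.hb (cst .lda), .move A.ldInst 3⟩]

/-- The attacker's code copy: stores go to, and loads preferably come from, the auxiliary addresses
that simulate the buffer; fences are deleted. -/
noncomputable def attackerCopy (i : LInst L R D) : List (ILInst L R D) :=
  match i.inst with
  | .store e₁ e₂ => [⟨.tilde i.src, .store e₁.delay e₂.delay, .tilde i.dst⟩]
  | .load r e =>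
    [⟨.tilde i.src, .load .aux e.delay, .copy i 0⟩,
     ⟨.copy i 0, .assert (test (· = 0) .aux), .copy i 1⟩,
     ⟨.copy i 1, .load (.orig r) e.lift, .tilde i.dst⟩,
     ⟨.tilde i.src, .load .aux e.delay, .copy i 2⟩,
     ⟨.copy i 2, .assert (test (· ≠ 0) .aux), .copy i 3⟩,
     ⟨.copy i 3, .load .aux e.delay, .copy i 4⟩,
     ⟨.copy i 4, .assign (.orig r) (app (fun v => .val v.strip) .aux), .tilde i.dst⟩]
  | .assign r e => [⟨.tilde i.src, .assign (.orig r) e.lift, .tilde i.dst⟩]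
  | .assert e => [⟨.tilde i.src, .assert e.lift, .tilde i.dst⟩]
  | .mfence => []

/-- A helper's original code: an instruction is executed only if the flag `hb` is not raised. -/
noncomputable def helperOrig (i : LInst L R D) : List (ILInst L R D) :=
  [⟨.orig i.src, .load .aux (cst .hbFlag), .guard i 0⟩,
   ⟨.guard i 0, .assert (test (· = 0) .aux), .guard i 1⟩,
   ⟨.guard i 1, i.inst.lift, .orig i.dst⟩]

/-- A helper moves to its code copy by a load whose address has seen a store access, or by a store
whose address has seen some access. -/
noncomputable def helperMove (i : LInst L R D) : List (ILInst L R D) :=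
  match i.inst with
  | .load r e =>
    [⟨.orig i.src, .load .aux e.hb, .move i 0⟩,
     ⟨.move i 0, .assert (test (· = .sta) .aux), .move i 1⟩,
     ⟨.move i 1, .load (.orig r) e.lift, .tilde i.dst⟩]
  | .store e₁ e₂ =>
    [⟨.orig i.src, .load .aux e₁.hb, .move i 0⟩,
     ⟨.move i 0, .assert (test (1 ≤ ·.rank) .aux), .move i 1⟩,
     ⟨.move i 1, .store e₁.lift e₂.lift, .move i 2⟩,
     ⟨.move i 2, .store e₁.hb (cst .sta), .tilde i.dst⟩]
  | _ => []

/-- A helper's code copy: loads and stores maintain the maximal access type of their address. -/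
def helperCopy (i : LInst L R D) : List (ILInst L R D) :=
  match i.inst with
  | .store e₁ e₂ =>
    [⟨.tilde i.src, .store e₁.lift e₂.lift, .copy i 0⟩,
     ⟨.copy i 0, .store e₁.hb (cst .sta), .tilde i.dst⟩]
  | .load r e =>
    [⟨.tilde i.src, .assign .aux e.lift, .copy i 0⟩,
     ⟨.copy i 0, .load (.orig r) (app id .aux), .copy i 1⟩,
     ⟨.copy i 1, .load .aux' (app (fun v => .hb v.strip) .aux), .copy i 2⟩,
     ⟨.copy i 2, .store (app (fun v => .hb v.strip) .aux) (app IVal.maxLda .aux'), .tilde i.dst⟩]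
  | .assign r e => [⟨.tilde i.src, .assign (.orig r) e.lift, .tilde i.dst⟩]
  | .assert e => [⟨.tilde i.src, .assert e.lift, .tilde i.dst⟩]
  | .mfence => [⟨.tilde i.src, .mfence, .tilde i.dst⟩]

/-- At every label of the code copy, a helper may raise the success flag if the address of the
attack's store has been accessed. -/
noncomputable def helperCheck (ℓ : L) : List (ILInst L R D) :=
  [⟨.tilde ℓ, .load .aux (cst .stAdr), .check ℓ 0⟩,
   ⟨.check ℓ 0, .load .aux (app (fun v => .hb v.strip) .aux), .check ℓ 1⟩,
   ⟨.check ℓ 1, .assert (test (· ≠ 0) .aux), .check ℓ 2⟩,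
   ⟨.check ℓ 2, .store (cst .success) (cst .tt), .check ℓ 3⟩]

/-- The labels used by a thread (possibly with repetitions). -/
def Thread.labels (th : Thread L R D) : List L :=
  th.init :: th.code.flatMap (fun i => [i.src, i.dst])

noncomputable def instrumentAttacker {P : Program T L R D} (A : Attack P) :
    Thread (ILabel L R D) (IReg R) (IVal D) where
  init := .orig (P A.attacker).init
  code := (P A.attacker).code.flatMap attackerOrig ++ attackerMoveStore A ++ attackerMoveLoad A ++
    (P A.attacker).code.flatMap attackerCopy

noncomputable def instrumentHelper (th : Thread L R D) :
    Thread (ILabel L R D) (IReg R) (IVal D) where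
  init := .orig th.init
  code := th.code.flatMap helperOrig ++ th.code.flatMap helperMove ++ th.code.flatMap helperCopy ++
    th.labels.flatMap helperCheck

open Classical in
/-- The program instrumented for the attack `A`. -/
noncomputable def Attack.instrument {P : Program T L R D} (A : Attack P) :
    Program T (ILabel L R D) (IReg R) (IVal D) :=
  fun t => if t = A.attacker then instrumentAttacker A else instrumentHelper (P t)

/-- Goal configurations: the success flag is set. -/
def IsGoal (c : SCState T (ILabel L R D) (IReg R) (IVal D)) : Prop := c.mem .success = .tt

end Instrumentation

end TSORobustness

/-! Both directions are simulations between TSO runs of `P` and SC runs of `A.instrument`, organised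
around the three moments `isu`, `ld` and `st` of a witness. Before `isu` no store is delayed, and a
TSO run in which every issue is followed at once by its store is an SC run. Between `isu` and `ld`
the buffer of the attacker is kept in memory: the cell `(a, δ)` holds the newest pending value for
`a`. This is all that a load can observe, and the attacker flushes nothing in this period, so the
order of the buffer does not matter. After `ld` the attacker rests, and the cells `(a, hb)` record
the addresses accessed by `ld` and by the actions that happen after it.

From a goal configuration to a witness. `Phase` is an invariant of all reachable states. Its last
case holds a TSO run up to the load and an SC run of a list `M = ld :: τ₃` that is `Linked`: each
later action shares its thread with an earlier one or is in conflict with one. The access types in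
memory never overstate the accesses of `M` (`AccessType`). A helper does not test the flag and
execute its instruction atomically, so it may still act in its original code after the flag has been
raised. If such an action depends on `M`, it is appended to `M`; otherwise `SCRun.comm` moves it in
front of `ld`. Once the success flag is set, `M` contains an access to the address `x` of the
delayed store. Flushing the attacker's buffer then completes the witness (`Attack.feasible_of_run`).
The required paths come from `AttackTrace.reached`: a shared thread gives program order, a read
after a write gives the source relation, and a write after an access gives store order or conflict.

From a witness to a goal configuration. The witness is followed position by position. Threads that
do not delay are matched with an SC state in which a store is executed only when it is performed
(`Lagging`). By `IsTSOWitness.dependence`, a happens-before edge inside `ld · τ₃ · st` is program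
order of a helper or a conflict on one address. Program order of the attacker is impossible there,
since `st` entered it at `isu`, before `ld`. So a helper acting for the first time after `ld` finds
the access type that its move demands, and afterwards it stays in its copy. The last edge into `st`
exhibits a helper that accessed `x`, and this helper can perform the success check. It remains to
see that `ld` finds no buffered value for its address: the pending stores are `st` and those of
`τ₄`. The latter have other addresses by assumption, and `st` does by `IsTSOWitness.address_ne`,
because a load that reads `st` early cannot reach it by happens-before.

The translation replaces each instruction by boundedly many of proportional size and adds a fixed
check per label, which gives the linear bound. -/

namespace TSORobustness

variable {T L R D : Type*}

/-! ### Counting issues and stores -/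

/-- `e` is an issue action of thread `t`. -/
def Event.IsIssue (t : T) (e : Event T L R D) : Prop := e.thread = t ∧ e.kind = .isu

/-- `e` is a store action of thread `t`. -/
def Event.IsStore (t : T) (e : Event T L R D) : Prop := e.thread = t ∧ ∃ a v, e.kind = .st a v

open Classical in
/-- The number of issue actions of thread `t`. -/
noncomputable def issues (t : T) (τ : List (Event T L R D)) : ℕ :=
  τ.countP (fun e => decide (e.IsIssue t))

open Classical in
/-- The number of store actions of thread `t`. -/
noncomputable def stores (t : T) (τ : List (Event T L R D)) : ℕ :=
  τ.countP (fun e => decide (e.IsStore t))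

theorem issueAt_iff {τ : List (Event T L R D)} {i : ℕ} {t : T} :
    IssueAt τ i t ↔ ∃ e, τ[i]? = some e ∧ e.IsIssue t := Iff.rfl

theorem storeAt_iff {τ : List (Event T L R D)} {i : ℕ} {t : T} :
    (∃ a, StoreAt τ i t a) ↔ ∃ e, τ[i]? = some e ∧ e.IsStore t := by
  constructor
  · rintro ⟨a, e, v, h, ht, hk⟩
    exact ⟨e, h, ht, a, v, hk⟩
  · rintro ⟨e, h, ht, a, v, hk⟩
    exact ⟨a, e, v, h, ht, hk⟩

/-- The ranks compared by `IsIssueOf` are cardinalities of sets of positions; as counts over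
prefixes they can be computed along appends and runs. -/
theorem ncard_positions {α : Type*} (p : α → Prop) [DecidablePred p] (τ : List α) (n : ℕ) :
    {k | k < n ∧ ∃ e, τ[k]? = some e ∧ p e}.ncard = (τ.take n).countP p := by
  induction n with
  | zero => simp
  | succ n ih =>
    rw [List.take_add_one, List.countP_append, ← ih]
    have hfin : {k | k < n ∧ ∃ e, τ[k]? = some e ∧ p e}.Finite :=
      (Set.finite_lt_nat n).subset fun k hk => hk.1
    by_cases h : ∃ e, τ[n]? = some e ∧ p e
    · obtain ⟨e, he, hp⟩ := h
      have : {k | k < n + 1 ∧ ∃ e, τ[k]? = some e ∧ p e} =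
          insert n {k | k < n ∧ ∃ e, τ[k]? = some e ∧ p e} := by
        ext k
        simp only [Set.mem_ofPred_eq, Set.mem_insert_iff]
        constructor
        · rintro ⟨hk, h⟩
          rcases Nat.lt_succ_iff_lt_or_eq.1 hk with hk | hk
          · exact .inr ⟨hk, h⟩
          · exact .inl hk
        · rintro (rfl | ⟨hk, h⟩)
          · exact ⟨Nat.lt_succ_self _, e, he, hp⟩
          · exact ⟨by omega, h⟩
      rw [this, Set.ncard_insert_of_notMem (by simp) hfin, he]
      simp [hp]
    · have : {k | k < n + 1 ∧ ∃ e, τ[k]? = some e ∧ p e} =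
          {k | k < n ∧ ∃ e, τ[k]? = some e ∧ p e} := by
        ext k
        simp only [Set.mem_ofPred_eq]
        constructor
        · rintro ⟨hk, h'⟩
          rcases Nat.lt_succ_iff_lt_or_eq.1 hk with hk | rfl
          · exact ⟨hk, h'⟩
          · exact absurd h' h
        · rintro ⟨hk, h⟩
          exact ⟨by omega, h⟩
      rw [this]
      cases he : τ[n]? with
      | none => simp
      | some e =>
        have : ¬ p e := fun hp => h ⟨e, he, hp⟩
        simp [this]

/-- The form in which FIFO matching is used below. It depends only on the prefixes before the two
positions, so it survives any change of what follows. -/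
theorem isIssueOf_iff {τ : List (Event T L R D)} {t : T} {i s : ℕ} :
    IsIssueOf τ t i s ↔ (∃ e, τ[i]? = some e ∧ e.IsIssue t) ∧ (∃ e, τ[s]? = some e ∧ e.IsStore t) ∧
      issues t (τ.take i) = stores t (τ.take s) := by
  classical
  unfold IsIssueOf issues stores
  simp only [storeAt_iff, issueAt_iff]
  rw [ncard_positions, ncard_positions]

theorem countP_take_succ_of_getElem? {α : Type*} {p : α → Bool} {τ : List α} {q : ℕ} {e : α}
    (h : τ[q]? = some e) : (τ.take (q + 1)).countP p = (τ.take q).countP p + if p e then 1 else 0 := by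
  rw [List.take_add_one, List.countP_append, h]
  simp [List.countP_cons]

theorem countP_take_le {α : Type*} (p : α → Bool) (τ : List α) {m n : ℕ} (h : m ≤ n) :
    (τ.take m).countP p ≤ (τ.take n).countP p :=
  (List.take_sublist_take_left h).countP_le

/-- The element with a given rank among those that satisfy a predicate. -/
theorem exists_getElem?_countP_eq {α : Type*} (p : α → Bool) (τ : List α) {k : ℕ}
    (hk : k < τ.countP p) :
    ∃ q e, τ[q]? = some e ∧ p e ∧ (τ.take q).countP p = k := by
  induction τ generalizing k with
  | nil => simp at hk
  | cons a τ ih =>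
    by_cases ha : p a
    · cases k with
      | zero => exact ⟨0, a, by simp [ha]⟩
      | succ k =>
        obtain ⟨q, e, h1, h2, h3⟩ := ih (k := k) (by simpa [ha] using hk)
        exact ⟨q + 1, e, by simpa using h1, h2, by simp [ha, h3]⟩
    · obtain ⟨q, e, h1, h2, h3⟩ := ih (k := k) (by simpa [ha] using hk)
      exact ⟨q + 1, e, by simpa using h1, h2, by simp [ha, h3]⟩

/-- Elements with equal rank are at the same position. -/
theorem eq_of_countP_take_eq {α : Type*} {p : α → Bool} {τ : List α} {q q' : ℕ} {e e' : α}
    (h : τ[q]? = some e) (h' : τ[q']? = some e') (he : p e) (he' : p e')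
    (heq : (τ.take q).countP p = (τ.take q').countP p) : q = q' := by
  rcases lt_trichotomy q q' with hlt | rfl | hlt
  · have h1 := countP_take_succ_of_getElem? (p := p) h
    have h2 := countP_take_le p τ (Nat.succ_le_of_lt hlt)
    simp only [he, if_true, Nat.succ_eq_add_one] at h1 h2
    omega
  · rfl
  · have h1 := countP_take_succ_of_getElem? (p := p) h'
    have h2 := countP_take_le p τ (Nat.succ_le_of_lt hlt)
    simp only [he', if_true, Nat.succ_eq_add_one] at h1 h2
    omega

open Classical in
-- Two stores matched with one issue have the same rank among the stores of `t`.
theorem IsIssueOf.store_unique {τ : List (Event T L R D)} {t : T} {p q q' : ℕ}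
    (h : IsIssueOf τ t p q) (h' : IsIssueOf τ t p q') : q = q' := by
  rw [isIssueOf_iff] at h h'
  obtain ⟨-, ⟨e, h1, h2⟩, h3⟩ := h
  obtain ⟨-, ⟨e', h1', h2'⟩, h3'⟩ := h'
  refine eq_of_countP_take_eq (p := fun e => decide (e.IsStore t)) h1 h1' (by simpa) (by simpa) ?_
  exact h3.symm.trans h3'

open Classical in
theorem IsIssueOf.issue_unique {τ : List (Event T L R D)} {t : T} {p p' q : ℕ}
    (h : IsIssueOf τ t p q) (h' : IsIssueOf τ t p' q) : p = p' := by
  rw [isIssueOf_iff] at h h'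
  obtain ⟨⟨e, h1, h2⟩, -, h3⟩ := h
  obtain ⟨⟨e', h1', h2'⟩, -, h3'⟩ := h'
  refine eq_of_countP_take_eq (p := fun e => decide (e.IsIssue t)) h1 h1' (by simpa) (by simpa) ?_
  exact h3.trans h3'.symm

theorem issues_append (t : T) (τ σ : List (Event T L R D)) :
    issues t (τ ++ σ) = issues t τ + issues t σ := List.countP_append

theorem stores_append (t : T) (τ σ : List (Event T L R D)) :
    stores t (τ ++ σ) = stores t τ + stores t σ := List.countP_append

theorem stores_eq_zero {t : T} {τ : List (Event T L R D)} :
    stores t τ = 0 ↔ ∀ e ∈ τ, ¬ e.IsStore t := by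
  simp [stores, List.countP_eq_zero]

/-! ### Runs -/

section Runs

variable [Zero D] {P : Program T L R D}

theorem TSORun.append {c c' c'' : TSOState T L R D} {τ σ : List (Event T L R D)}
    (h : TSORun P c τ c') (h' : TSORun P c' σ c'') : TSORun P c (τ ++ σ) c'' := by
  induction h with
  | nil => exact h'
  | cons h _ ih => exact .cons h (ih h')

theorem TSORun.of_append {c c'' : TSOState T L R D} {τ σ : List (Event T L R D)}
    (h : TSORun P c (τ ++ σ) c'') : ∃ c', TSORun P c τ c' ∧ TSORun P c' σ c'' := by
  induction τ generalizing c with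
  | nil => exact ⟨c, .nil c, h⟩
  | cons a τ ih =>
    cases h with
    | cons h hτ =>
      obtain ⟨c', h1, h2⟩ := ih hτ
      exact ⟨c', .cons h h1, h2⟩

theorem TSORun.single {c c' : TSOState T L R D} {e : Event T L R D} (h : TSOStep P c e c') :
    TSORun P c [e] c' := .cons h (.nil c')

theorem TSOStep.buffer_length {c c' : TSOState T L R D} {e : Event T L R D}
    (h : TSOStep P c e c') (t : T) :
    issues t [e] + (c.buf t).length = stores t [e] + (c'.buf t).length := by
  classical
  cases h with
  | loadBuffer t' => simp [issues, stores, Event.IsIssue, Event.IsStore, TSOState.goto, TSOState.setReg]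
  | loadMemory t' => simp [issues, stores, Event.IsIssue, Event.IsStore, TSOState.goto, TSOState.setReg]
  | issue t' =>
    by_cases ht : t' = t
    · subst ht
      simp [issues, stores, Event.IsIssue, Event.IsStore, TSOState.goto, TSOState.setBuf]
      omega
    · simp [issues, stores, Event.IsIssue, Event.IsStore, TSOState.goto, TSOState.setBuf, ht,
        Function.update_of_ne (Ne.symm ht)]
  | flush t' a v β hb =>
    by_cases ht : t' = t
    · subst ht
      simp [issues, stores, Event.IsIssue, Event.IsStore, TSOState.setMem, TSOState.setBuf, hb]
      omega
    · simp [issues, stores, Event.IsIssue, Event.IsStore, TSOState.setMem, TSOState.setBuf, ht,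
        Function.update_of_ne (Ne.symm ht)]
  | mfence t' => simp [issues, stores, Event.IsIssue, Event.IsStore, TSOState.goto]
  | assign t' => simp [issues, stores, Event.IsIssue, Event.IsStore, TSOState.goto, TSOState.setReg]
  | assert t' => simp [issues, stores, Event.IsIssue, Event.IsStore, TSOState.goto]

/-- A buffer holds the stores that have been issued but not performed. -/
theorem TSORun.buffer_length {c c' : TSOState T L R D} {τ : List (Event T L R D)}
    (h : TSORun P c τ c') (t : T) :
    issues t τ + (c.buf t).length = stores t τ + (c'.buf t).length := by
  induction h with
  | nil => simp [issues, stores]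
  | @cons c c' c'' a τ h _ ih =>
    have h1 := h.buffer_length t
    rw [← List.singleton_append, issues_append, stores_append]
    omega

end Runs

/-! ### Labelled SC steps -/

open Classical in
/-- Execution of an instruction on the registers of a thread. -/
inductive Inst.Exec [Zero D] : Inst R D → (R → D) → ActKind D → (R → D) → Prop
  | load (r : R) (e : Expr R D) (ρ : R → D) (v : D) :
      Exec (.load r e) ρ (.ld (e.eval ρ) v) (Function.update ρ r v)
  | store (e₁ e₂ : Expr R D) (ρ : R → D) :
      Exec (.store e₁ e₂) ρ (.st (e₁.eval ρ) (e₂.eval ρ)) ρ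
  | mfence (ρ : R → D) : Exec .mfence ρ .loc ρ
  | assign (r : R) (e : Expr R D) (ρ : R → D) :
      Exec (.assign r e) ρ .loc (Function.update ρ r (e.eval ρ))
  | assert (e : Expr R D) (ρ : R → D) (h : e.eval ρ ≠ 0) : Exec (.assert e) ρ .loc ρ

open Classical in
/-- Effect of an action on the memory under SC. -/
inductive ActKind.Acts : ActKind D → (D → D) → (D → D) → Prop
  | loc (m : D → D) : Acts .loc m m
  | ld (a : D) (m : D → D) : Acts (.ld a (m a)) m m
  | st (a v : D) (m : D → D) : Acts (.st a v) m (Function.update m a v)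

open Classical in
/-- An SC step, labelled by the action performed. -/
structure SCAct [Zero D] (P : Program T L R D) (c : SCState T L R D) (e : Event T L R D)
    (c' : SCState T L R D) (i : LInst L R D) (ρ : R → D) : Prop where
  mem_code : i ∈ (P e.thread).code
  inst_eq : e.inst = some i
  src : c.pc e.thread = i.src
  exec : i.inst.Exec (c.reg e.thread) e.kind ρ
  acts : e.kind.Acts c.mem c'.mem
  pc : c'.pc = Function.update c.pc e.thread i.dst
  reg : c'.reg = Function.update c.reg e.thread ρ

/-- An SC step with action `e`. -/
def SCLStep [Zero D] (P : Program T L R D) (c : SCState T L R D) (e : Event T L R D)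
    (c' : SCState T L R D) : Prop := ∃ i ρ, SCAct P c e c' i ρ

/-- `SCStep` forgets which address was accessed and which value was read; commutation and traces
need this information. -/
theorem SCStep.exists_label [Zero D] {P : Program T L R D} {c c' : SCState T L R D}
    (h : SCStep P c c') : ∃ e, SCLStep P c e c' := by
  classical
  cases h with
  | load t r e ℓ' hin =>
    exact ⟨⟨t, .ld (e.eval (c.reg t)) _, _⟩, ⟨c.pc t, .load r e, ℓ'⟩, _, hin, rfl, rfl,
      .load r e _ _, .ld _ _, rfl, rfl⟩
  | store t e₁ e₂ ℓ' hin =>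
    exact ⟨⟨t, _, _⟩, ⟨c.pc t, .store e₁ e₂, ℓ'⟩, _, hin, rfl, rfl, .store e₁ e₂ _, .st _ _ _, rfl,
      by simp [SCState.goto, SCState.setMem]⟩
  | mfence t ℓ' hin =>
    exact ⟨⟨t, _, _⟩, ⟨c.pc t, .mfence, ℓ'⟩, _, hin, rfl, rfl, .mfence _, .loc _, rfl,
      by simp [SCState.goto]⟩
  | assign t r e ℓ' hin =>
    exact ⟨⟨t, _, _⟩, ⟨c.pc t, .assign r e, ℓ'⟩, _, hin, rfl, rfl, .assign r e _, .loc _, rfl, rfl⟩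
  | assert t e ℓ' hin hne =>
    exact ⟨⟨t, _, _⟩, ⟨c.pc t, .assert e, ℓ'⟩, _, hin, rfl, rfl, .assert e _ hne, .loc _, rfl,
      by simp [SCState.goto]⟩

theorem SCLStep.toSCStep [Zero D] {P : Program T L R D} {c c' : SCState T L R D}
    {e : Event T L R D} (h : SCLStep P c e c') : SCStep P c c' := by
  classical
  obtain ⟨i, ρ, h⟩ := h
  obtain ⟨src, inst, dst⟩ := i
  obtain ⟨hin, -, hsrc, hex, hacts, hpc, hreg⟩ := h
  obtain ⟨t, k, io⟩ := e
  obtain ⟨pc', reg', mem'⟩ := c'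
  simp only at *
  subst hsrc hpc hreg
  cases hex with
  | load r e _ v =>
    cases hacts
    convert SCStep.load c t r e dst hin using 1
    simp [SCState.goto, SCState.setReg]
  | store e₁ e₂ _ =>
    cases hacts
    convert SCStep.store c t e₁ e₂ dst hin using 1
    simp [SCState.goto, SCState.setMem]
  | mfence =>
    cases hacts
    convert SCStep.mfence c t dst hin using 1
    simp [SCState.goto]
  | assign r e =>
    cases hacts
    convert SCStep.assign c t r e dst hin using 1
    simp [SCState.goto, SCState.setReg]
  | assert e _ hne =>
    cases hacts
    convert SCStep.assert c t e dst hin hne using 1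
    simp [SCState.goto]

end TSORobustness

namespace TSORobustness

set_option linter.unusedSectionVars false

variable {T L R D : Type*} [Zero D]

/-! ### Evaluation of the expressions of the instrumented program -/

@[simp] theorem IVal.val_eq_zero {d : D} : IVal.val d = 0 ↔ d = 0 := by
  change IVal.val d = IVal.val 0 ↔ _
  rw [IVal.val.injEq]

@[simp] theorem IVal.delay_ne_zero {d : D} : IVal.delay d ≠ 0 := by
  change IVal.delay d ≠ IVal.val 0
  simp

@[simp] theorem IVal.tt_ne_zero : (IVal.tt : IVal D) ≠ 0 := by
  change IVal.tt ≠ IVal.val 0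
  simp

@[simp] theorem IVal.rank_zero : (0 : IVal D).rank = 0 := rfl

@[simp] theorem IVal.strip_val {d : D} : (IVal.val d).strip = d := rfl

@[simp] theorem IVal.strip_delay {d : D} : (IVal.delay d).strip = d := rfl

theorem IVal.rank_eq_two {v : IVal D} : v.rank = 2 ↔ v = .sta := by
  cases v <;> simp [IVal.rank]

theorem IVal.ne_zero_of_rank {v : IVal D} (h : 1 ≤ v.rank) : v ≠ 0 := by
  rintro rfl
  simp at h

theorem IVal.rank_maxLda (v : IVal D) : v.maxLda.rank = if 2 ≤ v.rank then 2 else 1 := by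
  unfold IVal.maxLda
  split <;> rfl

/-- The original registers hold original values. -/
def RegRel (ρi : IReg R → IVal D) (ρ : R → D) : Prop := ∀ r, ρi (.orig r) = .val (ρ r)

theorem RegRel.map {ρi : IReg R → IVal D} {ρ : R → D} (h : RegRel ρi ρ) (l : List R) :
    ((l.map IReg.orig).map ρi).map IVal.strip = l.map ρ := by
  simp only [List.map_map]
  exact List.map_congr_left fun r _ => by simp [h r]

theorem RegRel.eval_lift {ρi : IReg R → IVal D} {ρ : R → D} (h : RegRel ρi ρ) (e : Expr R D) :
    e.lift.eval ρi = .val (e.eval ρ) := by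
  simp only [Expr.eval, Expr.lift, h.map]

theorem RegRel.eval_delay {ρi : IReg R → IVal D} {ρ : R → D} (h : RegRel ρi ρ) (e : Expr R D) :
    e.delay.eval ρi = .delay (e.eval ρ) := by
  simp only [Expr.eval, Expr.delay, h.map]

theorem RegRel.eval_hb {ρi : IReg R → IVal D} {ρ : R → D} (h : RegRel ρi ρ) (e : Expr R D) :
    e.hb.eval ρi = .hb (e.eval ρ) := by
  simp only [Expr.eval, Expr.hb, h.map]

@[simp] theorem eval_cst (v : IVal D) (ρi : IReg R → IVal D) : (cst v).eval ρi = v := rfl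

@[simp] theorem eval_app (f : IVal D → IVal D) (r : IReg R) (ρi : IReg R → IVal D) :
    (app f r).eval ρi = f (ρi r) := rfl

@[simp] theorem eval_test_ne_zero {p : IVal D → Prop} {r : IReg R} {ρi : IReg R → IVal D} :
    (test p r).eval ρi ≠ 0 ↔ p (ρi r) := by
  unfold test IVal.ofProp
  rw [eval_app]
  split <;> simp [*]

open Classical in
theorem RegRel.update {ρi : IReg R → IVal D} {ρ : R → D} (h : RegRel ρi ρ) (r : R) (v : D) :
    RegRel (Function.update ρi (.orig r) (.val v)) (Function.update ρ r v) := by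
  intro r'
  by_cases hr : r' = r
  · subst hr; simp
  · rw [Function.update_of_ne (by simpa using hr), Function.update_of_ne hr, h]

open Classical in
theorem RegRel.update_aux {ρi : IReg R → IVal D} {ρ : R → D} (h : RegRel ρi ρ) {r : IReg R}
    (hr : ∀ r', r ≠ .orig r') (v : IVal D) : RegRel (Function.update ρi r v) ρ := by
  intro r'
  rw [Function.update_of_ne (hr r').symm, h]

/-- The original addresses hold original values. -/
def MemRel (mi : IVal D → IVal D) (m : D → D) : Prop := ∀ a, mi (.val a) = .val (m a)

open Classical in
theorem MemRel.update {mi : IVal D → IVal D} {m : D → D} (h : MemRel mi m) (a v : D) :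
    MemRel (Function.update mi (.val a) (.val v)) (Function.update m a v) := by
  intro a'
  by_cases ha : a' = a
  · subst ha; simp
  · rw [Function.update_of_ne (by simpa using ha), Function.update_of_ne ha, h]

open Classical in
theorem MemRel.update_aux {mi : IVal D → IVal D} {m : D → D} (h : MemRel mi m) {a : IVal D}
    (ha : ∀ a', a ≠ .val a') (v : IVal D) : MemRel (Function.update mi a v) m := by
  intro a'
  rw [Function.update_of_ne (ha a').symm, h]

/-- The lifted action. -/
def ActKind.lift : ActKind D → ActKind (IVal D)
  | .isu => .isu
  | .loc => .loc
  | .ld a v => .ld (.val a) (.val v)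
  | .st a v => .st (.val a) (.val v)

/-- Lifted instructions are executed only in the way of the original ones. -/
theorem Inst.Exec.of_lift {inst : Inst R D} {ρi ρi' : IReg R → IVal D} {ρ : R → D}
    {mi mi' : IVal D → IVal D} {m : D → D} {k : ActKind (IVal D)}
    (h : inst.lift.Exec ρi k ρi') (hm : k.Acts mi mi') (hr : RegRel ρi ρ) (hmr : MemRel mi m) :
    ∃ k₀ ρ' m', inst.Exec ρ k₀ ρ' ∧ k₀.Acts m m' ∧ k = k₀.lift ∧ RegRel ρi' ρ' ∧ MemRel mi' m' ∧
      (∀ a, (∀ a', a ≠ .val a') → mi' a = mi a) := by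
  classical
  cases inst with
  | load r e =>
    cases h
    cases hm
    refine ⟨_, _, _, .load r e ρ _, .ld _ _, ?_, ?_, hmr, fun _ _ => rfl⟩
    · simp [ActKind.lift, hr.eval_lift, hmr _]
    · rw [hr.eval_lift, hmr]
      convert hr.update r _
  | store e₁ e₂ =>
    cases h
    cases hm
    refine ⟨_, _, _, .store e₁ e₂ ρ, .st _ _ _, ?_, hr, ?_, ?_⟩
    · simp [ActKind.lift, hr.eval_lift]
    · rw [hr.eval_lift, hr.eval_lift]
      exact hmr.update _ _
    · intro a ha
      rw [Function.update_of_ne]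
      rw [hr.eval_lift]
      exact ha _
  | mfence =>
    cases h
    cases hm
    exact ⟨_, _, _, .mfence ρ, .loc _, rfl, hr, hmr, fun _ _ => rfl⟩
  | assign r e =>
    cases h
    cases hm
    refine ⟨_, _, _, .assign r e ρ, .loc _, rfl, ?_, hmr, fun _ _ => rfl⟩
    rw [hr.eval_lift]
    exact hr.update r _
  | assert e =>
    cases h with
    | assert _ _ h =>
    cases hm
    refine ⟨_, _, _, .assert e ρ ?_, .loc _, rfl, hr, hmr, fun _ _ => rfl⟩
    simpa [hr.eval_lift] using h

open Classical in
/-- Lifted instructions can be executed whenever the original ones can. -/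
theorem Inst.Exec.lift {inst : Inst R D} {ρi : IReg R → IVal D} {ρ ρ' : R → D}
    {mi : IVal D → IVal D} {m m' : D → D} {k₀ : ActKind D}
    (h : inst.Exec ρ k₀ ρ') (hm : k₀.Acts m m') (hr : RegRel ρi ρ) (hmr : MemRel mi m) :
    ∃ ρi' mi', inst.lift.Exec ρi k₀.lift ρi' ∧ k₀.lift.Acts mi mi' ∧ RegRel ρi' ρ' ∧
      MemRel mi' m' ∧ (∀ a, (∀ a', a ≠ .val a') → mi' a = mi a) ∧ ρi' .aux = ρi .aux := by
  cases h with
  | load r e _ v =>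
    cases hm
    have h1 := Inst.Exec.load (.orig r) e.lift ρi (.val (m (e.eval ρ)))
    have h2 := ActKind.Acts.ld (.val (e.eval ρ)) mi
    rw [hr.eval_lift] at h1
    rw [hmr] at h2
    exact ⟨_, _, h1, h2, hr.update r _, hmr, fun _ _ => rfl, by simp⟩
  | store e₁ e₂ _ =>
    cases hm
    have h1 := Inst.Exec.store e₁.lift e₂.lift ρi
    rw [hr.eval_lift, hr.eval_lift] at h1
    exact ⟨_, _, h1, .st _ _ mi, hr, hmr.update _ _,
      fun a ha => Function.update_of_ne (ha _) _ _, rfl⟩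
  | mfence => cases hm; exact ⟨_, _, .mfence _, .loc mi, hr, hmr, fun _ _ => rfl, rfl⟩
  | assign r e =>
    cases hm
    have h1 := Inst.Exec.assign (.orig r) e.lift ρi
    rw [hr.eval_lift] at h1
    exact ⟨_, _, h1, .loc mi, hr.update r _, hmr, fun _ _ => rfl, by simp⟩
  | assert e _ hne =>
    cases hm
    exact ⟨_, _, .assert _ _ (by simpa [hr.eval_lift] using hne), .loc mi, hr, hmr,
      fun _ _ => rfl, rfl⟩

/-- The instrumented state `d` represents the memory and the attacker's buffer. -/
structure Represents (d : SCState T (ILabel L R D) (IReg R) (IVal D)) (s : SCState T L R D)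
    (β : List (D × D)) : Prop where
  mem : MemRel d.mem s.mem
  delay : ∀ a, d.mem (.delay a) = ((bufLookup β a).map IVal.delay).getD 0

open Classical in
theorem bufLookup_concat (β : List (D × D)) (a v b : D) :
    bufLookup (β ++ [(a, v)]) b = if b = a then some v else bufLookup β b := by
  unfold bufLookup
  rw [List.filter_append]
  by_cases h : b = a
  · subst h; simp
  · simp [h, Ne.symm h]

theorem bufLookup_eq_none {β : List (D × D)} {a : D} :
    bufLookup β a = none ↔ ∀ q ∈ β, q.1 ≠ a := by
  unfold bufLookup
  simp

theorem Represents.delay_eq_zero {d : SCState T (ILabel L R D) (IReg R) (IVal D)}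
    {s : SCState T L R D} {β : List (D × D)} (h : Represents d s β) {a : D} :
    d.mem (.delay a) = 0 ↔ bufLookup β a = none := by
  rw [h.delay]
  cases bufLookup β a <;> simp

/-! ### Dependence on a sequence of actions -/

/-- Some action of `M` writes to `a`. -/
def Written (M : List (Event T L R D)) (a : D) : Prop := ∃ e ∈ M, ∃ v, e.kind = .st a v

/-- Some action of `M` accesses `a`. -/
def Accessed (M : List (Event T L R D)) (a : D) : Prop :=
  ∃ e ∈ M, ∃ v, e.kind = .ld a v ∨ e.kind = .st a v

/-- Some action of `M` belongs to `t`. -/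
def Acted (M : List (Event T L R D)) (t : T) : Prop := ∃ e ∈ M, e.thread = t

/-- The action `e` shares its thread with an action of `M` or is in conflict with one. -/
def Dependent (M : List (Event T L R D)) (e : Event T L R D) : Prop :=
  Acted M e.thread ∨ (∃ a v, e.kind = .ld a v ∧ Written M a) ∨ ∃ a v, e.kind = .st a v ∧ Accessed M a

section Mono

variable {M M' : List (Event T L R D)}

theorem Written.mono (hM : M ⊆ M') {a : D} : Written M a → Written M' a
  | ⟨e, he, h⟩ => ⟨e, hM he, h⟩

theorem Accessed.mono (hM : M ⊆ M') {a : D} : Accessed M a → Accessed M' a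
  | ⟨e, he, h⟩ => ⟨e, hM he, h⟩

theorem Acted.mono (hM : M ⊆ M') {t : T} : Acted M t → Acted M' t
  | ⟨e, he, h⟩ => ⟨e, hM he, h⟩

theorem Dependent.ne_nil {e : Event T L R D} (h : Dependent M e) : M ≠ [] := by
  rintro rfl
  rcases h with ⟨_, h, _⟩ | ⟨_, _, _, _, h, _⟩ | ⟨_, _, _, _, h, _⟩ <;> simp at h

end Mono

/-! ### Helpers in computations of the instrumented program -/

/-- Invariant for a helper `t` with label `ℓ` and registers `ρ` in the original program, and
registers `ρi` in the instrumented one, depending on its label there. -/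
inductive HelperInv (M : List (Event T L R D)) (x : D) (t : T) (ρi : IReg R → IVal D) (ℓ : L)
    (ρ : R → D) : ILabel L R D → Prop
  | orig : HelperInv M x t ρi ℓ ρ (.orig ℓ)
  | tilde (h : Acted M t) : HelperInv M x t ρi ℓ ρ (.tilde ℓ)
  | guard (inst : Inst R D) (dst : L) (k : ℕ) : HelperInv M x t ρi ℓ ρ (.guard ⟨ℓ, inst, dst⟩ k)
  | moveLoad₀ (r : R) (e : Expr R D) (dst : L) (h : ρi .aux = .sta → Written M (e.eval ρ)) :
      HelperInv M x t ρi ℓ ρ (.move ⟨ℓ, .load r e, dst⟩ 0)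
  | moveLoad₁ (r : R) (e : Expr R D) (dst : L) (h : Written M (e.eval ρ)) :
      HelperInv M x t ρi ℓ ρ (.move ⟨ℓ, .load r e, dst⟩ 1)
  | moveStore₀ (e₁ e₂ : Expr R D) (dst : L) (h : 1 ≤ (ρi .aux).rank → Accessed M (e₁.eval ρ)) :
      HelperInv M x t ρi ℓ ρ (.move ⟨ℓ, .store e₁ e₂, dst⟩ 0)
  | moveStore₁ (e₁ e₂ : Expr R D) (dst : L) (h : Accessed M (e₁.eval ρ)) :
      HelperInv M x t ρi ℓ ρ (.move ⟨ℓ, .store e₁ e₂, dst⟩ 1)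
  | moveStore₂ (src : L) (e₁ e₂ : Expr R D) (ha : Acted M t) (h : Written M (e₁.eval ρ)) :
      HelperInv M x t ρi ℓ ρ (.move ⟨src, .store e₁ e₂, ℓ⟩ 2)
  | copyStore (src : L) (e₁ e₂ : Expr R D) (ha : Acted M t) (h : Written M (e₁.eval ρ)) :
      HelperInv M x t ρi ℓ ρ (.copy ⟨src, .store e₁ e₂, ℓ⟩ 0)
  | copyLoad₀ (r : R) (e : Expr R D) (dst : L) (ha : Acted M t) (h : ρi .aux = .val (e.eval ρ)) :
      HelperInv M x t ρi ℓ ρ (.copy ⟨ℓ, .load r e, dst⟩ 0)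
  | copyLoad₁ (src : L) (r : R) (e : Expr R D) (a : D) (ha : Acted M t) (h : ρi .aux = .val a)
      (hacc : Accessed M a) : HelperInv M x t ρi ℓ ρ (.copy ⟨src, .load r e, ℓ⟩ 1)
  | copyLoad₂ (src : L) (r : R) (e : Expr R D) (a : D) (ha : Acted M t) (h : ρi .aux = .val a)
      (hacc : Accessed M a) (hwr : 2 ≤ (ρi .aux').rank → Written M a) :
      HelperInv M x t ρi ℓ ρ (.copy ⟨src, .load r e, ℓ⟩ 2)
  | check₀ (ℓ' : L) (ha : Acted M t) (h : ρi .aux = .val x) : HelperInv M x t ρi ℓ ρ (.check ℓ' 0)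
  | check₁ (ℓ' : L) (ha : Acted M t) (h : ρi .aux ≠ 0 → Accessed M x) :
      HelperInv M x t ρi ℓ ρ (.check ℓ' 1)
  | check₂ (ℓ' : L) (ha : Acted M t) (h : Accessed M x) : HelperInv M x t ρi ℓ ρ (.check ℓ' 2)
  | check₃ (ℓ' : L) (ha : Acted M t) : HelperInv M x t ρi ℓ ρ (.check ℓ' 3)

/-- Everything noted about `M` is a claim that some action occurs in it, so actions appended by
other helpers invalidate nothing. -/
theorem HelperInv.mono {M M' : List (Event T L R D)} (hM : M ⊆ M') {x : D} {t : T}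
    {ρi : IReg R → IVal D} {ℓ : L} {ρ : R → D} {lab : ILabel L R D}
    (h : HelperInv M x t ρi ℓ ρ lab) : HelperInv M' x t ρi ℓ ρ lab := by
  cases h with
  | orig => exact .orig
  | tilde h => exact .tilde (h.mono hM)
  | guard => exact .guard _ _ _
  | moveLoad₀ _ _ _ h => exact .moveLoad₀ _ _ _ fun h' => (h h').mono hM
  | moveLoad₁ _ _ _ h => exact .moveLoad₁ _ _ _ (h.mono hM)
  | moveStore₀ _ _ _ h => exact .moveStore₀ _ _ _ fun h' => (h h').mono hM
  | moveStore₁ _ _ _ h => exact .moveStore₁ _ _ _ (h.mono hM)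
  | moveStore₂ _ _ _ ha h => exact .moveStore₂ _ _ _ (ha.mono hM) (h.mono hM)
  | copyStore _ _ _ ha h => exact .copyStore _ _ _ (ha.mono hM) (h.mono hM)
  | copyLoad₀ _ _ _ ha h => exact .copyLoad₀ _ _ _ (ha.mono hM) h
  | copyLoad₁ _ _ _ a ha h h' => exact .copyLoad₁ _ _ _ a (ha.mono hM) h (h'.mono hM)
  | copyLoad₂ _ _ _ a ha h h' h'' =>
    exact .copyLoad₂ _ _ _ a (ha.mono hM) h (h'.mono hM) fun hr => (h'' hr).mono hM
  | check₀ _ ha h => exact .check₀ _ (ha.mono hM) h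
  | check₁ _ ha h => exact .check₁ _ (ha.mono hM) fun h' => (h h').mono hM
  | check₂ _ ha h => exact .check₂ _ (ha.mono hM) (h.mono hM)
  | check₃ _ ha => exact .check₃ _ (ha.mono hM)

/-- As long as no action has been recorded, the address of the attack's store is irrelevant. -/
theorem HelperInv.change {x y : D} {t : T} {ρi : IReg R → IVal D} {ℓ : L} {ρ : R → D}
    {lab : ILabel L R D} (h : HelperInv ([] : List (Event T L R D)) x t ρi ℓ ρ lab) :
    HelperInv ([] : List (Event T L R D)) y t ρi ℓ ρ lab := by
  have hf : ¬ Acted ([] : List (Event T L R D)) t := by rintro ⟨_, h, _⟩; simp at h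
  cases h with
  | orig => exact .orig
  | tilde h => exact .tilde h
  | guard => exact .guard _ _ _
  | moveLoad₀ _ _ _ h => exact .moveLoad₀ _ _ _ h
  | moveLoad₁ _ _ _ h => exact .moveLoad₁ _ _ _ h
  | moveStore₀ _ _ _ h => exact .moveStore₀ _ _ _ h
  | moveStore₁ _ _ _ h => exact .moveStore₁ _ _ _ h
  | moveStore₂ _ _ _ ha h => exact absurd ha hf
  | copyStore _ _ _ ha h => exact absurd ha hf
  | copyLoad₀ _ _ _ ha h => exact absurd ha hf
  | copyLoad₁ _ _ _ a ha h h' => exact absurd ha hf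
  | copyLoad₂ _ _ _ a ha h h' h'' => exact absurd ha hf
  | check₀ _ ha h => exact absurd ha hf
  | check₁ _ ha h => exact absurd ha hf
  | check₂ _ ha h => exact absurd ha hf
  | check₃ _ ha => exact absurd ha hf

/-- The value `v` is a correct access type for address `a` after the actions `M`. -/
def AccessType (M : List (Event T L R D)) (a : D) (v : IVal D) : Prop :=
  (v ≠ 0 → Accessed M a) ∧ (2 ≤ v.rank → Written M a)

theorem Written.accessed {M : List (Event T L R D)} {a : D} (h : Written M a) : Accessed M a := by
  obtain ⟨e, he, v, h⟩ := h
  exact ⟨e, he, v, .inr h⟩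

theorem AccessType.mono {M M' : List (Event T L R D)} (hM : M ⊆ M') {a : D} {v : IVal D}
    (h : AccessType M a v) : AccessType M' a v :=
  ⟨fun hv => (h.1 hv).mono hM, fun hv => (h.2 hv).mono hM⟩

/-- Records only have to avoid overstating; after a write even `sta` overstates nothing. -/
theorem Written.accessType {M : List (Event T L R D)} {a : D} (h : Written M a) (v : IVal D) :
    AccessType M a v := ⟨fun _ => h.accessed, fun _ => h⟩

/-- The instrumented state `d` simulates the state `s`, reached by the actions `M` of the load of the
attack and the helpers after it; `x` is the address of the store of the attack. -/
structure Simulates {P : Program T L R D} (A : Attack P) (x : D)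
    (d : SCState T (ILabel L R D) (IReg R) (IVal D)) (s : SCState T L R D)
    (β : List (D × D)) (M : List (Event T L R D)) : Prop extends Represents d s β where
  reg : ∀ t, t ≠ A.attacker → RegRel (d.reg t) (s.reg t)
  helper : ∀ t, t ≠ A.attacker → HelperInv M x t (d.reg t) (s.pc t) (s.reg t) (d.pc t)
  access : ∀ a, AccessType M a (d.mem (.hb a))
  success : d.mem .success = .tt → Accessed M x
  stAdr : M ≠ [] → d.mem .stAdr = .val x

/-- `M` must already be nonempty, since only then does the simulation determine the content of
`stAdr`, which the larger list requires. -/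
theorem Simulates.mono {P : Program T L R D} {A : Attack P} {x : D}
    {d : SCState T (ILabel L R D) (IReg R) (IVal D)} {s : SCState T L R D} {β : List (D × D)}
    {M M' : List (Event T L R D)} (h : Simulates A x d s β M) (hM : M ⊆ M') (hne : M ≠ []) :
    Simulates A x d s β M' where
  toRepresents := h.toRepresents
  reg := h.reg
  helper t ht := (h.helper t ht).mono hM
  access a := (h.access a).mono hM
  success hs := (h.success hs).mono hM
  stAdr _ := h.stAdr hne

/-- Preservation of the simulation by a step of the helper `t`. -/
theorem Simulates.update {P : Program T L R D} {A : Attack P} {x : D}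
    {d d' : SCState T (ILabel L R D) (IReg R) (IVal D)} {s s' : SCState T L R D} {β : List (D × D)}
    {M M' : List (Event T L R D)} (h : Simulates A x d s β M) (t : T) (hM : M ⊆ M')
    (hne : M' ≠ [] → M ≠ [])
    (hpc : ∀ t', t' ≠ t → d'.pc t' = d.pc t') (hreg : ∀ t', t' ≠ t → d'.reg t' = d.reg t')
    (hpcs : ∀ t', t' ≠ t → s'.pc t' = s.pc t') (hregs : ∀ t', t' ≠ t → s'.reg t' = s.reg t')
    (hr : t ≠ A.attacker → RegRel (d'.reg t) (s'.reg t)) (hm : MemRel d'.mem s'.mem)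
    (hd : ∀ a, d'.mem (.delay a) = d.mem (.delay a))
    (hhb : ∀ a, d'.mem (.hb a) = d.mem (.hb a) ∨ AccessType M' a (d'.mem (.hb a)))
    (hsuc : d'.mem .success = d.mem .success ∨ Accessed M' x)
    (hst : d'.mem .stAdr = d.mem .stAdr)
    (hinv : t ≠ A.attacker → HelperInv M' x t (d'.reg t) (s'.pc t) (s'.reg t) (d'.pc t)) :
    Simulates A x d' s' β M' where
  reg t' ht' := by
    by_cases ht : t' = t
    · subst ht
      exact hr ht'
    · rw [hreg t' ht, hregs t' ht]
      exact h.reg t' ht'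
  mem := hm
  delay a := by rw [hd, h.delay]
  helper t' ht' := by
    by_cases ht : t' = t
    · subst ht
      exact hinv ht'
    · rw [hreg t' ht, hregs t' ht, hpc t' ht, hpcs t' ht]
      exact (h.helper t' ht').mono hM
  access a := by
    rcases hhb a with h' | h'
    · rw [h']
      exact (h.access a).mono hM
    · exact h'
  success hs := by
    rcases hsuc with h' | h'
    · exact (h.success (h' ▸ hs)).mono hM
    · exact h'
  stAdr hne' := by rw [hst, h.stAdr (hne hne')]

open Classical in
/-- A step of a helper that has no counterpart in the original program. -/
theorem Simulates.silent {P : Program T L R D} {A : Attack P} {x : D}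
    {d : SCState T (ILabel L R D) (IReg R) (IVal D)} {s : SCState T L R D} {β : List (D × D)}
    {M : List (Event T L R D)} (h : Simulates A x d s β M) (t : T) {lab : ILabel L R D}
    {ρi : IReg R → IVal D} {mi : IVal D → IVal D} (hr : RegRel ρi (s.reg t))
    (hm : ∀ a, (∀ b, a ≠ .hb b) → a ≠ .success → mi a = d.mem a)
    (hhb : ∀ a, mi (.hb a) = d.mem (.hb a) ∨ AccessType M a (mi (.hb a)))
    (hsuc : mi .success = d.mem .success ∨ Accessed M x)
    (hinv : HelperInv M x t ρi (s.pc t) (s.reg t) lab) :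
    Simulates A x ⟨Function.update d.pc t lab, Function.update d.reg t ρi, mi⟩ s β M := by
  refine h.update t (List.Subset.refl M) id (fun t' ht => by simp [ht]) (fun t' ht => by simp [ht])
    (fun _ _ => rfl) (fun _ _ => rfl) (by simpa using fun _ => hr) ?_ ?_ hhb hsuc ?_ ?_
  · intro a
    rw [← h.mem a]
    exact hm _ (by simp) (by simp)
  · exact fun a => hm _ (by simp) (by simp)
  · exact hm _ (by simp) (by simp)
  · simpa using fun _ => hinv

open Classical in
/-- A step of thread `t` that executes the lifted instruction `j`. -/
theorem Simulates.lift {P : Program T L R D} {A : Attack P} {x : D}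
    {d : SCState T (ILabel L R D) (IReg R) (IVal D)} {s : SCState T L R D} {β : List (D × D)}
    {M : List (Event T L R D)} (h : Simulates A x d s β M) (t : T) {j : LInst L R D}
    (hj : j ∈ (P t).code) (hsrc : s.pc t = j.src) (hr : RegRel (d.reg t) (s.reg t)) {k : ActKind (IVal D)}
    {ρi : IReg R → IVal D} {mi : IVal D → IVal D}
    (hex : j.inst.lift.Exec (d.reg t) k ρi) (hacts : k.Acts d.mem mi) :
    ∃ e s' ρ, SCAct P s e s' j ρ ∧ e.thread = t ∧ k = e.kind.lift ∧ RegRel ρi ρ ∧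
      (∀ a, (∀ a', a ≠ .val a') → mi a = d.mem a) ∧ ∀ M' lab, M ⊆ M' → (M' ≠ [] → M ≠ []) →
        (t ≠ A.attacker → HelperInv M' x t ρi j.dst ρ lab) →
        Simulates A x ⟨Function.update d.pc t lab, Function.update d.reg t ρi, mi⟩ s' β M' := by
  obtain ⟨k₀, ρ, m, h1, h2, h3, h4, h5, h6⟩ := hex.of_lift hacts hr h.mem
  refine ⟨⟨t, k₀, some j⟩, ⟨Function.update s.pc t j.dst, Function.update s.reg t ρ, m⟩, ρ,
    ⟨hj, rfl, hsrc, h1, h2, rfl, rfl⟩, rfl, h3, h4, h6, ?_⟩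
  intro M' lab hM hne hinv
  refine h.update t hM hne (fun t' ht => by simp [ht]) (fun t' ht => by simp [ht])
    (fun t' ht => by simp [ht]) (fun t' ht => by simp [ht]) (by simpa using fun _ => h4) h5
    (fun a => h6 _ (by simp)) (fun a => .inl (h6 _ (by simp))) (.inl (h6 _ (by simp)))
    (h6 _ (by simp)) (by simpa using hinv)

theorem instrument_helper {P : Program T L R D} (A : Attack P) {t : T} (ht : t ≠ A.attacker) :
    A.instrument t = instrumentHelper (P t) := if_neg ht

theorem instrument_attacker {P : Program T L R D} (A : Attack P) :
    A.instrument A.attacker = instrumentAttacker A := if_pos rfl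

/-- The possible results of a helper's step in the instrumented program. -/
def HelperResult {P : Program T L R D} (A : Attack P) (x : D) (t : T)
    (d' : SCState T (ILabel L R D) (IReg R) (IVal D)) (s : SCState T L R D) (β : List (D × D))
    (M : List (Event T L R D)) : Prop :=
  Simulates A x d' s β M ∨ ∃ e s', SCLStep P s e s' ∧ e.thread = t ∧
    (Simulates A x d' s' β M ∨ Dependent M e ∧ Simulates A x d' s' β (M ++ [e]))

/-! ### Steps of helpers in the instrumented program, by kind of code. -/

section HelperSteps

variable {P : Program T L R D} {A : Attack P} {x : D}
  {d d' : SCState T (ILabel L R D) (IReg R) (IVal D)} {s : SCState T L R D} {β : List (D × D)}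
  {M : List (Event T L R D)} {e : Event T (ILabel L R D) (IReg R) (IVal D)}
  {i : ILInst L R D} {ρi : IReg R → IVal D}

/-- Testing the flag and executing the instruction are separate steps, so the instruction can still
be executed after the flag has been raised. The invariant therefore ignores the flag. The action is
left unrecorded here, and `Phase.helper_step` decides whether it belongs before or after the load of
the attack. -/
theorem Simulates.helperOrig_step (h : Simulates A x d s β M) (ht : e.thread ≠ A.attacker)
    (hs : SCAct A.instrument d e d' i ρi) {j : LInst L R D} (hj : j ∈ (P e.thread).code)
    (hi : i ∈ helperOrig j) :
    d'.mem .stAdr = d.mem .stAdr ∧ HelperResult A x e.thread d' s β M := by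
  classical
  obtain ⟨t, k, io⟩ := e
  obtain ⟨pc', reg', mem'⟩ := d'
  obtain ⟨src, inst, dst⟩ := j
  obtain ⟨-, -, hsrc, hex, hacts, hpc, hreg⟩ := hs
  have hinv := h.helper t ht
  simp only at *
  subst hpc hreg
  rw [hsrc] at hinv
  simp only [helperOrig, List.mem_cons, List.not_mem_nil, or_false] at hi
  rcases hi with rfl | rfl | rfl
  · cases hinv
    cases hex
    cases hacts
    exact ⟨rfl, .inl (h.silent t ((h.reg t ht).update_aux (by simp) _) (fun _ _ _ => rfl)
      (fun _ => .inl rfl) (.inl rfl) (.guard _ _ _))⟩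
  · cases hinv
    cases hex
    cases hacts
    exact ⟨rfl, .inl (h.silent t (h.reg t ht) (fun _ _ _ => rfl)
      (fun _ => .inl rfl) (.inl rfl) (.guard _ _ _))⟩
  · cases hinv
    obtain ⟨e, s', ρ, h1, h2, h3, h4, h5, h6⟩ := h.lift t hj rfl (h.reg t ht) hex hacts
    refine ⟨h5 _ (by simp), .inr ⟨e, s', ⟨_, _, h1⟩, h2, .inl ?_⟩⟩
    exact h6 M _ (List.Subset.refl M) id fun _ => .orig

end HelperSteps

section HelperSteps

variable {P : Program T L R D} {A : Attack P} {x : D}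
  {d d' : SCState T (ILabel L R D) (IReg R) (IVal D)} {s : SCState T L R D} {β : List (D × D)}
  {M : List (Event T L R D)} {e : Event T (ILabel L R D) (IReg R) (IVal D)}
  {i : ILInst L R D} {ρi : IReg R → IVal D}

theorem ActKind.eq_ld_of_lift {k : ActKind D} {a v : IVal D} (h : ActKind.ld a v = k.lift) :
    ∃ a' v', k = .ld a' v' ∧ a = .val a' ∧ v = .val v' := by
  cases k <;> simp_all [ActKind.lift]

theorem ActKind.eq_st_of_lift {k : ActKind D} {a v : IVal D} (h : ActKind.st a v = k.lift) :
    ∃ a' v', k = .st a' v' ∧ a = .val a' ∧ v = .val v' := by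
  cases k <;> simp_all [ActKind.lift]

theorem acted_concat (M : List (Event T L R D)) (e : Event T L R D) :
    Acted (M ++ [e]) e.thread := ⟨e, by simp, rfl⟩

theorem written_concat (M : List (Event T L R D)) {e : Event T L R D} {a v : D}
    (h : e.kind = .st a v) : Written (M ++ [e]) a := ⟨e, by simp, v, h⟩

theorem accessed_concat (M : List (Event T L R D)) {e : Event T L R D} {a v : D}
    (h : e.kind = .ld a v) : Accessed (M ++ [e]) a := ⟨e, by simp, v, .inl h⟩

/-- The tested access type is sound for `M`, so the access that leads into the copy conflicts with a
recorded action: a load with a write, a store with any access. Hence the action depends on `M` and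
joins it. -/
theorem Simulates.helperMove_step (h : Simulates A x d s β M) (ht : e.thread ≠ A.attacker)
    (hs : SCAct A.instrument d e d' i ρi) {j : LInst L R D} (hj : j ∈ (P e.thread).code)
    (hi : i ∈ helperMove j) :
    d'.mem .stAdr = d.mem .stAdr ∧ HelperResult A x e.thread d' s β M := by
  classical
  obtain ⟨t, k, io⟩ := e
  obtain ⟨pc', reg', mem'⟩ := d'
  obtain ⟨src, inst, dst⟩ := j
  obtain ⟨-, -, hsrc, hex, hacts, hpc, hreg⟩ := hs
  have hinv := h.helper t ht
  simp only at *
  subst hpc hreg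
  rw [hsrc] at hinv
  cases inst with
  | load r e =>
    simp only [helperMove, List.mem_cons, List.not_mem_nil, or_false] at hi
    rcases hi with rfl | rfl | rfl
    · cases hinv
      cases hex
      cases hacts
      refine ⟨rfl, .inl (h.silent t ((h.reg t ht).update_aux (by simp) _) (fun _ _ _ => rfl)
        (fun _ => .inl rfl) (.inl rfl) (.moveLoad₀ _ _ _ fun h' => ?_))⟩
      rw [Function.update_self, (h.reg t ht).eval_hb] at h'
      exact (h.access _).2 (by rw [h']; simp [IVal.rank])
    · cases hinv with
      | moveLoad₀ _ _ _ hw =>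
      cases hex with
      | assert _ _ hne =>
      cases hacts
      exact ⟨rfl, .inl (h.silent t (h.reg t ht) (fun _ _ _ => rfl) (fun _ => .inl rfl) (.inl rfl)
        (.moveLoad₁ _ _ _ (hw (eval_test_ne_zero.1 hne))))⟩
    · cases hinv with
      | moveLoad₁ _ _ _ hw =>
      obtain ⟨e', s', ρ, h1, h2, h3, h4, h5, h6⟩ := h.lift t hj rfl (h.reg t ht) hex hacts
      have hdep : Dependent M e' := by
        cases hex
        obtain ⟨a', v', hk, ha, -⟩ := ActKind.eq_ld_of_lift h3
        rw [(h.reg t ht).eval_lift, IVal.val.injEq] at ha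
        exact .inr (.inl ⟨a', v', hk, ha ▸ hw⟩)
      refine ⟨h5 _ (by simp), .inr ⟨e', s', ⟨_, _, h1⟩, h2, .inr ⟨hdep, ?_⟩⟩⟩
      exact h6 _ _ (List.subset_append_left _ _) (fun _ => hdep.ne_nil)
        fun _ => .tilde (h2 ▸ acted_concat M e')
  | store e₁ e₂ =>
    simp only [helperMove, List.mem_cons, List.not_mem_nil, or_false] at hi
    rcases hi with rfl | rfl | rfl | rfl
    · cases hinv
      cases hex
      cases hacts
      refine ⟨rfl, .inl (h.silent t ((h.reg t ht).update_aux (by simp) _) (fun _ _ _ => rfl)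
        (fun _ => .inl rfl) (.inl rfl) (.moveStore₀ _ _ _ fun h' => ?_))⟩
      rw [Function.update_self, (h.reg t ht).eval_hb] at h'
      exact (h.access _).1 (IVal.ne_zero_of_rank h')
    · cases hinv with
      | moveStore₀ _ _ _ hw =>
      cases hex with
      | assert _ _ hne =>
      cases hacts
      exact ⟨rfl, .inl (h.silent t (h.reg t ht) (fun _ _ _ => rfl) (fun _ => .inl rfl) (.inl rfl)
        (.moveStore₁ _ _ _ (hw (eval_test_ne_zero.1 hne))))⟩
    · cases hinv with
      | moveStore₁ _ _ _ hw =>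
      obtain ⟨e', s', ρ, h1, h2, h3, h4, h5, h6⟩ := h.lift t hj rfl (h.reg t ht) hex hacts
      cases hex
      obtain ⟨a', v', hk, ha, -⟩ := ActKind.eq_st_of_lift h3
      rw [(h.reg t ht).eval_lift, IVal.val.injEq] at ha
      subst ha
      have hdep : Dependent M e' := .inr (.inr ⟨_, v', hk, hw⟩)
      refine ⟨h5 _ (by simp), .inr ⟨e', s', ⟨_, _, h1⟩, h2, .inr ⟨hdep, ?_⟩⟩⟩
      refine h6 _ _ (List.subset_append_left _ _) (fun _ => hdep.ne_nil)
        fun _ => .moveStore₂ _ _ _ (h2 ▸ acted_concat M e') ?_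
      -- A store keeps the registers, and `RegRel` determines the original registers from the
      -- instrumented ones.
      have : ρ = s.reg t := by funext r; simpa [h.reg t ht r] using (h4 r).symm
      rw [this]
      exact written_concat M hk
    · cases hinv with
      | moveStore₂ _ _ _ ha hw =>
      cases hex
      cases hacts
      rw [(h.reg t ht).eval_hb]
      refine ⟨by simp, .inl (h.silent t (h.reg t ht) (fun a ha _ => by simp [ha]) (fun a => ?_)
        (.inl (by simp)) (.tilde ha))⟩
      by_cases ha : a = e₁.eval (s.reg t)
      · exact .inr (ha ▸ hw.accessType _)
      · exact .inl (by simp [ha])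
  | mfence => simp [helperMove] at hi
  | assign => simp [helperMove] at hi
  | assert => simp [helperMove] at hi

open Classical in
-- A helper inside its copy has acted in `M`, so all its further actions depend on `M` by sharing
-- its thread.
theorem Simulates.helperCopy_step (h : Simulates A x d s β M) (ht : e.thread ≠ A.attacker)
    (hs : SCAct A.instrument d e d' i ρi) {j : LInst L R D} (hj : j ∈ (P e.thread).code)
    (hi : i ∈ helperCopy j) :
    d'.mem .stAdr = d.mem .stAdr ∧ HelperResult A x e.thread d' s β M := by
  obtain ⟨t, k, io⟩ := e
  obtain ⟨pc', reg', mem'⟩ := d'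
  obtain ⟨src, inst, dst⟩ := j
  obtain ⟨-, -, hsrc, hex, hacts, hpc, hreg⟩ := hs
  have hinv := h.helper t ht
  simp only at *
  subst hpc hreg
  rw [hsrc] at hinv
  have key : ∀ lab, s.pc t = src → Acted M t → inst.lift.Exec (d.reg t) k ρi →
      (∀ e' ρ, e'.thread = t → inst.Exec (s.reg t) e'.kind ρ → k = e'.kind.lift → RegRel ρi ρ →
        HelperInv (M ++ [e']) x t ρi dst ρ lab) →
      mem' .stAdr = d.mem .stAdr ∧ HelperResult A x t
        ⟨Function.update d.pc t lab, Function.update d.reg t ρi, mem'⟩ s β M := by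
    intro lab hsrc hact hex hinv
    obtain ⟨e', s', ρ, h1, h2, h3, h4, h5, h6⟩ := h.lift t hj hsrc (h.reg t ht) hex hacts
    have hdep : Dependent M e' := .inl (h2 ▸ hact)
    refine ⟨h5 _ (by simp), .inr ⟨e', s', ⟨_, _, h1⟩, h2, .inr ⟨hdep, ?_⟩⟩⟩
    exact h6 _ _ (List.subset_append_left _ _) (fun _ => hdep.ne_nil)
      fun _ => hinv e' ρ h2 (h2 ▸ h1.exec) h3 h4
  cases inst with
  | load r e =>
    simp only [helperCopy, List.mem_cons, List.not_mem_nil, or_false] at hi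
    rcases hi with rfl | rfl | rfl | rfl
    · cases hinv with
      | tilde hact =>
      cases hex
      cases hacts
      refine ⟨rfl, .inl (h.silent t ((h.reg t ht).update_aux (by simp) _) (fun _ _ _ => rfl)
        (fun _ => .inl rfl) (.inl rfl) (.copyLoad₀ _ _ _ hact ?_))⟩
      rw [Function.update_self, (h.reg t ht).eval_lift]
    · cases hinv with
      | copyLoad₀ _ _ _ hact haux =>
      have heval : (app id .aux : Expr (IReg R) (IVal D)).eval (d.reg t) = e.lift.eval (d.reg t) := by
        rw [(h.reg t ht).eval_lift, eval_app, haux, id]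
      refine key _ rfl hact ?_ fun e' ρ h1 h2 h3 h4 => ?_
      · cases hex with
        | load _ _ _ v =>
        rw [heval]
        exact .load (.orig r) e.lift (d.reg t) v
      · cases hex
        obtain ⟨a', v', hk, ha, -⟩ := ActKind.eq_ld_of_lift h3
        rw [eval_app, haux] at ha
        refine .copyLoad₁ _ _ _ _ (h1 ▸ acted_concat M e') ?_ (accessed_concat M hk)
        rw [Function.update_of_ne (by simp), haux]
        exact ha
    · cases hinv with
      | copyLoad₁ _ _ _ a hact haux hacc =>
      cases hex
      cases hacts
      refine ⟨rfl, .inl (h.silent t ((h.reg t ht).update_aux (by simp) _) (fun _ _ _ => rfl)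
        (fun _ => .inl rfl) (.inl rfl) (.copyLoad₂ _ _ _ a hact ?_ hacc fun h' => ?_))⟩
      · rw [Function.update_of_ne (by simp), haux]
      · rw [Function.update_self, eval_app, haux, IVal.strip_val] at h'
        exact (h.access a).2 h'
    · cases hinv with
      | copyLoad₂ _ _ _ a hact haux hacc hwr =>
      cases hex
      cases hacts
      rw [eval_app, eval_app, haux, IVal.strip_val]
      refine ⟨by simp, .inl (h.silent t (h.reg t ht) (fun b hb _ => by simp [hb]) (fun b => ?_)
        (.inl (by simp)) (.tilde hact))⟩
      -- The value in `aux'` may be stale, so this write can lower a type that another helper has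
      -- raised meanwhile. That is harmless here: records must not overstate, but they may
      -- understate.
      by_cases hb : b = a
      · subst hb
        refine .inr ⟨fun _ => hacc, fun h' => hwr ?_⟩
        rw [Function.update_self, IVal.rank_maxLda] at h'
        by_contra hlt
        simp [hlt] at h'
      · exact .inl (by simp [hb])
  | store e₁ e₂ =>
    simp only [helperCopy, List.mem_cons, List.not_mem_nil, or_false] at hi
    rcases hi with rfl | rfl
    · cases hinv with
      | tilde hact =>
      refine key _ rfl hact hex fun e' ρ h1 h2 h3 h4 => ?_
      obtain ⟨t', k', io'⟩ := e'
      simp only at h2 h1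
      subst h1
      cases h2
      exact .copyStore _ _ _ (acted_concat M _) (written_concat M rfl)
    · cases hinv with
      | copyStore _ _ _ hact hw =>
      cases hex
      cases hacts
      rw [(h.reg t ht).eval_hb]
      refine ⟨by simp, .inl (h.silent t (h.reg t ht) (fun a ha _ => by simp [ha]) (fun a => ?_)
        (.inl (by simp)) (.tilde hact))⟩
      by_cases ha : a = e₁.eval (s.reg t)
      · exact .inr (ha ▸ hw.accessType _)
      · exact .inl (by simp [ha])
  | mfence =>
    simp only [helperCopy, List.mem_cons, List.not_mem_nil, or_false] at hi
    subst hi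
    cases hinv with
    | tilde hact =>
    exact key _ rfl hact hex fun e' ρ h1 _ _ _ => .tilde (h1 ▸ acted_concat M e')
  | assign =>
    simp only [helperCopy, List.mem_cons, List.not_mem_nil, or_false] at hi
    subst hi
    cases hinv with
    | tilde hact =>
    exact key _ rfl hact hex fun e' ρ h1 _ _ _ => .tilde (h1 ▸ acted_concat M e')
  | assert =>
    simp only [helperCopy, List.mem_cons, List.not_mem_nil, or_false] at hi
    subst hi
    cases hinv with
    | tilde hact =>
    exact key _ rfl hact hex fun e' ρ h1 _ _ _ => .tilde (h1 ▸ acted_concat M e')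

theorem Acted.ne_nil {t : T} (h : Acted M t) : M ≠ [] := by
  rintro rfl
  obtain ⟨_, h, _⟩ := h
  simp at h

/-- Being in the copy implies `M ≠ []`, so `stAdr` holds `x`; a nonzero access type of `x` then
proves the access that justifies the success flag. -/
theorem Simulates.helperCheck_step (h : Simulates A x d s β M) (ht : e.thread ≠ A.attacker)
    (hs : SCAct A.instrument d e d' i ρi) {ℓ : L} (hi : i ∈ helperCheck ℓ) :
    d'.mem .stAdr = d.mem .stAdr ∧ HelperResult A x e.thread d' s β M := by
  classical
  obtain ⟨t, k, io⟩ := e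
  obtain ⟨pc', reg', mem'⟩ := d'
  obtain ⟨-, -, hsrc, hex, hacts, hpc, hreg⟩ := hs
  have hinv := h.helper t ht
  simp only at *
  subst hpc hreg
  rw [hsrc] at hinv
  simp only [helperCheck, List.mem_cons, List.not_mem_nil, or_false] at hi
  rcases hi with rfl | rfl | rfl | rfl
  · cases hinv with
    | tilde hact =>
    cases hex
    cases hacts
    refine ⟨rfl, .inl (h.silent t ((h.reg t ht).update_aux (by simp) _) (fun _ _ _ => rfl)
      (fun _ => .inl rfl) (.inl rfl) (.check₀ _ hact ?_))⟩
    rw [Function.update_self, eval_cst, h.stAdr hact.ne_nil]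
  · cases hinv with
    | check₀ _ hact haux =>
    cases hex
    cases hacts
    refine ⟨rfl, .inl (h.silent t ((h.reg t ht).update_aux (by simp) _) (fun _ _ _ => rfl)
      (fun _ => .inl rfl) (.inl rfl) (.check₁ _ hact fun h' => ?_))⟩
    rw [Function.update_self, eval_app, haux] at h'
    exact (h.access x).1 h'
  · cases hinv with
    | check₁ _ hact haux =>
    cases hex with
    | assert _ _ hne =>
    cases hacts
    exact ⟨rfl, .inl (h.silent t (h.reg t ht) (fun _ _ _ => rfl)
      (fun _ => .inl rfl) (.inl rfl) (.check₂ _ hact (haux (eval_test_ne_zero.1 hne))))⟩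
  · cases hinv with
    | check₂ _ hact hacc =>
    cases hex
    cases hacts
    rw [eval_cst, eval_cst]
    exact ⟨by simp, .inl (h.silent t (h.reg t ht) (fun a _ ha => by simp [ha])
      (fun a => .inl (by simp)) (.inr hacc) (.check₃ _ hact))⟩

/-- That `stAdr` is unchanged is stated separately because the attacker's invariant refers to its
content. -/
theorem Simulates.helper_step (h : Simulates A x d s β M) (ht : e.thread ≠ A.attacker)
    (hs : SCAct A.instrument d e d' i ρi) :
    d'.mem .stAdr = d.mem .stAdr ∧ HelperResult A x e.thread d' s β M := by
  have hc := hs.mem_code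
  rw [instrument_helper A ht] at hc
  simp only [instrumentHelper, List.mem_append, List.mem_flatMap] at hc
  rcases hc with ((⟨j, hj, hi⟩ | ⟨j, hj, hi⟩) | ⟨j, hj, hi⟩) | ⟨ℓ, -, hi⟩
  · exact h.helperOrig_step ht hs hj hi
  · exact h.helperMove_step ht hs hj hi
  · exact h.helperCopy_step ht hs hj hi
  · exact h.helperCheck_step ht hs hi

end HelperSteps

/-! ### Runs of labelled SC steps and their commutation -/

/-- A sequence of labelled SC steps. -/
inductive SCRun (P : Program T L R D) :
    SCState T L R D → List (Event T L R D) → SCState T L R D → Prop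
  | nil (s : SCState T L R D) : SCRun P s [] s
  | cons {s s' s'' : SCState T L R D} {e : Event T L R D} {M : List (Event T L R D)}
      (h : SCLStep P s e s') (hM : SCRun P s' M s'') : SCRun P s (e :: M) s''

theorem SCRun.concat {P : Program T L R D} {s s' s'' : SCState T L R D} {e : Event T L R D}
    {M : List (Event T L R D)} (h : SCRun P s M s') (he : SCLStep P s' e s'') :
    SCRun P s (M ++ [e]) s'' := by
  induction h with
  | nil => exact .cons he (.nil _)
  | cons h _ ih => exact .cons h (ih he)

/-- The action `k'` does not write what `k` reads, nor read or write what `k` writes. -/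
def ActKind.Independent (k k' : ActKind D) : Prop :=
  (∀ a v, k = .ld a v → ∀ v', k' ≠ .st a v') ∧
    ∀ a v, k = .st a v → ∀ v', k' ≠ .ld a v' ∧ k' ≠ .st a v'

/-- Two actions can be exchanged unless they share an address that one of them writes. The value
read by a load is part of its kind, so the exchange preserves it too. -/
theorem ActKind.Acts.comm {k k' : ActKind D} {m m' m'' : D → D} (h : k'.Acts m m')
    (h' : k.Acts m' m'') (hi : k.Independent k') : ∃ n, k.Acts m n ∧ k'.Acts n m'' := by
  classical
  cases h with
  | loc => exact ⟨m'', h', .loc _⟩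
  | ld a =>
    cases h' with
    | loc => exact ⟨_, .loc _, .ld _ _⟩
    | ld b => exact ⟨_, .ld _ _, .ld _ _⟩
    | st b v =>
      refine ⟨_, .st _ _ _, ?_⟩
      have hab : a ≠ b := by
        rintro rfl
        exact (hi.2 _ _ rfl _).1 rfl
      have := ActKind.Acts.ld a (Function.update m b v)
      rwa [Function.update_of_ne hab] at this
  | st a w =>
    cases h' with
    | loc => exact ⟨_, .loc _, .st _ _ _⟩
    | ld b =>
      have hab : b ≠ a := by
        rintro rfl
        exact hi.1 _ _ rfl _ rfl
      rw [Function.update_of_ne hab]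
      exact ⟨_, .ld _ _, .st _ _ _⟩
    | st b v =>
      have hab : a ≠ b := by
        rintro rfl
        exact (hi.2 _ _ rfl _).2 rfl
      refine ⟨_, .st _ _ _, ?_⟩
      rw [Function.update_comm hab]
      exact .st _ _ _

/-- Different threads have separate labels and registers, so only the effects on memory have to
commute. -/
theorem SCLStep.comm {P : Program T L R D} {s s' s'' : SCState T L R D} {e e' : Event T L R D}
    (h : SCLStep P s e' s') (h' : SCLStep P s' e s'') (ht : e.thread ≠ e'.thread)
    (hi : e.kind.Independent e'.kind) : ∃ u, SCLStep P s e u ∧ SCLStep P u e' s'' := by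
  classical
  obtain ⟨i, ρ, h⟩ := h
  obtain ⟨i', ρ', h'⟩ := h'
  obtain ⟨n, hn, hn'⟩ := h.acts.comm h'.acts hi
  refine ⟨⟨Function.update s.pc e.thread i'.dst, Function.update s.reg e.thread ρ', n⟩,
    ⟨i', ρ', h'.mem_code, h'.inst_eq, ?_, ?_, hn, rfl, rfl⟩,
    ⟨i, ρ, h.mem_code, h.inst_eq, ?_, ?_, hn', ?_, ?_⟩⟩
  · rw [← h'.src, h.pc, Function.update_of_ne ht]
  · have := h'.exec
    rwa [h.reg, Function.update_of_ne ht] at this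
  · simpa [ht.symm] using h.src
  · simpa [ht.symm] using h.exec
  · rw [h'.pc, h.pc, Function.update_comm ht.symm]
  · rw [h'.reg, h.reg, Function.update_comm ht.symm]

/-- An action that does not depend on the actions before it can be executed before them. -/
theorem SCRun.comm {P : Program T L R D} {s s' s'' : SCState T L R D} {e : Event T L R D}
    {M : List (Event T L R D)} (h : SCRun P s M s') (he : SCLStep P s' e s'')
    (hd : ¬ Dependent M e) : ∃ u, SCLStep P s e u ∧ SCRun P u M s'' := by
  induction h with
  | nil => exact ⟨_, he, .nil _⟩
  | @cons s s₁ s' a M h hM ih =>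
    obtain ⟨u, hu, hu'⟩ := ih he fun hd' => hd <| by
      have hM := List.subset_cons_self a M
      rcases hd' with h | ⟨b, v, h, h'⟩ | ⟨b, v, h, h'⟩
      · exact .inl (h.mono hM)
      · exact .inr (.inl ⟨b, v, h, h'.mono hM⟩)
      · exact .inr (.inr ⟨b, v, h, h'.mono hM⟩)
    obtain ⟨w, hw, hw'⟩ := h.comm hu (fun heq => hd (.inl ⟨a, by simp, heq.symm⟩)) <| by
      constructor
      · intro b v hk v' hk'
        exact hd (.inr (.inl ⟨b, v, hk, a, by simp, v', hk'⟩))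
      · intro b v hk v'
        constructor
        · exact fun hk' => hd (.inr (.inr ⟨b, v, hk, a, by simp, v', .inl hk'⟩))
        · exact fun hk' => hd (.inr (.inr ⟨b, v, hk, a, by simp, v', .inr hk'⟩))
    exact ⟨w, hw, .cons hw' hu'⟩

/-- Every action of `M` but the first one depends on the actions before it. -/
def Linked (M : List (Event T L R D)) : Prop :=
  ∀ xs e ys, M = xs ++ e :: ys → xs ≠ [] → Dependent xs e

theorem Linked.concat {M : List (Event T L R D)} {e : Event T L R D} (h : Linked M)
    (he : Dependent M e) : Linked (M ++ [e]) := by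
  intro xs a ys heq hne
  rcases List.eq_nil_or_concat ys with rfl | ⟨zs, b, rfl⟩
  · obtain ⟨rfl, h2⟩ := List.append_inj' heq rfl
    simp only [List.cons.injEq, and_true] at h2
    exact h2 ▸ he
  · rw [List.concat_eq_append, ← List.cons_append, ← List.append_assoc] at heq
    exact h xs a zs (List.append_inj' heq rfl).1 hne

/-! ### From SC steps to TSO runs -/

/-- The TSO state with the given buffers. -/
def SCState.withBuf (s : SCState T L R D) (b : T → List (D × D)) : TSOState T L R D :=
  ⟨s.pc, s.reg, s.mem, b⟩

open Classical in
/-- The buffers if only thread `t` has delayed stores. -/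
noncomputable def soleBuf (t : T) (β : List (D × D)) : T → List (D × D) :=
  Function.update (fun _ => []) t β

/-- The TSO actions for an SC action: a store is preceded by its issue. -/
def Event.expand (e : Event T L R D) : List (Event T L R D) :=
  match e.kind with
  | .st a v => [⟨e.thread, .isu, e.inst⟩, ⟨e.thread, .st a v, none⟩]
  | _ => [e]

/-- With an empty buffer a thread acts on memory directly. A store does so by an issue and an
immediate flush, which empties the buffer again. -/
theorem SCAct.run {P : Program T L R D} {s s' : SCState T L R D} {e : Event T L R D}
    {i : LInst L R D} {ρ : R → D} (h : SCAct P s e s' i ρ) (b : T → List (D × D))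
    (hb : b e.thread = []) : TSORun P (s.withBuf b) e.expand (s'.withBuf b) := by
  obtain ⟨src, inst, dst⟩ := i
  obtain ⟨hin, hio, hsrc, hex, hacts, hpc, hreg⟩ := h
  obtain ⟨t, k, io⟩ := e
  obtain ⟨pc', reg', mem'⟩ := s'
  simp only at *
  subst hsrc hpc hreg hio
  cases hex with
  | load r e _ v =>
    cases hacts
    exact .single (.loadMemory (s.withBuf b) t r e dst hin (by simp [SCState.withBuf, hb, bufLookup]))
  | store e₁ e₂ _ =>
    cases hacts
    refine .cons (.issue (s.withBuf b) t e₁ e₂ dst hin) (.single ?_)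
    convert TSOStep.flush _ t (e₁.eval (s.reg t)) (e₂.eval (s.reg t)) [] _ using 1
    · simp [SCState.withBuf, TSOState.goto, TSOState.setBuf, TSOState.setMem, ← hb]
    · simp [SCState.withBuf, TSOState.goto, TSOState.setBuf, hb]
  | mfence =>
    cases hacts
    simp only [Function.update_eq_self]
    exact .single (.mfence (s.withBuf b) t dst hin hb)
  | assign r e =>
    cases hacts
    exact .single (.assign (s.withBuf b) t r e dst hin)
  | assert e _ hne =>
    cases hacts
    simp only [Function.update_eq_self]
    exact .single (.assert (s.withBuf b) t e dst hin hne)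

/-- Loads from the memory and local actions other than fences are possible with a nonempty buffer. -/
theorem SCAct.step_of_lookup {P : Program T L R D} {s s' : SCState T L R D} {e : Event T L R D}
    {i : LInst L R D} {ρ : R → D} (h : SCAct P s e s' i ρ) (b : T → List (D × D))
    (hb : (∃ a v, e.kind = .ld a v ∧ bufLookup (b e.thread) a = none) ∨
      e.kind = .loc ∧ i.inst ≠ .mfence) : TSOStep P (s.withBuf b) e (s'.withBuf b) := by
  obtain ⟨src, inst, dst⟩ := i
  obtain ⟨hin, hio, hsrc, hex, hacts, hpc, hreg⟩ := h
  obtain ⟨t, k, io⟩ := e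
  obtain ⟨pc', reg', mem'⟩ := s'
  simp only at *
  subst hsrc hpc hreg hio
  cases hex with
  | load r e _ v =>
    cases hacts
    refine .loadMemory (s.withBuf b) t r e dst hin ?_
    rcases hb with ⟨a, v, h, hb⟩ | ⟨h, -⟩
    · cases h
      exact hb
    · cases h
  | store e₁ e₂ _ => simp at hb
  | mfence => simp at hb
  | assign r e =>
    cases hacts
    exact .assign (s.withBuf b) t r e dst hin
  | assert e _ hne =>
    cases hacts
    simp only [Function.update_eq_self]
    exact .assert (s.withBuf b) t e dst hin hne

/-- In `τ` every issue of `t` is immediately followed by its store, and all stores of `t` are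
preceded by their issue. -/
inductive Paired (t : T) : List (Event T L R D) → Prop
  | nil : Paired t []
  | other {e : Event T L R D} {τ : List (Event T L R D)} (hi : ¬ e.IsIssue t) (hs : ¬ e.IsStore t)
      (h : Paired t τ) : Paired t (e :: τ)
  | pair {e e' : Event T L R D} {τ : List (Event T L R D)} (hi : e.IsIssue t) (hs : e'.IsStore t)
      (h : Paired t τ) : Paired t (e :: e' :: τ)

theorem Paired.append {t : T} {τ σ : List (Event T L R D)} (h : Paired t τ) (h' : Paired t σ) :
    Paired t (τ ++ σ) := by
  induction h with
  | nil => exact h'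
  | other hi hs _ ih => exact .other hi hs ih
  | pair hi hs _ ih => exact .pair hi hs ih

theorem Event.expand_paired {e : Event T L R D} (he : e.kind ≠ .isu) (t : T) :
    Paired t e.expand := by
  obtain ⟨t', k, io⟩ := e
  cases k with
  | isu => exact absurd rfl he
  | loc => exact .other (by simp [IsIssue]) (by simp [IsStore]) .nil
  | ld => exact .other (by simp [IsIssue]) (by simp [IsStore]) .nil
  | st a v =>
    by_cases ht : t' = t
    · exact .pair ⟨ht, rfl⟩ ⟨ht, a, v, rfl⟩ .nil
    · exact .other (by simp [IsIssue, ht]) (by simp [IsStore]) <|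
        .other (by simp [IsIssue]) (by simp [IsStore, ht]) .nil

theorem SCAct.kind_ne_isu {P : Program T L R D} {s s' : SCState T L R D} {e : Event T L R D}
    {i : LInst L R D} {ρ : R → D} (h : SCAct P s e s' i ρ) : e.kind ≠ .isu := by
  intro hk
  have := h.exec
  rw [hk] at this
  generalize i.inst = inst at this
  cases this

theorem Event.expand_thread {e e' : Event T L R D} (h : e' ∈ e.expand) : e'.thread = e.thread := by
  obtain ⟨t', k, io⟩ := e
  cases k <;> simp [expand] at h
  case st => rcases h with rfl | rfl <;> rfl
  all_goals exact h ▸ rfl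

theorem Paired.counts {t : T} {τ : List (Event T L R D)} (h : Paired t τ) :
    issues t τ = stores t τ := by
  classical
  induction h with
  | nil => rfl
  | other hi hs _ ih =>
    simp only [issues, stores, List.countP_cons] at ih ⊢
    simp [hi, hs, ih]
  | @pair e e' τ hi hs _ ih =>
    have h1 : ¬ e.IsStore t := by rintro ⟨_, a, v, h⟩; rw [hi.2] at h; cases h
    have h2 : ¬ e'.IsIssue t := by
      rintro ⟨_, h⟩
      obtain ⟨_, a, v, h'⟩ := hs
      rw [h'] at h; cases h
    simp only [issues, stores, List.countP_cons] at ih ⊢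
    simp [hi, hs, ih, h1, h2]

/-- Between blocks of an issue and its store the two counts agree, so the store that ends a block
has the rank of the issue that starts it. -/
theorem Paired.at_issue {t : T} {τ : List (Event T L R D)} (h : Paired t τ) {p : ℕ}
    {e : Event T L R D} (he : τ[p]? = some e) (hi : e.IsIssue t) :
    (∃ e', τ[p + 1]? = some e' ∧ e'.IsStore t) ∧
      issues t (τ.take p) = stores t (τ.take (p + 1)) := by
  classical
  induction h generalizing p with
  | nil => simp at he
  | @other a τ hi' hs' _ ih =>
    cases p with
    | zero =>
      simp only [List.getElem?_cons_zero, Option.some.injEq] at he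
      exact absurd (he ▸ hi) hi'
    | succ p =>
      obtain ⟨h1, h2⟩ := ih (by simpa using he)
      refine ⟨by simpa using h1, ?_⟩
      simp only [issues, stores, List.take_succ_cons, List.countP_cons] at h2 ⊢
      simp [h2, hi', hs']
  | @pair a a' τ hi' hs' _ ih =>
    have h1 : ¬ a.IsStore t := by rintro ⟨_, a, v, h⟩; rw [hi'.2] at h; cases h
    have h2 : ¬ a'.IsIssue t := by
      rintro ⟨_, h⟩
      obtain ⟨_, a, v, h'⟩ := hs'
      rw [h'] at h; cases h
    match p with
    | 0 =>
      refine ⟨⟨a', by simp, hs'⟩, ?_⟩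
      simp [issues, stores, h1]
    | 1 =>
      simp only [List.getElem?_cons_succ, List.getElem?_cons_zero, Option.some.injEq] at he
      exact absurd (he ▸ hi) h2
    | p + 2 =>
      obtain ⟨h3, h4⟩ := ih (p := p) (by simpa using he)
      refine ⟨by simpa using h3, ?_⟩
      simp only [issues, stores, List.take_succ_cons, List.countP_cons] at h4 ⊢
      simp [h4, hi', hs', h1, h2]

/-- Where issues are followed by their stores, no other store belongs to them. -/
theorem Paired.eq_succ {t : T} {τ σ : List (Event T L R D)} (h : Paired t τ) {p q : ℕ}
    (hp : p < τ.length) (hpq : IsIssueOf (τ ++ σ) t p q) : q = p + 1 := by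
  refine hpq.store_unique ?_
  rw [isIssueOf_iff] at hpq ⊢
  obtain ⟨⟨e, he, hi⟩, -, -⟩ := hpq
  have he' := he
  rw [List.getElem?_append_left hp] at he'
  obtain ⟨⟨e', h1, h2⟩, h3⟩ := h.at_issue he' hi
  have hlt : p + 1 < τ.length := by
    by_contra hge
    rw [List.getElem?_eq_none (by omega)] at h1
    cases h1
  refine ⟨⟨e, he, hi⟩, ⟨e', by rw [List.getElem?_append_left hlt, h1], h2⟩, ?_⟩
  rw [List.take_append_of_le_length hp.le, List.take_append_of_le_length hlt.le, h3]

/-- Matching looks only at prefixes, so the continuation `σ` plays no role. -/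
theorem Paired.isIssueOf_succ {t : T} {τ σ : List (Event T L R D)} (h : Paired t τ) {p : ℕ}
    (hp : p < τ.length) (hi : IssueAt (τ ++ σ) p t) : IsIssueOf (τ ++ σ) t p (p + 1) := by
  obtain ⟨e, he, hi⟩ := hi
  have he' := he
  rw [List.getElem?_append_left hp] at he'
  obtain ⟨⟨e', h1, h2⟩, h3⟩ := h.at_issue he' hi
  have hlt : p + 1 < τ.length := by
    by_contra hge
    rw [List.getElem?_eq_none (by omega)] at h1
    cases h1
  refine isIssueOf_iff.2 ⟨⟨e, he, hi⟩, ⟨e', by rw [List.getElem?_append_left hlt, h1], h2⟩, ?_⟩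
  rw [List.take_append_of_le_length hp.le, List.take_append_of_le_length hlt.le, h3]

/-! ### The attacker in computations of the instrumented program -/

open Classical in
theorem issue_step {P : Program T L R D} (s : SCState T L R D) (t : T) (β : List (D × D))
    (e₁ e₂ : Expr R D) (dst : L) (hin : ⟨s.pc t, .store e₁ e₂, dst⟩ ∈ (P t).code) :
    TSOStep P (s.withBuf (soleBuf t β)) ⟨t, .isu, some ⟨s.pc t, .store e₁ e₂, dst⟩⟩
      (SCState.withBuf ⟨Function.update s.pc t dst, s.reg, s.mem⟩
        (soleBuf t (β ++ [(e₁.eval (s.reg t), e₂.eval (s.reg t))]))) := by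
  convert TSOStep.issue (s.withBuf (soleBuf t β)) t e₁ e₂ dst hin using 1
  · simp [SCState.withBuf]
  · simp [SCState.withBuf, TSOState.goto, TSOState.setBuf, soleBuf]

open Classical in
theorem loadBuffer_step {P : Program T L R D} (s : SCState T L R D) (t : T) (β : List (D × D))
    (r : R) (e : Expr R D) (dst : L) (hin : ⟨s.pc t, .load r e, dst⟩ ∈ (P t).code) {v : D}
    (hv : bufLookup β (e.eval (s.reg t)) = some v) :
    TSOStep P (s.withBuf (soleBuf t β))
      ⟨t, .ld (e.eval (s.reg t)) v, some ⟨s.pc t, .load r e, dst⟩⟩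
      (SCState.withBuf ⟨Function.update s.pc t dst,
        Function.update s.reg t (Function.update (s.reg t) r v), s.mem⟩ (soleBuf t β)) :=
  .loadBuffer (s.withBuf (soleBuf t β)) t r e dst v hin (by simpa [SCState.withBuf, soleBuf])

/-- Invariant for the attacker between the issue of the delayed store and the load of the attack,
depending on its label in the instrumented program; `y` is the value at the address `stAdr`. -/
inductive AttackerInv {P : Program T L R D} (A : Attack P) (x : D) (β : List (D × D)) (y : IVal D)
    (ρi : IReg R → IVal D) (ℓ : L) (ρ : R → D) : ILabel L R D → Prop
  | moveStore (hℓ : ℓ = A.stTo) (h : A.stAdr.eval ρ = x) :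
      AttackerInv A x β y ρi ℓ ρ (.move ⟨A.stFrom, .store A.stAdr A.stVal, A.stTo⟩ 0)
  | tilde (ℓ' : L) (hy : y = .val x) (hℓ : ℓ = ℓ') : AttackerInv A x β y ρi ℓ ρ (.tilde ℓ')
  | moveLoad₀ (hy : y = .val x) (hℓ : ℓ = A.ldFrom)
      (h : ρi .aux = 0 → bufLookup β (A.ldAdr.eval ρ) = none) :
      AttackerInv A x β y ρi ℓ ρ (.move ⟨A.ldFrom, .load A.ldReg A.ldAdr, A.ldTo⟩ 0)
  | moveLoad (k : ℕ) (hy : y = .val x) (hℓ : ℓ = A.ldFrom)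
      (h : bufLookup β (A.ldAdr.eval ρ) = none) :
      AttackerInv A x β y ρi ℓ ρ (.move ⟨A.ldFrom, .load A.ldReg A.ldAdr, A.ldTo⟩ (k + 1))
  | copyLoad₀ (ℓ' dst : L) (r : R) (e : Expr R D) (hy : y = .val x) (hℓ : ℓ = ℓ')
      (h : ρi .aux = 0 → bufLookup β (e.eval ρ) = none) :
      AttackerInv A x β y ρi ℓ ρ (.copy ⟨ℓ', .load r e, dst⟩ 0)
  | copyLoad₁ (ℓ' dst : L) (r : R) (e : Expr R D) (hy : y = .val x) (hℓ : ℓ = ℓ')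
      (h : bufLookup β (e.eval ρ) = none) :
      AttackerInv A x β y ρi ℓ ρ (.copy ⟨ℓ', .load r e, dst⟩ 1)
  | copyLoad₂ (ℓ' dst : L) (r : R) (e : Expr R D) (hy : y = .val x) (hℓ : ℓ = ℓ')
      (h : ρi .aux ≠ 0 → bufLookup β (e.eval ρ) ≠ none) :
      AttackerInv A x β y ρi ℓ ρ (.copy ⟨ℓ', .load r e, dst⟩ 2)
  | copyLoad₃ (ℓ' dst : L) (r : R) (e : Expr R D) (hy : y = .val x) (hℓ : ℓ = ℓ')
      (h : bufLookup β (e.eval ρ) ≠ none) :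
      AttackerInv A x β y ρi ℓ ρ (.copy ⟨ℓ', .load r e, dst⟩ 3)
  | copyLoad₄ (ℓ' dst : L) (r : R) (e : Expr R D) (v : D) (hy : y = .val x) (hℓ : ℓ = ℓ')
      (h : bufLookup β (e.eval ρ) = some v) (haux : ρi .aux = .delay v) :
      AttackerInv A x β y ρi ℓ ρ (.copy ⟨ℓ', .load r e, dst⟩ 4)

/-- A TSO run in which the attacker has issued the store of the attack and delays its stores. -/
structure Delaying {P : Program T L R D} (A : Attack P) (β : List (D × D))
    (τ₁ : List (Event T L R D)) (isu : Event T L R D) (τ₂ : List (Event T L R D))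
    (s : SCState T L R D) : Prop where
  run : TSORun P (.initial P) (τ₁ ++ [isu] ++ τ₂) (s.withBuf (soleBuf A.attacker β))
  paired₁ : ∀ t, Paired t τ₁
  isIssue : isu.IsIssue A.attacker
  isu_inst : isu.inst = some A.stInst
  paired₂ : ∀ t, t ≠ A.attacker → Paired t τ₂
  no_store : ∀ e ∈ τ₂, ¬ e.IsStore A.attacker

/-- The reachable states of the instrumented program: the attacker is in its original code, in its
code copy, or has executed the load of the attack. -/
inductive Phase {P : Program T L R D} (A : Attack P)
    (d : SCState T (ILabel L R D) (IReg R) (IVal D)) : Prop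
  | original (s : SCState T L R D) (τ : List (Event T L R D))
      (run : TSORun P (.initial P) τ (s.withBuf (soleBuf A.attacker [])))
      (paired : ∀ t, Paired t τ) (x : D) (sim : Simulates A x d s [] [])
      (reg : RegRel (d.reg A.attacker) (s.reg A.attacker))
      (pc : d.pc A.attacker = .orig (s.pc A.attacker)) : Phase A d
  | delaying (s : SCState T L R D) (τ₁ : List (Event T L R D)) (isu : Event T L R D)
      (τ₂ : List (Event T L R D)) (x v : D) (β : List (D × D))
      (run : Delaying A ((x, v) :: β) τ₁ isu τ₂ s) (sim : Simulates A x d s ((x, v) :: β) [])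
      (reg : RegRel (d.reg A.attacker) (s.reg A.attacker))
      (inv : AttackerInv A x ((x, v) :: β) (d.mem .stAdr) (d.reg A.attacker) (s.pc A.attacker)
        (s.reg A.attacker) (d.pc A.attacker)) : Phase A d
  | loaded (s₁ s : SCState T L R D) (τ₁ : List (Event T L R D)) (isu : Event T L R D)
      (τ₂ : List (Event T L R D)) (x v : D) (β : List (D × D)) (ld : Event T L R D)
      (τ₃ : List (Event T L R D)) (a w : D)
      (run : Delaying A ((x, v) :: β) τ₁ isu τ₂ s₁) (run' : SCRun P s₁ (ld :: τ₃) s)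
      (ld_thread : ld.thread = A.attacker) (ld_inst : ld.inst = some A.ldInst)
      (ld_kind : ld.kind = .ld a w) (lookup : bufLookup ((x, v) :: β) a = none)
      (helpers : ∀ e ∈ τ₃, e.thread ≠ A.attacker) (linked : Linked (ld :: τ₃))
      (sim : Simulates A x d s ((x, v) :: β) (ld :: τ₃))
      (pc : d.pc A.attacker = .move A.ldInst 3) : Phase A d

/-! ### Preservation of the phases by helpers. -/

section Steps

variable {P : Program T L R D} {A : Attack P} {x : D}
  {d d' : SCState T (ILabel L R D) (IReg R) (IVal D)} {s s' : SCState T L R D} {β : List (D × D)}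
  {M : List (Event T L R D)} {e : Event T L R D}

/-- Helpers have empty buffers, so an SC step of a helper is a TSO run with its store directly
behind the issue; the attacker's buffer is untouched. -/
theorem Delaying.helper {τ₁ τ₂ : List (Event T L R D)} {isu : Event T L R D}
    (h : Delaying A β τ₁ isu τ₂ s) (hs : SCLStep P s e s') (ht : e.thread ≠ A.attacker) :
    Delaying A β τ₁ isu (τ₂ ++ e.expand) s' where
  run := by
    obtain ⟨i, ρ, hs⟩ := hs
    rw [← List.append_assoc]
    exact h.run.append (hs.run _ (by simp [soleBuf, ht]))
  paired₁ := h.paired₁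
  isIssue := h.isIssue
  isu_inst := h.isu_inst
  paired₂ t ht' := by
    obtain ⟨i, ρ, hs⟩ := hs
    exact (h.paired₂ t ht').append (Event.expand_paired hs.kind_ne_isu t)
  no_store e' he' := by
    rcases List.mem_append.1 he' with h' | h'
    · exact h.no_store e' h'
    · exact fun h'' => ht (Event.expand_thread h' ▸ h''.1)

theorem Delaying.attacker {τ₁ τ₂ : List (Event T L R D)} {isu : Event T L R D}
    {β' : List (D × D)} (h : Delaying A β τ₁ isu τ₂ s)
    (hs : TSOStep P (s.withBuf (soleBuf A.attacker β)) e (s'.withBuf (soleBuf A.attacker β')))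
    (ht : e.thread = A.attacker) (hk : ∀ a v, e.kind ≠ .st a v) :
    Delaying A β' τ₁ isu (τ₂ ++ [e]) s' where
  run := by
    rw [← List.append_assoc]
    exact h.run.append (.single hs)
  paired₁ := h.paired₁
  isIssue := h.isIssue
  isu_inst := h.isu_inst
  paired₂ t ht' := (h.paired₂ t ht').append <|
    .other (fun h => ht' (h.1 ▸ ht)) (fun h => ht' (h.1 ▸ ht)) .nil
  no_store e' he' := by
    rcases List.mem_append.1 he' with h' | h'
    · exact h.no_store e' h'
    · rw [List.mem_singleton] at h'
      subst h'
      rintro ⟨-, a, v, h⟩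
      exact hk a v h

open Classical in
-- Before the load nothing is recorded, and the helper's action simply extends the TSO run. After
-- it, the action extends `τ₃` if it depends on `ld :: τ₃`, and is otherwise shifted in front of the
-- load, where it extends `τ₂`.
theorem Phase.helper_step (h : Phase A d) {e : Event T (ILabel L R D) (IReg R) (IVal D)}
    (ht : e.thread ≠ A.attacker) (hs : SCLStep A.instrument d e d') : Phase A d' := by
  obtain ⟨i, ρi, hs⟩ := hs
  have hpc : d'.pc A.attacker = d.pc A.attacker := by rw [hs.pc, Function.update_of_ne ht.symm]
  have hreg : d'.reg A.attacker = d.reg A.attacker := by rw [hs.reg, Function.update_of_ne ht.symm]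
  have hpc' : ∀ {s s' : SCState T L R D} {e' : Event T L R D}, SCLStep P s e' s' →
      e'.thread = e.thread →
      s'.pc A.attacker = s.pc A.attacker ∧ s'.reg A.attacker = s.reg A.attacker := by
    rintro s s' e' ⟨_, _, hs'⟩ he
    rw [hs'.pc, hs'.reg, he, Function.update_of_ne ht.symm, Function.update_of_ne ht.symm]
    exact ⟨rfl, rfl⟩
  cases h with
  | original s τ run paired x sim reg pc =>
    obtain ⟨hst, hres⟩ := sim.helper_step ht hs
    rcases hres with hres | ⟨e', s', hs', he', hres⟩
    · exact .original s τ run paired x hres (hreg ▸ reg) (hpc ▸ pc)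
    · obtain ⟨h1, h2⟩ := hpc' hs' he'
      -- Nothing depends on an empty list, which rules out the recorded alternative.
      have hres : Simulates A x d' s' [] [] := by
        rcases hres with hres | ⟨hdep, -⟩
        · exact hres
        · exact absurd rfl hdep.ne_nil
      obtain ⟨j, ρ, hs'⟩ := hs'
      refine .original s' (τ ++ e'.expand) (run.append (hs'.run _ ?_)) (fun t => ?_) x hres ?_ ?_
      · simp [soleBuf]
      · exact (paired t).append (Event.expand_paired hs'.kind_ne_isu t)
      · rw [hreg, h2]
        exact reg
      · rw [hpc, h1]
        exact pc
  | delaying s τ₁ isu τ₂ x v β run sim reg inv =>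
    obtain ⟨hst, hres⟩ := sim.helper_step ht hs
    rcases hres with hres | ⟨e', s', hs', he', hres⟩
    · exact .delaying s τ₁ isu τ₂ x v β run hres (hreg ▸ reg) (by rwa [hst, hreg, hpc])
    · obtain ⟨h1, h2⟩ := hpc' hs' he'
      have hres : Simulates A x d' s' ((x, v) :: β) [] := by
        rcases hres with hres | ⟨hdep, -⟩
        · exact hres
        · exact absurd rfl hdep.ne_nil
      exact .delaying s' τ₁ isu _ x v β (run.helper hs' (he' ▸ ht)) hres (by rwa [hreg, h2])
        (by rwa [hst, hreg, hpc, h1, h2])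
  | loaded s₁ s τ₁ isu τ₂ x v β ld τ₃ a w run run' ld_thread ld_inst ld_kind lookup helpers linked
      sim pc =>
    obtain ⟨-, hres⟩ := sim.helper_step ht hs
    rcases hres with hres | ⟨e', s', hs', he', hres⟩
    · exact .loaded s₁ s τ₁ isu τ₂ x v β ld τ₃ a w run run' ld_thread ld_inst ld_kind lookup helpers
        linked hres (hpc ▸ pc)
    -- The distinction is by dependence, not by the code that was executed: an instruction of the
    -- original code with a passed guard can be of either kind.
    · by_cases hdep : Dependent (ld :: τ₃) e'
      · have hres : Simulates A x d' s' ((x, v) :: β) (ld :: (τ₃ ++ [e'])) := by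
          rcases hres with hres | ⟨-, hres⟩
          · exact hres.mono (by simp) (by simp)
          · exact hres
        refine .loaded s₁ s' τ₁ isu τ₂ x v β ld (τ₃ ++ [e']) a w run (run'.concat hs') ld_thread
          ld_inst ld_kind lookup ?_ (linked.concat hdep) hres (hpc ▸ pc)
        intro e'' he''
        rcases List.mem_append.1 he'' with h' | h'
        · exact helpers e'' h'
        · rw [List.mem_singleton.1 h', he']
          exact ht
      · have hres : Simulates A x d' s' ((x, v) :: β) (ld :: τ₃) := by
          rcases hres with hres | ⟨h', -⟩
          · exact hres
          · exact absurd h' hdep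
        -- The load and `τ₃` are replayed after the shifted action, with the same labels and hence
        -- the same values.
        obtain ⟨u, hu, hu'⟩ := run'.comm hs' hdep
        exact .loaded u s' τ₁ isu (τ₂ ++ e'.expand) x v β ld τ₃ a w (run.helper hu (he' ▸ ht)) hu'
          ld_thread ld_inst ld_kind lookup helpers linked hres (hpc ▸ pc)

open Classical in
/-- Preservation of the simulation by a step of the attacker before the load of the attack. -/
theorem Simulates.attacker_step (h : Simulates A x d s β []) {y : D} {β' : List (D × D)}
    {lab : ILabel L R D} {ρi : IReg R → IVal D} {mi : IVal D → IVal D}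
    (hpcs : ∀ t, t ≠ A.attacker → s'.pc t = s.pc t)
    (hregs : ∀ t, t ≠ A.attacker → s'.reg t = s.reg t)
    (hm : MemRel mi s'.mem)
    (hd : ∀ a, mi (.delay a) = ((bufLookup β' a).map IVal.delay).getD 0)
    (hhb : ∀ a, mi (.hb a) = d.mem (.hb a)) (hsuc : mi .success = d.mem .success) :
    Simulates A y ⟨Function.update d.pc A.attacker lab, Function.update d.reg A.attacker ρi, mi⟩ s'
      β' [] where
  mem := hm
  delay := hd
  reg t ht := by
    rw [hregs t ht]
    simpa [ht] using h.reg t ht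
  helper t ht := by
    rw [hregs t ht, hpcs t ht]
    simpa [ht] using (h.helper t ht).change
  access a := by
    simp only [hhb]
    exact h.access a
  success hs := by
    obtain ⟨_, h', _⟩ := h.success (hsuc ▸ hs)
    simp at h'
  stAdr h' := absurd rfl h'

open Classical in
-- Overwriting the cell `(a, δ)` affects lookups as appending to the buffer does, because only the
-- newest entry for an address is ever read.
theorem delay_update {mi : IVal D → IVal D} {β : List (D × D)}
    (h : ∀ a, mi (.delay a) = ((bufLookup β a).map IVal.delay).getD 0) (a v b : D) :
    Function.update mi (.delay a) (.delay v) (.delay b) =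
      ((bufLookup (β ++ [(a, v)]) b).map IVal.delay).getD 0 := by
  rw [bufLookup_concat]
  by_cases hb : b = a
  · subst hb; simp
  · simp [hb, h]

theorem Phase.initial : Phase A (SCState.initial A.instrument) := by
  -- The address `0` is a dummy: `x` means nothing before the store of the attack has been issued.
  refine .original (SCState.initial P) [] ?_ (fun _ => .nil) 0 ⟨⟨fun _ => rfl, fun _ => rfl⟩,
    fun _ _ _ => rfl, ?_, ?_, ?_, fun h => absurd rfl h⟩ (fun _ => rfl) ?_
  · convert TSORun.nil _ using 1
    simp [SCState.withBuf, soleBuf, SCState.initial, TSOState.initial]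
  · intro t ht
    simp only [SCState.initial, instrument_helper A ht]
    exact .orig
  · intro a
    exact ⟨fun h => absurd rfl h, fun h => by simp [SCState.initial] at h⟩
  · intro h
    exact absurd h.symm IVal.tt_ne_zero
  · simp only [SCState.initial, instrument_attacker]
    rfl

end Steps

/-! ### Steps of the attacker and the invariant of reachable states. -/

section Steps

variable {P : Program T L R D} {A : Attack P} {x : D}
  {d d' : SCState T (ILabel L R D) (IReg R) (IVal D)} {s s' : SCState T L R D} {β : List (D × D)}
  {e : Event T (ILabel L R D) (IReg R) (IVal D)} {i : ILInst L R D} {ρi : IReg R → IVal D}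

theorem ActKind.Acts.eq_of_ne_st {k : ActKind D} {m m' : D → D} (h : k.Acts m m')
    (hk : ∀ a v, k ≠ .st a v) : m' = m := by
  cases h with
  | loc => rfl
  | ld => rfl
  | st a v => exact absurd rfl (hk a v)

section Inversion

variable {y : IVal D} {ℓ : L} {ρ : R → D}

theorem AttackerInv.of_moveStore
    (h : AttackerInv A x β y ρi ℓ ρ (.move ⟨A.stFrom, .store A.stAdr A.stVal, A.stTo⟩ 0)) :
    ℓ = A.stTo ∧ A.stAdr.eval ρ = x := by
  generalize hlab : (ILabel.move _ _ : ILabel L R D) = lab at h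
  cases h <;> simp at hlab
  exact ⟨by assumption, by assumption⟩

theorem AttackerInv.of_tilde {ℓ' : L} (h : AttackerInv A x β y ρi ℓ ρ (.tilde ℓ')) :
    y = .val x ∧ ℓ = ℓ' := by
  cases h with
  | tilde _ h1 h2 => exact ⟨h1, h2⟩

theorem AttackerInv.of_moveLoad₀
    (h : AttackerInv A x β y ρi ℓ ρ (.move ⟨A.ldFrom, .load A.ldReg A.ldAdr, A.ldTo⟩ 0)) :
    y = .val x ∧ ℓ = A.ldFrom ∧ (ρi .aux = 0 → bufLookup β (A.ldAdr.eval ρ) = none) := by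
  generalize hlab : (ILabel.move _ _ : ILabel L R D) = lab at h
  cases h <;> simp at hlab
  exact ⟨by assumption, by assumption, by assumption⟩

theorem AttackerInv.of_moveLoad {k : ℕ}
    (h : AttackerInv A x β y ρi ℓ ρ (.move ⟨A.ldFrom, .load A.ldReg A.ldAdr, A.ldTo⟩ (k + 1))) :
    y = .val x ∧ ℓ = A.ldFrom ∧ bufLookup β (A.ldAdr.eval ρ) = none := by
  generalize hlab : (ILabel.move _ _ : ILabel L R D) = lab at h
  cases h <;> simp at hlab
  exact ⟨by assumption, by assumption, by assumption⟩

end Inversion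

theorem mem_instrumentAttacker (hs : SCAct A.instrument d e d' i ρi) (ht : e.thread = A.attacker) :
    (∃ j ∈ (P A.attacker).code, i ∈ attackerOrig j) ∨ i ∈ attackerMoveStore A ∨
      i ∈ attackerMoveLoad A ∨ ∃ j ∈ (P A.attacker).code, i ∈ attackerCopy j := by
  have hc := hs.mem_code
  rw [ht, instrument_attacker] at hc
  simp only [instrumentAttacker, List.mem_append, List.mem_flatMap] at hc
  simpa only [or_assoc] using hc

open Classical in
-- The attacker either acts undelayed or takes the first instruction of the moved store, which is
-- the point where `P` issues the store of the attack. All other code starts at labels outside the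
-- original code.
theorem Phase.attacker_step_original {τ : List (Event T L R D)}
    (run : TSORun P (.initial P) τ (s.withBuf (soleBuf A.attacker [])))
    (paired : ∀ t, Paired t τ) (sim : Simulates A x d s [] [])
    (reg : RegRel (d.reg A.attacker) (s.reg A.attacker))
    (pc : d.pc A.attacker = .orig (s.pc A.attacker))
    (ht : e.thread = A.attacker) (hs : SCAct A.instrument d e d' i ρi) : Phase A d' := by
  have hc := mem_instrumentAttacker hs ht
  obtain ⟨t, k, io⟩ := e
  obtain ⟨pc', reg', mem'⟩ := d'
  obtain ⟨-, -, hsrc, hex, hacts, hpc, hreg⟩ := hs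
  simp only at *
  subst ht hpc hreg
  rw [pc] at hsrc
  rcases hc with ⟨j, hj, hi⟩ | hi | hi | ⟨j, hj, hi⟩
  · simp only [attackerOrig, List.mem_singleton] at hi
    subst hi
    obtain ⟨k₀, ρ, m, h1, h2, h3, h4, h5, h6⟩ := hex.of_lift hacts reg sim.mem
    have hact : SCAct P s ⟨A.attacker, k₀, some j⟩ ⟨Function.update s.pc A.attacker j.dst,
        Function.update s.reg A.attacker ρ, m⟩ j ρ :=
      ⟨hj, rfl, by simpa using hsrc, h1, h2, rfl, rfl⟩
    refine .original _ (τ ++ Event.expand ⟨A.attacker, k₀, some j⟩)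
      (run.append (hact.run _ (by simp [soleBuf]))) (fun t => ?_) x ?_ ?_ ?_
    · exact (paired t).append (Event.expand_paired hact.kind_ne_isu t)
    · refine sim.attacker_step (fun t ht => by simp [ht]) (fun t ht => by simp [ht]) h5 ?_ ?_ ?_
      · intro a
        rw [h6 _ (by simp), sim.delay]
      · exact fun a => h6 _ (by simp)
      · exact h6 _ (by simp)
    · simpa using h4
    · simp
  · simp only [attackerMoveStore, List.mem_cons, List.not_mem_nil, or_false] at hi
    rcases hi with rfl | rfl
    · cases hex
      cases hacts
      rw [reg.eval_delay, reg.eval_delay]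
      have hsrc : s.pc A.attacker = A.stFrom := by simpa using hsrc
      have hin := A.st_mem
      rw [← hsrc] at hin
      have hstep := issue_step s A.attacker [] A.stAdr A.stVal A.stTo hin
      -- From here on `x` is the address just evaluated. Replacing the old `x` is sound because no
      -- action has been recorded.
      refine .delaying _ τ ⟨A.attacker, .isu, some ⟨s.pc A.attacker, .store A.stAdr A.stVal, A.stTo⟩⟩ [] (A.stAdr.eval (s.reg A.attacker))
        (A.stVal.eval (s.reg A.attacker)) [] ⟨?_, paired, ⟨rfl, rfl⟩, ?_, fun _ _ => .nil, by simp⟩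
        (sim.attacker_step (s' := ⟨Function.update s.pc A.attacker A.stTo, s.reg, s.mem⟩) (fun t ht => ?_) (fun t ht => rfl)
        (sim.mem.update_aux (by simp) _) ?_ (fun a => by simp) (by simp)) ?_ ?_
      · rw [List.append_nil]
        exact run.append (.single hstep)
      · rw [hsrc]
        rfl
      · exact Function.update_of_ne ht _ _
      · exact delay_update sim.delay _ _
      · simpa using reg
      · simpa [Attack.stInst] using
          AttackerInv.moveStore (A := A) (x := A.stAdr.eval (s.reg A.attacker))
            (β := [(A.stAdr.eval (s.reg A.attacker), A.stVal.eval (s.reg A.attacker))])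
            (y := d.mem .stAdr) (ρi := d.reg A.attacker) (ℓ := A.stTo)
            (ρ := s.reg A.attacker) rfl rfl
    · simp at hsrc
  · simp only [attackerMoveLoad, List.mem_cons, List.not_mem_nil, or_false] at hi
    rcases hi with rfl | rfl | rfl | rfl <;> simp at hsrc
  · obtain ⟨src, inst, dst⟩ := j
    cases inst <;> simp only [attackerCopy, List.mem_cons, List.not_mem_nil, or_false] at hi
    · rcases hi with rfl | rfl | rfl | rfl | rfl | rfl | rfl <;> simp at hsrc
    all_goals subst hi; simp at hsrc

open Classical in
-- In each block of auxiliary instructions at most one corresponds to an action of `P`; at the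
-- labels in between, the invariant keeps what has been learnt about the buffer. Helpers cannot
-- spoil this knowledge, since buffer and registers belong to the attacker.
theorem Phase.attacker_step_delaying {τ₁ τ₂ : List (Event T L R D)} {isu : Event T L R D} {v : D}
    (run : Delaying A ((x, v) :: β) τ₁ isu τ₂ s) (sim : Simulates A x d s ((x, v) :: β) [])
    (reg : RegRel (d.reg A.attacker) (s.reg A.attacker))
    (inv : AttackerInv A x ((x, v) :: β) (d.mem .stAdr) (d.reg A.attacker) (s.pc A.attacker)
      (s.reg A.attacker) (d.pc A.attacker))
    (ht : e.thread = A.attacker) (hs : SCAct A.instrument d e d' i ρi) : Phase A d' := by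
  have hc := mem_instrumentAttacker hs ht
  obtain ⟨t, k, io⟩ := e
  obtain ⟨pc', reg', mem'⟩ := d'
  obtain ⟨-, -, hsrc, hex, hacts, hpc, hreg⟩ := hs
  simp only at *
  subst ht hpc hreg
  rw [hsrc] at inv
  -- steps without a counterpart
  have silent : ∀ (ρi' : IReg R → IVal D) (mi : IVal D → IVal D) (lab : ILabel L R D),
      RegRel ρi' (s.reg A.attacker) → (∀ a, a ≠ .stAdr → mi a = d.mem a) →
      AttackerInv A x ((x, v) :: β) (mi .stAdr) ρi' (s.pc A.attacker) (s.reg A.attacker) lab →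
      Phase A ⟨Function.update d.pc A.attacker lab, Function.update d.reg A.attacker ρi', mi⟩ := by
    intro ρi' mi lab hr hm hinv
    refine .delaying s τ₁ isu τ₂ x v β run (sim.attacker_step (fun _ _ => rfl) (fun _ _ => rfl)
      (fun a => ?_) (fun a => ?_) (fun a => ?_) ?_) (by simpa using hr) (by simpa using hinv)
    · rw [hm _ (by simp), sim.mem]
    · rw [hm _ (by simp), sim.delay]
    · rw [hm _ (by simp)]
    · rw [hm _ (by simp)]
  -- steps with one action of the attacker other than a store
  have visible : ∀ (e : Event T L R D) (ℓ : L) (ρ : R → D) (β' : List (D × D))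
      (ρi' : IReg R → IVal D) (mi : IVal D → IVal D),
      e.thread = A.attacker → (∀ a v, e.kind ≠ .st a v) →
      TSOStep P (s.withBuf (soleBuf A.attacker ((x, v) :: β))) e
        (SCState.withBuf ⟨Function.update s.pc A.attacker ℓ, Function.update s.reg A.attacker ρ, s.mem⟩
          (soleBuf A.attacker ((x, v) :: β'))) →
      RegRel ρi' ρ → (∀ a, (∀ b, a ≠ .delay b) → mi a = d.mem a) →
      (∀ a, mi (.delay a) = ((bufLookup ((x, v) :: β') a).map IVal.delay).getD 0) →
      d.mem .stAdr = .val x →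
      Phase A ⟨Function.update d.pc A.attacker (.tilde ℓ), Function.update d.reg A.attacker ρi', mi⟩ := by
    intro e ℓ ρ β' ρi' mi he hk hstep hr hm hd hst
    refine .delaying _ τ₁ isu (τ₂ ++ [e]) x v β' (run.attacker hstep he hk)
      (sim.attacker_step (fun t ht => by simp [ht]) (fun t ht => by simp [ht])
      (fun a => ?_) hd (fun a => ?_) ?_) (by simpa using hr) ?_
    · rw [hm _ (by simp), sim.mem]
    · rw [hm _ (by simp)]
    · rw [hm _ (by simp)]
    · simpa using AttackerInv.tilde (A := A) ℓ ((hm _ (by simp)).trans hst) rfl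
  -- loads from the memory and local actions
  have lifted : ∀ (inst : Inst R D) (dst : L), ⟨s.pc A.attacker, inst, dst⟩ ∈ (P A.attacker).code →
      inst.lift.Exec (d.reg A.attacker) k ρi → inst ≠ .mfence → (∀ e₁ e₂, inst ≠ .store e₁ e₂) →
      (∀ r e, inst = .load r e → bufLookup ((x, v) :: β) (e.eval (s.reg A.attacker)) = none) →
      d.mem .stAdr = .val x →
      Phase A ⟨Function.update d.pc A.attacker (.tilde dst),
        Function.update d.reg A.attacker ρi, mem'⟩ := by
    intro inst dst hj hex hf hst hld hy
    obtain ⟨k₀, ρ, m, h1, h2, h3, h4, h5, h6⟩ := hex.of_lift hacts reg sim.mem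
    have hact : SCAct P s ⟨A.attacker, k₀, some ⟨s.pc A.attacker, inst, dst⟩⟩
        ⟨Function.update s.pc A.attacker dst, Function.update s.reg A.attacker ρ, m⟩
        ⟨s.pc A.attacker, inst, dst⟩ ρ := ⟨hj, rfl, rfl, h1, h2, rfl, rfl⟩
    have hk : ∀ a v, k₀ ≠ .st a v := by
      rintro a v rfl
      cases h1
      exact hst _ _ rfl
    have hmem : mem' = d.mem ∧ m = s.mem := by
      refine ⟨hacts.eq_of_ne_st ?_, h2.eq_of_ne_st hk⟩
      rintro a v rfl
      obtain ⟨a', v', h, -⟩ := ActKind.eq_st_of_lift h3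
      exact hk _ _ h
    obtain ⟨rfl, rfl⟩ := hmem
    refine visible _ dst ρ β ρi d.mem rfl hk (hact.step_of_lookup _ ?_) h4 (fun _ _ => rfl)
      sim.delay hy
    cases h1 with
    | load r e _ w => exact .inl ⟨_, _, rfl, by simpa [soleBuf] using hld r e rfl⟩
    | store => exact absurd rfl (hst _ _)
    | mfence => exact absurd rfl hf
    | assign => exact .inr ⟨rfl, hf⟩
    | assert => exact .inr ⟨rfl, hf⟩
  rcases hc with ⟨j, hj, hi⟩ | hi | hi | ⟨j, hj, hi⟩
  · simp only [attackerOrig, List.mem_singleton] at hi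
    subst hi
    cases inv
  · simp only [attackerMoveStore, List.mem_cons, List.not_mem_nil, or_false, Attack.stInst] at hi
    rcases hi with rfl | rfl
    · generalize hlab : (ILabel.orig _ : ILabel L R D) = lab at inv
      cases inv <;> simp at hlab
    · obtain ⟨h1, h2⟩ := inv.of_moveStore
      cases hex
      cases hacts
      rw [eval_cst, reg.eval_lift, h2]
      exact silent _ _ _ reg (fun a ha => by simp [ha]) (.tilde _ (by simp) h1)
  · simp only [attackerMoveLoad, List.mem_cons, List.not_mem_nil, or_false, Attack.ldInst] at hi
    rcases hi with rfl | rfl | rfl | rfl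
    · obtain ⟨hy, hℓ⟩ := inv.of_tilde
      cases hex
      cases hacts
      refine silent _ _ _ (reg.update_aux (by simp) _) (fun a ha => rfl) (.moveLoad₀ hy hℓ fun h => ?_)
      rw [Function.update_self, reg.eval_delay] at h
      exact sim.delay_eq_zero.1 h
    · obtain ⟨hy, hℓ, h⟩ := inv.of_moveLoad₀
      cases hex with
      | assert _ _ hne =>
      cases hacts
      exact silent _ _ _ reg (fun a ha => rfl) (.moveLoad 0 hy hℓ (h (eval_test_ne_zero.1 hne)))
    · obtain ⟨hy, hℓ, h⟩ := inv.of_moveLoad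
      cases hex
      cases hacts
      rw [eval_cst, eval_cst]
      -- `silent` allows only `stAdr` to change. The flag may change as well, because the simulation
      -- makes no claim about it.
      refine .delaying s τ₁ isu τ₂ x v β run (sim.attacker_step (fun _ _ => rfl) (fun _ _ => rfl)
        (fun a => ?_) (fun a => ?_) (fun a => ?_) ?_) (by simpa using reg) ?_
      · simp [sim.mem a]
      · simp [sim.delay]
      · simp
      · simp
      · simpa using AttackerInv.moveLoad 1 hy hℓ h
    · obtain ⟨hy, hℓ, h⟩ := inv.of_moveLoad
      cases hex
      cases hacts
      rw [eval_cst, reg.eval_hb]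
      -- `P` performs the load only now, when its access is recorded. Helpers may have acted since
      -- the buffer was tested, but the lookup still fails.
      have hact : SCLStep P s ⟨A.attacker, .ld (A.ldAdr.eval (s.reg A.attacker)) _, some A.ldInst⟩
          ⟨Function.update s.pc A.attacker A.ldTo, Function.update s.reg A.attacker _, s.mem⟩ :=
        ⟨A.ldInst, _, A.ld_mem, rfl, hℓ, .load _ _ _ _, .ld _ _, rfl, rfl⟩
      refine .loaded s _ τ₁ isu τ₂ x v β _ [] _ _ run (.cons hact (.nil _)) rfl rfl rfl h (by simp)
        ?_ ⟨⟨fun a => ?_, fun a => ?_⟩, fun t ht => ?_, fun t ht => ?_, fun a => ?_, fun h => ?_,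
        fun _ => ?_⟩ ?_
      · intro xs e ys heq hne
        have := congrArg List.length heq
        have := List.length_pos_iff.2 hne
        simp at *
        omega
      · simp [sim.mem a]
      · simp [sim.delay]
      · simpa [ht] using sim.reg t ht
      · simpa [ht] using (sim.helper t ht).mono (List.nil_subset _)
      · by_cases ha : a = A.ldAdr.eval (s.reg A.attacker)
        · subst ha
          refine ⟨fun _ => ⟨_, List.mem_singleton_self _, _, .inl rfl⟩, fun h => ?_⟩
          simp [IVal.rank] at h
        · simpa [ha] using (sim.access a).mono (List.nil_subset _)
      · exact (sim.success (by simpa using h)).mono (List.nil_subset _)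
      · simpa using hy
      · simp [Attack.ldInst]
  · obtain ⟨src, inst, dst⟩ := j
    cases inst with
    | load r e =>
      simp only [attackerCopy, List.mem_cons, List.not_mem_nil, or_false] at hi
      rcases hi with rfl | rfl | rfl | rfl | rfl | rfl | rfl
      · cases inv with
        | tilde _ hy hℓ =>
        cases hex
        cases hacts
        refine silent _ _ _ (reg.update_aux (by simp) _) (fun a ha => rfl)
          (.copyLoad₀ _ _ _ _ hy hℓ fun h => ?_)
        rw [Function.update_self, reg.eval_delay] at h
        exact sim.delay_eq_zero.1 h
      · cases inv with
        | copyLoad₀ _ _ _ _ hy hℓ h =>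
        cases hex with
        | assert _ _ hne =>
        cases hacts
        exact silent _ _ _ reg (fun a ha => rfl)
          (.copyLoad₁ _ _ _ _ hy hℓ (h (eval_test_ne_zero.1 hne)))
      · cases inv with
        | copyLoad₁ _ _ _ _ hy hℓ h =>
        subst hℓ
        refine lifted (.load r e) dst hj hex (by simp) (by simp) (fun r' e' heq => ?_) hy
        cases heq
        exact h
      · cases inv with
        | tilde _ hy hℓ =>
        cases hex
        cases hacts
        refine silent _ _ _ (reg.update_aux (by simp) _) (fun a ha => rfl)
          (.copyLoad₂ _ _ _ _ hy hℓ fun h h' => h ?_)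
        rw [Function.update_self, reg.eval_delay]
        exact sim.delay_eq_zero.2 h'
      · cases inv with
        | copyLoad₂ _ _ _ _ hy hℓ h =>
        cases hex with
        | assert _ _ hne =>
        cases hacts
        exact silent _ _ _ reg (fun a ha => rfl)
          (.copyLoad₃ _ _ _ _ hy hℓ (h (eval_test_ne_zero.1 hne)))
      · cases inv with
        | copyLoad₃ _ _ _ _ hy hℓ h =>
        cases hex
        cases hacts
        obtain ⟨w, hw⟩ := Option.ne_none_iff_exists'.1 h
        refine silent _ _ _ (reg.update_aux (by simp) _) (fun a ha => rfl)
          (.copyLoad₄ _ _ _ _ w hy hℓ hw ?_)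
        rw [Function.update_self, reg.eval_delay, sim.delay, hw]
        rfl
      · cases inv with
        | copyLoad₄ _ _ _ _ w hy hℓ hw haux =>
        subst hℓ
        cases hex
        cases hacts
        rw [eval_app, haux, IVal.strip_delay]
        exact visible _ _ _ β _ _ rfl (by simp) (loadBuffer_step s A.attacker _ r e dst hj hw)
          (reg.update r w) (fun _ _ => rfl) sim.delay hy
    | store e₁ e₂ =>
      simp only [attackerCopy, List.mem_cons, List.not_mem_nil, or_false] at hi
      subst hi
      cases inv with
      | tilde _ hy hℓ =>
      subst hℓ
      cases hex
      cases hacts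
      rw [reg.eval_delay, reg.eval_delay]
      refine visible ⟨A.attacker, .isu, some ⟨s.pc A.attacker, .store e₁ e₂, dst⟩⟩ dst (s.reg A.attacker) (β ++ [_]) _ _ rfl (by simp) ?_ reg
        (fun a ha => by simp [ha]) (delay_update sim.delay _ _) hy
      rw [Function.update_eq_self]
      exact issue_step s A.attacker ((x, v) :: β) e₁ e₂ dst hj
    | mfence => simp [attackerCopy] at hi
    | assign r e =>
      simp only [attackerCopy, List.mem_cons, List.not_mem_nil, or_false] at hi
      subst hi
      cases inv with
      | tilde _ hy hℓ =>
      subst hℓ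
      exact lifted (.assign r e) dst hj hex (by simp) (by simp) (by simp) hy
    | assert e =>
      simp only [attackerCopy, List.mem_cons, List.not_mem_nil, or_false] at hi
      subst hi
      cases inv with
      | tilde _ hy hℓ =>
      subst hℓ
      exact lifted (.assert e) dst hj hex (by simp) (by simp) (by simp) hy

theorem Phase.step (h : Phase A d) (hs : SCStep A.instrument d d') : Phase A d' := by
  obtain ⟨e, hs⟩ := hs.exists_label
  by_cases ht : e.thread = A.attacker
  · obtain ⟨i, ρi, hs⟩ := hs
    cases h with
    | original s τ run paired x sim reg pc =>
      exact attacker_step_original run paired sim reg pc ht hs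
    | delaying s τ₁ isu τ₂ x v β run sim reg inv =>
      exact attacker_step_delaying run sim reg inv ht hs
    | loaded s₁ s τ₁ isu τ₂ x v β ld τ₃ a w run run' ld_thread ld_inst ld_kind lookup helpers linked
        sim pc =>
      -- The label after the load of the attack is final: no instruction of the attacker starts
      -- there.
      exfalso
      have hsrc := hs.src
      rw [ht, pc] at hsrc
      rcases mem_instrumentAttacker hs ht with ⟨j, hj, hi⟩ | hi | hi | ⟨j, hj, hi⟩
      · simp only [attackerOrig, List.mem_singleton] at hi
        subst hi
        simp at hsrc
      · simp only [attackerMoveStore, List.mem_cons, List.not_mem_nil, or_false] at hi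
        rcases hi with rfl | rfl <;> simp at hsrc
      · simp only [attackerMoveLoad, List.mem_cons, List.not_mem_nil, or_false] at hi
        rcases hi with rfl | rfl | rfl | rfl <;> simp at hsrc
      · obtain ⟨src, inst, dst⟩ := j
        cases inst <;> simp only [attackerCopy, List.mem_cons, List.not_mem_nil, or_false] at hi
        · rcases hi with rfl | rfl | rfl | rfl | rfl | rfl | rfl <;> simp at hsrc
        all_goals subst hi; simp at hsrc
  · exact h.helper_step ht hs

theorem Phase.of_reachable {c : SCState T (ILabel L R D) (IReg R) (IVal D)}
    (h : SCReachable A.instrument c) : Phase A c := by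
  induction h with
  | refl => exact .initial
  | tail _ hs ih => exact ih.step hs

end Steps

/-! ### Traces of computations -/

theorem LoadAt.not_store {τ : List (Event T L R D)} {n : ℕ} {t t' : T} {a a' : D}
    (h : LoadAt τ n t a) : ¬ StoreAt τ n t' a' := by
  rintro ⟨e', v', he', -, hk'⟩
  obtain ⟨e, v, he, -, hk⟩ := h
  rw [he] at he'
  cases he'
  rw [hk] at hk'
  cases hk'

theorem LoadAt.not_issue {τ : List (Event T L R D)} {n : ℕ} {t t' : T} {a : D}
    (h : LoadAt τ n t a) : ¬ IssueAt τ n t' := by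
  rintro ⟨e', he', -, hk'⟩
  obtain ⟨e, v, he, -, hk⟩ := h
  rw [he] at he'
  cases he'
  rw [hk] at hk'
  cases hk'

theorem StoreAt.not_issue {τ : List (Event T L R D)} {n : ℕ} {t t' : T} {a : D}
    (h : StoreAt τ n t a) : ¬ IssueAt τ n t' := by
  rintro ⟨e', he', -, hk'⟩
  obtain ⟨e, v, he, -, hk⟩ := h
  rw [he] at he'
  cases he'
  rw [hk] at hk'
  cases hk'

theorem StoreAt.lt_length {τ : List (Event T L R D)} {n : ℕ} {t : T} {a : D}
    (h : StoreAt τ n t a) : n < τ.length := by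
  obtain ⟨e, v, he, -⟩ := h
  by_contra hn
  rw [List.getElem?_eq_none (by omega)] at he
  cases he

/-- A load to which some store is visible has a source. -/
theorem exists_source {τ : List (Event T L R D)} {l s : ℕ} {t : T} {a : D} (hl : LoadAt τ l t a)
    (hs : VisibleTo τ t a l s) : ∃ s', Source τ s' l ∧ VisibleTo τ t a l s' ∧ s ≤ s' := by
  classical
  have hb : ∀ m, VisibleTo τ t a l m → m ≤ τ.length := fun m hm => by
    obtain ⟨t', h⟩ := hm.1
    exact h.lt_length.le
  have hv := Nat.findGreatest_spec (P := VisibleTo τ t a l) (hb s hs) hs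
  exact ⟨_, ⟨t, a, hl, hv, fun m hm => Nat.le_findGreatest (hb m hm) hm⟩, hv,
    Nat.le_findGreatest (hb s hs) hs⟩

theorem LoadAt.unique {τ : List (Event T L R D)} {n : ℕ} {t t' : T} {a a' : D}
    (h : LoadAt τ n t a) (h' : LoadAt τ n t' a') : t = t' ∧ a = a' := by
  obtain ⟨e, v, he, ht, hk⟩ := h
  obtain ⟨e', v', he', ht', hk'⟩ := h'
  rw [he] at he'
  cases he'
  rw [hk] at hk'
  cases hk'
  exact ⟨ht.symm.trans ht', rfl⟩

/-- A load happens before a later store to its address if all stores visible to it precede that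
store. -/
theorem conflict_of_visible {τ : List (Event T L R D)} {l s : ℕ} {t t' : T} {a : D}
    (hl : LoadAt τ l t a) (hs : StoreAt τ s t' a) (h : ∀ m, VisibleTo τ t a l m → m < s) :
    Conflict τ l s := by
  by_cases hsrc : ∃ m, Source τ m l
  · obtain ⟨m, hm⟩ := hsrc
    obtain ⟨t₁, a₁, hl₁, hv, -⟩ := id hm
    obtain ⟨rfl, rfl⟩ := hl.unique hl₁
    obtain ⟨t₂, hst⟩ := hv.1
    exact .inl ⟨m, hm, h m hv, a, t₂, t', hst, hs⟩
  · exact .inr ⟨fun m hm => hsrc ⟨m, hm⟩, a, t, t', hl, hs⟩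

theorem Event.expand_eq {e : Event T L R D} (he : e.kind ≠ .isu) :
    (e.expand = [e] ∧ ∀ a v, e.kind ≠ .st a v) ∨
      ∃ a v, e.kind = .st a v ∧ e.expand = [⟨e.thread, .isu, e.inst⟩, ⟨e.thread, .st a v, none⟩] := by
  obtain ⟨t, k, io⟩ := e
  cases k <;> simp_all [expand]

theorem Event.expand_length_pos (e : Event T L R D) : 0 < e.expand.length := by
  obtain ⟨t, k, io⟩ := e
  cases k <;> simp [expand]

theorem exists_expand_position {M : List (Event T L R D)} {j : ℕ}
    (hj : j < (M.flatMap Event.expand).length) :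
    ∃ ys e zs off, M = ys ++ e :: zs ∧ j = (ys.flatMap Event.expand).length + off ∧
      off < e.expand.length := by
  induction M generalizing j with
  | nil => simp at hj
  | cons a M ih =>
    by_cases h : j < a.expand.length
    · exact ⟨[], a, M, j, rfl, by simp, h⟩
    · rw [List.flatMap_cons, List.length_append] at hj
      obtain ⟨ys, e, zs, off, h1, h2, h3⟩ := ih (j := j - a.expand.length) (by omega)
      refine ⟨a :: ys, e, zs, off, by rw [h1]; rfl, ?_, h3⟩
      rw [List.flatMap_cons, List.length_append]
      omega

/-- A computation `τ` that consists of `pre`, the actions of `M` and `tail`, where `M` is the load of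
the attack by `t₀` from `a`, followed by actions of other threads which do not delay stores. -/
structure AttackTrace (t₀ : T) (a : D) (τ pre M tail : List (Event T L R D)) : Prop where
  eq : τ = pre ++ M.flatMap Event.expand ++ tail
  paired : ∀ t, t ≠ t₀ → Paired t τ
  kind : ∀ e ∈ M, e.kind ≠ .isu
  load : ∀ e ∈ M, e.thread = t₀ → ∃ v, e.kind = .ld a v
  head : ∀ ys e zs, M = ys ++ e :: zs → e.thread = t₀ → ys = []
  store : ∀ n, StoreAt τ n t₀ a → n < pre.length

/-! ### Happens-before paths in the constructed computation. -/

namespace AttackTrace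

variable {t₀ : T} {a : D} {τ pre M tail : List (Event T L R D)}

theorem getElem? (h : AttackTrace t₀ a τ pre M tail) {ys zs : List (Event T L R D)}
    {e : Event T L R D} (hM : M = ys ++ e :: zs) {off : ℕ} (hoff : off < e.expand.length) :
    τ[pre.length + (ys.flatMap Event.expand).length + off]? = e.expand[off]? := by
  have : τ = (pre ++ ys.flatMap Event.expand) ++ (e.expand ++ (zs.flatMap Event.expand ++ tail)) := by
    rw [h.eq, hM]
    simp
  rw [this, ← List.length_append, List.getElem?_append_right (by omega), Nat.add_sub_cancel_left,
    List.getElem?_append_left hoff]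

/-- The position of an action of `M`, which is that of its store if it is one. -/
theorem node (h : AttackTrace t₀ a τ pre M tail) {ys zs : List (Event T L R D)}
    {e : Event T L R D} (hM : M = ys ++ e :: zs) :
    ∃ e', τ[pre.length + (ys.flatMap Event.expand).length + (e.expand.length - 1)]? = some e' ∧
      e'.thread = e.thread ∧ e'.kind = e.kind := by
  have hpos := e.expand_length_pos
  rw [h.getElem? hM (by omega)]
  rcases Event.expand_eq (h.kind e (by simp [hM])) with ⟨h1, -⟩ | ⟨b, v, hk, h1⟩
  · exact ⟨e, by simp [h1], rfl, rfl⟩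
  · exact ⟨⟨e.thread, .st b v, none⟩, by simp [h1], rfl, hk.symm⟩

theorem exists_of_mem (_ : AttackTrace t₀ a τ pre M tail) {ys zs : List (Event T L R D)}
    {e e' : Event T L R D} (hM : M = ys ++ e :: zs) (he' : e' ∈ ys) :
    ∃ xs ws, M = xs ++ e' :: ws ∧
      pre.length + (xs.flatMap Event.expand).length + (e'.expand.length - 1) <
        pre.length + (ys.flatMap Event.expand).length := by
  obtain ⟨xs, ws, rfl⟩ := List.append_of_mem he'
  refine ⟨xs, ws ++ e :: zs, by simp [hM], ?_⟩
  have := e'.expand_length_pos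
  simp only [List.flatMap_append, List.flatMap_cons, List.length_append]
  omega

/-- Only the first half of an expanded store is an issue, so any other position is the last one of
its block; this is the position that represents the action in the trace. -/
theorem decode (h : AttackTrace t₀ a τ pre M tail) {n : ℕ} (hn : pre.length ≤ n)
    (hn' : n < pre.length + (M.flatMap Event.expand).length) (hi : ∀ t, ¬ IssueAt τ n t) :
    ∃ ys e zs, M = ys ++ e :: zs ∧
      n = pre.length + (ys.flatMap Event.expand).length + (e.expand.length - 1) := by
  obtain ⟨ys, e, zs, off, hM, hj, hoff⟩ := exists_expand_position (M := M) (j := n - pre.length)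
    (by omega)
  refine ⟨ys, e, zs, hM, ?_⟩
  have hget := h.getElem? hM hoff
  have hn : n = pre.length + (ys.flatMap Event.expand).length + off := by omega
  rcases Event.expand_eq (h.kind e (by simp [hM])) with ⟨h1, -⟩ | ⟨b, v, hk, h1⟩
  · rw [h1] at hoff ⊢
    simp only [List.length_singleton] at hoff ⊢
    omega
  · rw [h1] at hoff hget ⊢
    simp only [List.length_cons, List.length_nil] at hoff ⊢
    have : off ≠ 0 := by
      rintro rfl
      exact hi e.thread ⟨⟨e.thread, .isu, e.inst⟩, by rw [hn, hget]; rfl, rfl, rfl⟩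
    omega

/-- Stores that helpers see before they are performed do not exist. -/
theorem visible_lt (h : AttackTrace t₀ a τ pre M tail) {n m : ℕ} {t : T} {b : D}
    (hn : pre.length ≤ n) (hl : LoadAt τ n t b) (ht : t = t₀ → b = a) (hv : VisibleTo τ t b n m) :
    m < n := by
  rcases hv with ⟨-, hm | ⟨p, hp, hst, hpn⟩⟩
  · exact hm
  -- The attacker performs no store to `a` from here on. A store of a helper stands right behind its
  -- issue, so a load cannot lie between the two.
  by_cases ht₀ : t = t₀
  · obtain rfl := ht ht₀
    subst ht₀
    have := h.store m hst
    omega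
  · have hpl : p < τ.length := by
      have := hl
      obtain ⟨e, v, he, -⟩ := this
      by_contra hge
      rw [List.getElem?_eq_none (by omega)] at he
      cases he
    have := (h.paired t ht₀).eq_succ (σ := []) hpl (by simpa using hp)
    have hne : m ≠ n := by
      rintro rfl
      exact hl.not_store hst
    omega

/-- No store visible to the load lies after it, so every later store to its address overwrites what
it read. -/
theorem conflict (h : AttackTrace t₀ a τ pre M tail) {n s : ℕ} {t t' : T} {b : D}
    (hn : pre.length ≤ n) (hl : LoadAt τ n t b) (ht : t = t₀ → b = a) (hs : StoreAt τ s t' b)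
    (hlt : n < s) : Conflict τ n s :=
  conflict_of_visible hl hs fun _ hm => (h.visible_lt hn hl ht hm).trans hlt

/-- An access happens before a later store to its address. -/
theorem happensBefore_store (h : AttackTrace t₀ a τ pre M tail) {ys zs : List (Event T L R D)}
    {e : Event T L R D} (hM : M = ys ++ e :: zs) {b v : D} (he : e.kind = .ld b v ∨ e.kind = .st b v)
    {s : ℕ} {t' : T} (hs : StoreAt τ s t' b)
    (hlt : pre.length + (ys.flatMap Event.expand).length + (e.expand.length - 1) < s) :
    HappensBefore τ (pre.length + (ys.flatMap Event.expand).length + (e.expand.length - 1)) s := by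
  obtain ⟨e', h1, h2, h3⟩ := h.node hM
  rcases he with he | he
  · refine .inr (.inr (.inr (h.conflict (by omega) ⟨e', v, h1, h2, h3.trans he⟩ (fun ht => ?_) hs
      hlt)))
    obtain ⟨w, hw⟩ := h.load e (by simp [hM]) ht
    rw [he] at hw
    cases hw
    rfl
  · exact .inr (.inl ⟨hlt, b, _, _, ⟨e', v, h1, h2, h3.trans he⟩, hs⟩)

/-- An action enters program order at the start of its block and is represented by the end. For a
store these are the matched issue and store, which `Paired` provides only for threads other than
`t₀`. -/
theorem nodeAt (h : AttackTrace t₀ a τ pre M tail) {ys zs : List (Event T L R D)}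
    {e : Event T L R D} (hM : M = ys ++ e :: zs) (ht : e.thread ≠ t₀) :
    NodeAt τ e.thread (pre.length + (ys.flatMap Event.expand).length + (e.expand.length - 1))
      (pre.length + (ys.flatMap Event.expand).length) := by
  have hpos := e.expand_length_pos
  have hget := h.getElem? hM hpos
  rcases Event.expand_eq (h.kind e (by simp [hM])) with ⟨h1, h2⟩ | ⟨b, v, hk, h1⟩
  · rw [h1] at hget ⊢
    simp only [List.length_singleton, Nat.add_zero, Nat.sub_self, List.getElem?_cons_zero] at hget ⊢
    refine .inr ⟨rfl, ⟨e, hget, rfl⟩, ?_, ?_⟩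
    · rintro ⟨e', he', -, hk⟩
      rw [hget] at he'
      cases he'
      exact h.kind e (by simp [hM]) hk
    · rintro ⟨b, e', v, he', -, hk⟩
      rw [hget] at he'
      cases he'
      exact h2 _ _ hk
  · rw [h1] at hget ⊢
    refine .inl ?_
    have hlt : pre.length + (ys.flatMap Event.expand).length < τ.length := by
      by_contra hge
      rw [List.getElem?_eq_none (by omega)] at hget
      cases hget
    have := (h.paired e.thread ht).isIssueOf_succ (σ := []) hlt (by
      rw [List.append_nil]
      exact ⟨⟨e.thread, .isu, e.inst⟩, hget, rfl, rfl⟩)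
    rwa [List.append_nil] at this

/-- Every action of `M` is reached from the first one, if each depends on earlier ones. -/
theorem reached (h : AttackTrace t₀ a τ pre M tail) (hlink : Linked M) {n : ℕ}
    (hn : pre.length ≤ n) (hn' : n < pre.length + (M.flatMap Event.expand).length)
    (hi : ∀ t, ¬ IssueAt τ n t) :
    ∃ ys e zs, M = ys ++ e :: zs ∧
      n = pre.length + (ys.flatMap Event.expand).length + (e.expand.length - 1) ∧
      (ys ≠ [] → ∃ m, pre.length ≤ m ∧ m < n ∧ (∀ t, ¬ IssueAt τ m t) ∧ HappensBefore τ m n) := by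
  obtain ⟨ys, e, zs, hM, rfl⟩ := h.decode hn hn' hi
  refine ⟨ys, e, zs, hM, rfl, fun hne => ?_⟩
  have hte : e.thread ≠ t₀ := fun ht => hne (h.head ys e zs hM ht)
  obtain ⟨e₀, he₀, ht₀, hk₀⟩ := h.node hM
  have node_not_issue : ∀ {xs ws e'}, M = xs ++ e' :: ws →
      ∀ t, ¬ IssueAt τ (pre.length + (xs.flatMap Event.expand).length + (e'.expand.length - 1)) t := by
    rintro xs ws e' hM' t ⟨e'', he'', -, hk''⟩
    obtain ⟨e₁, h1, -, h3⟩ := h.node hM'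
    rw [he''] at h1
    cases h1
    exact h.kind e' (by simp [hM']) (h3 ▸ hk'')
  rcases hlink ys e zs hM hne with ⟨e', he', ht'⟩ | ⟨b, v, hk, e', he', v', hk'⟩ |
    ⟨b, v, hk, e', he', v', hk'⟩
  all_goals obtain ⟨xs, ws, hM', hlt⟩ := h.exists_of_mem hM he'
  -- Shared thread: program order compares the starts of the blocks.
  · refine ⟨_, by omega, by omega, node_not_issue hM', .inl ⟨e.thread,
      pre.length + (xs.flatMap Event.expand).length, _, ?_, h.nodeAt hM hte,
      lt_of_le_of_lt ?_ hlt⟩⟩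
    · rw [← ht']
      exact h.nodeAt hM' (ht' ▸ hte)
    · omega
  · obtain ⟨e₁, h1, h2, h3⟩ := h.node hM'
    have hl : LoadAt τ (pre.length + (ys.flatMap Event.expand).length + (e.expand.length - 1))
        e.thread b := ⟨e₀, v, he₀, ht₀, hk₀.trans hk⟩
    -- The value may come from a later store than the given one, but not from an earlier one, so the
    -- source still lies behind `pre`.
    obtain ⟨m, hm, hv, hle⟩ := exists_source hl
      (s := pre.length + (xs.flatMap Event.expand).length + (e'.expand.length - 1))
      ⟨⟨e'.thread, e₁, v', h1, h2, h3.trans hk'⟩, .inl (by omega)⟩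
    have hlt' := h.visible_lt (by omega) hl (fun ht => absurd ht hte) hv
    obtain ⟨t', hst⟩ := hv.1
    exact ⟨m, by omega, hlt', fun t => hst.not_issue, .inr (.inr (.inl hm))⟩
  · exact ⟨_, by omega, by omega, node_not_issue hM', h.happensBefore_store hM' hk'
      ⟨e₀, v, he₀, ht₀, hk₀.trans hk⟩ (by omega)⟩

/-- Predecessors in the sense of `reached` have smaller positions, so following them ends at the
first action of `M`, the load. -/
theorem happensBeforeThrough (h : AttackTrace t₀ a τ pre M tail) (hlink : Linked M)
    {ld : Event T L R D} {M' : List (Event T L R D)} (hM : M = ld :: M') (hld : ld.thread = t₀)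
    {n : ℕ} (hn : pre.length ≤ n)
    (hn' : n < pre.length + (M.flatMap Event.expand).length) (hi : ∀ t, ¬ IssueAt τ n t) :
    n = pre.length ∨ HappensBeforeThrough τ pre.length n := by
  induction n using Nat.strong_induction_on with
  | _ n ih =>
  obtain ⟨ys, e, zs, hM', hn₁, hex⟩ := h.reached hlink hn hn' hi
  by_cases hys : ys = []
  · subst hys
    left
    obtain ⟨rfl, -⟩ : ld = e ∧ M' = zs := by simpa [hM] using hM'
    obtain ⟨v, hv⟩ := h.load ld (by simp [hM]) hld
    rcases Event.expand_eq (h.kind ld (by simp [hM])) with ⟨h1, -⟩ | ⟨b, v', hk, -⟩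
    · simpa [h1] using hn₁
    · rw [hv] at hk
      cases hk
  · obtain ⟨m, hm, hmn, him, hhb⟩ := hex hys
    right
    rcases ih m hmn hm (by omega) him with rfl | hpath
    · exact .single ⟨hmn, hhb⟩
    · exact .tail hpath ⟨hmn, hhb⟩

end AttackTrace

section AttackWitness

variable {P : Program T L R D} {A : Attack P}

/-! ### From the instrumented program to TSO witnesses -/

theorem SCRun.toTSORun {s s' : SCState T L R D} {M : List (Event T L R D)} (h : SCRun P s M s')
    (b : T → List (D × D)) (hb : ∀ e ∈ M, b e.thread = []) :
    TSORun P (s.withBuf b) (M.flatMap Event.expand) (s'.withBuf b) := by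
  induction h with
  | nil => exact .nil _
  | cons h _ ih =>
    obtain ⟨i, ρ, h⟩ := h
    rw [List.flatMap_cons]
    exact (h.run b (hb _ (by simp))).append (ih fun e he => hb e (by simp [he]))

theorem SCRun.kind_ne_isu {s s' : SCState T L R D} {M : List (Event T L R D)} (h : SCRun P s M s') :
    ∀ e ∈ M, e.kind ≠ .isu := by
  induction h with
  | nil => simp
  | cons h _ ih =>
    obtain ⟨i, ρ, h⟩ := h
    intro e he
    rcases List.mem_cons.1 he with rfl | he
    · exact h.kind_ne_isu
    · exact ih e he

/-- The store actions that empty a buffer. -/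
def flushes (t : T) (β : List (D × D)) : List (Event T L R D) :=
  β.map fun q => ⟨t, .st q.1 q.2, none⟩

theorem mem_flushes {t : T} {β : List (D × D)} {e : Event T L R D} :
    e ∈ flushes t β ↔ ∃ a v, (a, v) ∈ β ∧ e = ⟨t, .st a v, none⟩ := by
  simp [flushes, eq_comm]

theorem exists_flush_run (s : SCState T L R D) (t : T) (β : List (D × D)) :
    ∃ c, TSORun P (s.withBuf (soleBuf t β)) (flushes t β) c ∧ ∀ t, c.buf t = [] := by
  induction β generalizing s with
  | nil => exact ⟨_, .nil _, by simp [SCState.withBuf, soleBuf]⟩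
  | cons q β ih =>
    obtain ⟨c, h, hc⟩ := ih (s.setMem q.1 q.2)
    refine ⟨c, .cons ?_ h, hc⟩
    convert TSOStep.flush (s.withBuf (soleBuf t (q :: β))) t q.1 q.2 β ?_ using 1
    · simp [SCState.withBuf, SCState.setMem, TSOState.setMem, TSOState.setBuf, soleBuf]
    · simp [SCState.withBuf, soleBuf]

theorem Paired.of_thread_ne {t : T} {τ : List (Event T L R D)} (h : ∀ e ∈ τ, e.thread ≠ t) :
    Paired t τ := by
  induction τ with
  | nil => exact .nil
  | cons e τ ih =>
    have he := h e (by simp)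
    exact .other (fun hi => he hi.1) (fun hs => he hs.1) (ih fun e' he' => h e' (by simp [he']))

theorem Paired.flatMap_expand {M : List (Event T L R D)} (h : ∀ e ∈ M, e.kind ≠ .isu) (t : T) :
    Paired t (M.flatMap Event.expand) := by
  induction M with
  | nil => exact .nil
  | cons e M ih =>
    rw [List.flatMap_cons]
    exact (Event.expand_paired (h e (by simp)) t).append (ih fun e' he' => h e' (by simp [he']))

/-- A witness for the attack, from a run in which the load has been executed and the address of the
delayed store has been accessed afterwards. -/
theorem Attack.feasible_of_run {s₁ s : SCState T L R D} {τ₁ τ₂ τ₃ : List (Event T L R D)}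
    {isu ld : Event T L R D} {x v a w : D} {β : List (D × D)}
    (run : Delaying A ((x, v) :: β) τ₁ isu τ₂ s₁) (run' : SCRun P s₁ (ld :: τ₃) s)
    (ld_thread : ld.thread = A.attacker) (ld_inst : ld.inst = some A.ldInst)
    (ld_kind : ld.kind = .ld a w) (lookup : bufLookup ((x, v) :: β) a = none)
    (helpers : ∀ e ∈ τ₃, e.thread ≠ A.attacker) (linked : Linked (ld :: τ₃))
    (hx : Accessed (ld :: τ₃) x) : A.Feasible := by
  set W := τ₃.flatMap Event.expand with hW
  set st : Event T L R D := ⟨A.attacker, .st x v, none⟩ with hst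
  set pre := τ₁ ++ [isu] ++ τ₂ with hpre
  set τ := pre ++ [ld] ++ W ++ [st] ++ flushes A.attacker β with hτ
  have hkind := run'.kind_ne_isu
  have hexp : ld.expand = [ld] := by simp [Event.expand, ld_kind]
  have hflat : (ld :: τ₃).flatMap Event.expand = [ld] ++ W := by rw [List.flatMap_cons, hexp]
  have hlookup := bufLookup_eq_none.1 lookup
  have hWthread : ∀ e ∈ W, e.thread ≠ A.attacker := by
    intro e he
    obtain ⟨e', he', he⟩ := List.mem_flatMap.1 he
    rw [Event.expand_thread he]
    exact helpers e' he'
  -- The store of the attack is the oldest buffer entry, so `st` and `τ₄` together are the flush of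
  -- the whole buffer.
  have htail : [st] ++ flushes A.attacker β = flushes A.attacker ((x, v) :: β) := rfl
  have hτ' : τ = pre ++ (ld :: τ₃).flatMap Event.expand ++ flushes A.attacker ((x, v) :: β) := by
    rw [hflat, hτ, ← htail]
    simp
  have hpaired : ∀ t, t ≠ A.attacker → Paired t τ := by
    intro t ht
    rw [hτ', hpre]
    refine ((((run.paired₁ t).append (.of_thread_ne ?_)).append (run.paired₂ t ht)).append
      (.flatMap_expand hkind t)).append (.of_thread_ne ?_)
    · intro e he
      rw [List.mem_singleton.1 he, run.isIssue.1]
      exact ht.symm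
    · intro e he
      obtain ⟨_, _, _, rfl⟩ := mem_flushes.1 he
      exact ht.symm
  have hlenW : (pre ++ [ld] ++ W).length = pre.length + 1 + W.length := by
    simp only [List.length_append, List.length_singleton]
  have hs : τ[pre.length + 1 + W.length]? = some st := by
    rw [hτ, List.append_assoc _ [st], List.getElem?_append_right (by omega), hlenW,
      Nat.sub_self]
    rfl
  have htrace : AttackTrace A.attacker a τ pre (ld :: τ₃) (flushes A.attacker ((x, v) :: β)) := by
    refine ⟨hτ', hpaired, hkind, ?_, ?_, ?_⟩
    · intro e he ht
      rcases List.mem_cons.1 he with rfl | he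
      · exact ⟨w, ld_kind⟩
      · exact absurd ht (helpers e he)
    · intro ys e zs heq ht
      cases ys with
      | nil => rfl
      | cons y ys =>
        obtain ⟨-, rfl⟩ := List.cons.inj heq
        exact absurd ht (helpers e (by simp))
    -- After `pre` the attacker performs only the pending stores, and the failed lookup says that
    -- none of them has address `a`.
    · rintro n ⟨e, u, he, ht, hk⟩
      by_contra hge
      rw [hτ', List.append_assoc, List.getElem?_append_right (by omega), hflat] at he
      have hmem := List.mem_of_getElem? he
      simp only [List.mem_append, List.mem_singleton] at hmem
      rcases hmem with (rfl | h) | h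
      · rw [ld_kind] at hk
        cases hk
      · exact hWthread e h ht
      · obtain ⟨a', v', hm, rfl⟩ := mem_flushes.1 h
        cases hk
        exact hlookup _ hm rfl
  have hstore : StoreAt τ (pre.length + 1 + W.length) A.attacker x := ⟨st, v, hs, rfl, rfl⟩
  have hflatlen : ((ld :: τ₃).flatMap Event.expand).length = 1 + W.length := by
    rw [hflat, List.length_append, List.length_singleton]
  refine ⟨τ, τ₁, τ₂, W, flushes A.attacker β, isu, ld, st, τ₁.length, τ₁.length + 1 + τ₂.length,
    τ₁.length + 1 + τ₂.length + 1 + W.length, ?_⟩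
  have hl : τ₁.length + 1 + τ₂.length = pre.length := by simp [hpre]; omega
  rw [hl]
  refine ⟨?_, rfl, hl.symm, rfl, ?_, ?_, run.isu_inst, ?_, ?_, ld_thread, ld_inst, hWthread, ?_, ?_,
    ?_⟩
  · simp [hτ, hpre]
  · obtain ⟨c, hc, hc'⟩ := exists_flush_run (P := P) s A.attacker ((x, v) :: β)
    refine ⟨c, ?_, hc'⟩
    rw [hτ']
    refine (run.run.append ?_).append hc
    rw [hflat]
    cases run' with
    | cons h hM =>
      obtain ⟨i, ρ, h⟩ := h
      -- The load runs with a nonempty buffer but reads from memory, as under SC; the helpers behind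
      -- it have empty buffers.
      refine (TSORun.single (h.step_of_lookup _ (.inl ⟨a, w, ld_kind, ?_⟩))).append
        (hM.toTSORun _ fun e he => ?_)
      · simpa [soleBuf, ld_thread] using lookup
      · simp [soleBuf, helpers e he]
  · rintro t p q ht hpq ⟨k, h1, h2, -⟩
    have hp : p < τ.length := by
      obtain ⟨⟨e, he, -⟩, -⟩ := hpq
      by_contra hge
      rw [List.getElem?_eq_none (by omega)] at he
      cases he
    have := (hpaired t ht).eq_succ (σ := []) hp (by simpa using hpq)
    omega
  · refine isIssueOf_iff.2 ⟨⟨isu, ?_, run.isIssue⟩, ⟨st, hs, rfl, x, v, rfl⟩, ?_⟩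
    · rw [hτ, hpre]
      simp
    · have h1 : τ.take τ₁.length = τ₁ := by
        rw [hτ, hpre]
        simp
      have h2 : τ.take (pre.length + 1 + W.length) = τ₁ ++ ([isu] ++ τ₂ ++ [ld] ++ W) := by
        rw [hτ, List.append_assoc _ [st], ← hlenW, List.take_left' rfl, hpre]
        simp
      -- All issues before `isu` have been performed within `τ₁`, and the attacker performs no store
      -- between `isu` and `st`. Hence the ranks agree.
      rw [h1, h2, stores_append, (run.paired₁ A.attacker).counts, left_eq_add, stores_eq_zero]
      intro e he
      simp only [List.mem_append, List.mem_singleton] at he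
      rcases he with ((rfl | h) | rfl) | h
      · rintro ⟨-, _, _, hk⟩
        rw [run.isIssue.2] at hk
        cases hk
      · exact run.no_store e h
      · rintro ⟨-, _, _, hk⟩
        rw [ld_kind] at hk
        cases hk
      · exact fun hk => hWthread e h hk.1
  -- An earlier issue of the attacker lies in `τ₁`, with its store directly behind it and no room
  -- for an action in between.
  · rintro p q hp hpq ⟨k, h1, h2, -⟩
    have hτ₁ : τ = τ₁ ++ ([isu] ++ τ₂ ++ [ld] ++ W ++ [st] ++ flushes A.attacker β) := by
      simp [hτ, hpre]
    rw [hτ₁] at hpq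
    have := (run.paired₁ A.attacker).eq_succ hp hpq
    omega
  · intro n hn hns hi
    rcases Nat.lt_or_ge n (pre.length + 1 + W.length) with hlt | hge
    · rcases htrace.happensBeforeThrough linked rfl ld_thread hn.le (by omega) hi with h | h
      · omega
      · exact h
    -- The store `st` itself is reached through the action of `M` that accessed `x`.
    · obtain rfl : n = pre.length + 1 + W.length := le_antisymm hns hge
      obtain ⟨e, he, u, hk⟩ := hx
      obtain ⟨ys, zs, hM⟩ := List.append_of_mem he
      obtain ⟨e', h1, h2, h3⟩ := htrace.node hM
      have hlt : pre.length + (ys.flatMap Event.expand).length + (e.expand.length - 1) <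
          pre.length + 1 + W.length := by
        have h4 := e.expand_length_pos
        have h5 := congrArg (fun M => (M.flatMap Event.expand).length) hM
        simp only [hflatlen] at h5
        simp only [List.flatMap_append, List.flatMap_cons, List.length_append] at h5
        omega
      have hhb := htrace.happensBefore_store hM hk hstore hlt
      have hne : ∀ t, ¬ IssueAt τ
          (pre.length + (ys.flatMap Event.expand).length + (e.expand.length - 1)) t := by
        rintro t ⟨e'', he'', -, hk''⟩
        rw [h1] at he''
        cases he''
        exact hkind e he (h3 ▸ hk'')
      rcases htrace.happensBeforeThrough linked rfl ld_thread (by omega) (by omega) hne with h | h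
      · rw [h] at hhb
        exact .single ⟨by omega, hhb⟩
      · exact .tail h ⟨hlt, hhb⟩
  · intro e he
    obtain ⟨a', v', -, rfl⟩ := mem_flushes.1 he
    exact ⟨rfl, a', v', rfl⟩
  · intro e he b u b' u' hk hk' hbb
    obtain ⟨a', v', hm, rfl⟩ := mem_flushes.1 he
    rw [ld_kind] at hk'
    cases hk
    cases hk'
    exact hlookup (b, u) (by simp [hm]) hbb

/-- If the instrumented program reaches a goal configuration, the attack is feasible. -/
theorem Attack.feasible_of_goal {c : SCState T (ILabel L R D) (IReg R) (IVal D)}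
    (hc : SCReachable A.instrument c) (hg : IsGoal c) : A.Feasible := by
  have hnil : ∀ x : D, ¬ Accessed ([] : List (Event T L R D)) x := by
    rintro x ⟨_, h, -⟩
    simp at h
  cases Phase.of_reachable hc with
  | original s τ run paired x sim => exact absurd (sim.success hg) (hnil x)
  | delaying s τ₁ isu τ₂ x v β run sim => exact absurd (sim.success hg) (hnil x)
  | loaded s₁ s τ₁ isu τ₂ x v β ld τ₃ a w run run' ld_thread ld_inst ld_kind lookup helpers linked
      sim pc =>
    exact feasible_of_run run run' ld_thread ld_inst ld_kind lookup helpers linked (sim.success hg)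

end AttackWitness

/-! ### From TSO runs to SC steps -/

/-- The SC state `s` agrees with the TSO state `c` for thread `t`, except that it executes a store
together with its removal from the buffer. -/
def Lagging (P : Program T L R D) (c : TSOState T L R D) (s : SCState T L R D) (t : T) : Prop :=
  s.reg t = c.reg t ∧ ((c.buf t = [] ∧ s.pc t = c.pc t) ∨
    ∃ e₁ e₂, ⟨s.pc t, .store e₁ e₂, c.pc t⟩ ∈ (P t).code ∧
      c.buf t = [(e₁.eval (s.reg t), e₂.eval (s.reg t))])

/-- The acting thread is the only one whose local state or buffer changes; memory is shared and
excluded. -/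
theorem TSOStep.frame {P : Program T L R D} {c c' : TSOState T L R D} {e : Event T L R D}
    (h : TSOStep P c e c') {t : T} (ht : t ≠ e.thread) :
    c'.pc t = c.pc t ∧ c'.reg t = c.reg t ∧ c'.buf t = c.buf t := by
  cases h <;> simp only at ht <;>
    simp [TSOState.goto, TSOState.setReg, TSOState.setMem, TSOState.setBuf, ht]

theorem SCLStep.frame {P : Program T L R D} {s s' : SCState T L R D} {e : Event T L R D}
    (h : SCLStep P s e s') {t : T} (ht : t ≠ e.thread) :
    s'.pc t = s.pc t ∧ s'.reg t = s.reg t := by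
  classical
  obtain ⟨i, ρ, h⟩ := h
  rw [h.pc, h.reg]
  exact ⟨Function.update_of_ne ht _ _, Function.update_of_ne ht _ _⟩

theorem Lagging.frame {P : Program T L R D} {c c' : TSOState T L R D} {s s' : SCState T L R D} {t : T}
    (h : Lagging P c s t) (hc : c'.pc t = c.pc t ∧ c'.reg t = c.reg t ∧ c'.buf t = c.buf t)
    (hs : s'.pc t = s.pc t ∧ s'.reg t = s.reg t) : Lagging P c' s' t := by
  unfold Lagging
  rw [hs.1, hs.2, hc.1, hc.2.1, hc.2.2]
  exact h

/-- A TSO step of a thread that does not delay stores is an issue or corresponds to an SC step. -/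
theorem Lagging.step {P : Program T L R D} {c c' : TSOState T L R D} {s : SCState T L R D}
    {e : Event T L R D} (h : Lagging P c s e.thread) (hm : s.mem = c.mem) (hs : TSOStep P c e c')
    (hbuf : c.buf e.thread ≠ [] → ∃ a v, e.kind = .st a v) :
    (e.kind = .isu ∧ Lagging P c' s e.thread ∧ s.mem = c'.mem) ∨
      ∃ e' s', SCLStep P s e' s' ∧ e'.thread = e.thread ∧ e'.kind = e.kind ∧
        Lagging P c' s' e.thread ∧ s'.mem = c'.mem := by
  classical
  obtain ⟨hreg, h⟩ := h
  cases hs with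
  | flush t a v β hb =>
    dsimp only at *
    rcases h with ⟨h, -⟩ | ⟨e₁, e₂, hin, h⟩
    · rw [h] at hb
      cases hb
    · rw [h] at hb
      cases hb
      -- The lagging SC state has waited at the store instruction; it executes it now and catches up
      -- with the label of `c`.
      refine .inr ⟨⟨t, .st _ _, _⟩, ⟨Function.update s.pc t (c.pc t), Function.update s.reg t (s.reg t),
        _⟩, ⟨⟨s.pc t, .store e₁ e₂, c.pc t⟩, _, hin, rfl, rfl, .store _ _ _, .st _ _ _, rfl, rfl⟩,
        rfl, rfl, ⟨?_, .inl ⟨?_, ?_⟩⟩, ?_⟩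
      · simpa [TSOState.setMem, TSOState.setBuf] using hreg
      · simp [TSOState.setBuf]
      · simp [TSOState.setMem, TSOState.setBuf]
      · rw [hm]
        rfl
  | issue t e₁ e₂ ℓ' hin =>
    dsimp only at *
    -- An issue is not a store action, so `hbuf` excludes a pending store. The same argument recurs
    -- for loads and local actions.
    have hb : c.buf t = [] := by
      by_contra hb
      obtain ⟨_, _, hk⟩ := hbuf hb
      cases hk
    rcases h with ⟨-, h⟩ | ⟨_, _, _, h⟩
    · refine .inl ⟨rfl, ⟨?_, .inr ⟨e₁, e₂, ?_, ?_⟩⟩, ?_⟩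
      · simpa [TSOState.goto, TSOState.setBuf] using hreg
      · simpa [TSOState.goto, TSOState.setBuf, h] using hin
      · simp [TSOState.goto, TSOState.setBuf, hb, hreg]
      · simpa [TSOState.goto, TSOState.setBuf] using hm
    · rw [h] at hb
      cases hb
  | loadBuffer t r e ℓ' v hin hv =>
    dsimp only at *
    have hb : c.buf t = [] := by
      by_contra hb
      obtain ⟨_, _, hk⟩ := hbuf hb
      cases hk
    rw [hb] at hv
    cases hv
  | loadMemory t r e ℓ' hin hv =>
    dsimp only at *
    have hb : c.buf t = [] := by
      by_contra hb
      obtain ⟨_, _, hk⟩ := hbuf hb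
      cases hk
    rcases h with ⟨-, h⟩ | ⟨_, _, _, h⟩
    · rw [← h] at hin
      rw [← hreg, ← hm]
      refine .inr ⟨⟨t, .ld _ _, _⟩, ⟨Function.update s.pc t ℓ', Function.update s.reg t _, s.mem⟩,
        ⟨⟨s.pc t, .load r e, ℓ'⟩, _, hin, rfl, rfl, .load _ _ _ _, .ld _ _, rfl, rfl⟩,
        rfl, rfl, ⟨?_, .inl ⟨?_, ?_⟩⟩, ?_⟩
      · simp [TSOState.goto, TSOState.setReg, hreg]
      · simpa [TSOState.goto, TSOState.setReg] using hb
      · simp [TSOState.goto]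
      · simpa [TSOState.goto, TSOState.setReg] using hm
    · rw [h] at hb
      cases hb
  | mfence t ℓ' hin hb =>
    dsimp only at *
    rcases h with ⟨-, h⟩ | ⟨_, _, _, h⟩
    · rw [← h] at hin
      refine .inr ⟨⟨t, .loc, _⟩, ⟨Function.update s.pc t ℓ', Function.update s.reg t _, s.mem⟩,
        ⟨⟨s.pc t, .mfence, ℓ'⟩, _, hin, rfl, rfl, .mfence _, .loc _, rfl, rfl⟩,
        rfl, rfl, ⟨?_, .inl ⟨?_, ?_⟩⟩, ?_⟩
      · simpa [TSOState.goto] using hreg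
      · simpa [TSOState.goto] using hb
      · simp [TSOState.goto]
      · simpa [TSOState.goto] using hm
    · rw [h] at hb
      cases hb
  | assign t r e ℓ' hin =>
    dsimp only at *
    have hb : c.buf t = [] := by
      by_contra hb
      obtain ⟨_, _, hk⟩ := hbuf hb
      cases hk
    rcases h with ⟨-, h⟩ | ⟨_, _, _, h⟩
    · rw [← h] at hin
      refine .inr ⟨⟨t, .loc, _⟩, ⟨Function.update s.pc t ℓ', Function.update s.reg t _, s.mem⟩,
        ⟨⟨s.pc t, .assign r e, ℓ'⟩, _, hin, rfl, rfl, .assign _ _ _, .loc _, rfl, rfl⟩,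
        rfl, rfl, ⟨?_, .inl ⟨?_, ?_⟩⟩, ?_⟩
      · simp [TSOState.goto, TSOState.setReg, hreg]
      · simpa [TSOState.goto, TSOState.setReg] using hb
      · simp [TSOState.goto]
      · simpa [TSOState.goto, TSOState.setReg] using hm
    · rw [h] at hb
      cases hb
  | assert t e ℓ' hin hne =>
    dsimp only at *
    have hb : c.buf t = [] := by
      by_contra hb
      obtain ⟨_, _, hk⟩ := hbuf hb
      cases hk
    rcases h with ⟨-, h⟩ | ⟨_, _, _, h⟩
    · rw [← h] at hin
      refine .inr ⟨⟨t, .loc, _⟩, ⟨Function.update s.pc t ℓ', Function.update s.reg t _, s.mem⟩,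
        ⟨⟨s.pc t, .assert e, ℓ'⟩, _, hin, rfl, rfl, .assert _ _ (hreg ▸ hne), .loc _, rfl, rfl⟩,
        rfl, rfl, ⟨?_, .inl ⟨?_, ?_⟩⟩, ?_⟩
      · simpa [TSOState.goto] using hreg
      · simpa [TSOState.goto] using hb
      · simp [TSOState.goto]
      · simpa [TSOState.goto] using hm
    · rw [h] at hb
      cases hb

/-- A store of `t` is the next action of `t` if none of the pending stores is delayed. -/
theorem TSORun.store_of_pending {P : Program T L R D} {τ : List (Event T L R D)} {k : ℕ}
    {c cₑ : TSOState T L R D} (h : TSORun P (.initial P) (τ.take k) c)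
    (h' : TSORun P c (τ.drop k) cₑ) {e : Event T L R D} (hₑ : cₑ.buf e.thread = [])
    (he : τ[k]? = some e) (hb : c.buf e.thread ≠ [])
    (hd : ∀ p q, p < k → IsIssueOf τ e.thread p q → ¬ Delayed τ e.thread p q) :
    ∃ a v, e.kind = .st a v := by
  classical
  have h1 := h.buffer_length e.thread
  have h2 := (h.append h').buffer_length e.thread
  rw [List.take_append_drop, hₑ] at h2
  have h3 : 0 < (c.buf e.thread).length := List.length_pos_iff.2 hb
  have h0 : ((TSOState.initial P).buf e.thread).length = 0 := rfl
  simp only [h0, List.length_nil, Nat.add_zero] at h1 h2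
  have hi : stores e.thread (τ.take k) < issues e.thread (τ.take k) := by omega
  -- The oldest pending issue: its rank is the number of stores already performed.
  obtain ⟨p, ep, hp1, hp2, hp3⟩ := exists_getElem?_countP_eq
    (fun a : Event T L R D => decide (a.IsIssue e.thread)) (τ.take k) hi
  have hpk : p < k := by
    by_contra hge
    rw [List.getElem?_eq_none (by rw [List.length_take]; omega)] at hp1
    cases hp1
  rw [List.getElem?_take_of_lt hpk] at hp1
  rw [List.take_take, min_eq_left hpk.le] at hp3
  have hs : stores e.thread (τ.take k) < stores e.thread τ := by
    -- Since the run ends with an empty buffer, all issues are eventually performed. The bound `max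
    -- k τ.length` presents `τ` as a prefix at least as long as `τ.take k`.
    have := countP_take_le (fun a : Event T L R D => decide (a.IsIssue e.thread)) τ
      (m := k) (n := max k τ.length) (by omega)
    rw [List.take_of_length_le (i := max k τ.length) (by omega)] at this
    unfold issues stores at *
    omega
  obtain ⟨q, eq, hq1, hq2, hq3⟩ := exists_getElem?_countP_eq
    (fun a : Event T L R D => decide (a.IsStore e.thread)) τ hs
  have hkq : k ≤ q := by
    by_contra hlt
    have h5 := countP_take_succ_of_getElem?
      (p := fun a : Event T L R D => decide (a.IsStore e.thread)) hq1
    have h6 := countP_take_le (fun a : Event T L R D => decide (a.IsStore e.thread)) τ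
      (m := q + 1) (n := k) (by omega)
    simp only [hq2, if_true] at h5
    unfold stores at *
    omega
  have hpq : IsIssueOf τ e.thread p q :=
    isIssueOf_iff.2 ⟨⟨ep, hp1, by simpa using hp2⟩, ⟨eq, hq1, by simpa using hq2⟩, hp3.trans hq3.symm⟩
  -- If the store came later than `k`, the action at `k` would delay it.
  have : k = q := by
    by_contra hne
    exact hd p q hpk hpq ⟨k, hpk, by omega, e, he, rfl⟩
  subst this
  rw [he] at hq1
  cases hq1
  have : e.IsStore e.thread := by simpa using hq2
  exact this.2

/-- Induction along a run. -/
theorem TSORun.induction {P : Program T L R D} {τ : List (Event T L R D)} {c₀ cₑ : TSOState T L R D}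
    (Inv : ℕ → TSOState T L R D → Prop) {k₁ k₂ : ℕ} (hk : k₁ ≤ k₂) (hk₂ : k₂ ≤ τ.length)
    (h₁ : ∃ c, TSORun P c₀ (τ.take k₁) c ∧ TSORun P c (τ.drop k₁) cₑ ∧ Inv k₁ c)
    (hstep : ∀ k c c' e, k₁ ≤ k → k < k₂ → τ[k]? = some e → TSORun P c₀ (τ.take k) c →
      TSORun P c (τ.drop k) cₑ → TSOStep P c e c' → Inv k c → Inv (k + 1) c') :
    ∃ c, TSORun P c₀ (τ.take k₂) c ∧ TSORun P c (τ.drop k₂) cₑ ∧ Inv k₂ c := by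
  induction k₂, hk using Nat.le_induction with
  | base => exact h₁
  | succ k hk ih =>
    obtain ⟨c, hc, hc', hinv⟩ := ih (by omega) fun k c c' e h h' => hstep k c c' e h (by omega)
    have hlt : k < τ.length := by omega
    have hd := List.drop_eq_getElem_cons hlt
    have ht := List.take_add_one (l := τ) (i := k)
    rw [List.getElem?_eq_getElem hlt] at ht
    have hc'' := hc'
    rw [hd] at hc''
    cases hc'' with
    | cons h hτ =>
      refine ⟨_, ?_, hτ, hstep k c _ _ hk (by omega) (List.getElem?_eq_getElem hlt) hc hc' h hinv⟩
      rw [ht]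
      exact hc.append (.single h)

/-! ### Simulation of original steps by the instrumented program -/

/-- A sequence of SC steps of one thread with the given code, on its label, its registers and the
memory. -/
inductive LocalRun (code : List (LInst L R D)) :
    L → (R → D) → (D → D) → L → (R → D) → (D → D) → Prop
  | refl (ℓ : L) (ρ : R → D) (m : D → D) : LocalRun code ℓ ρ m ℓ ρ m
  | step {ℓ' ℓ'' : L} {ρ ρ' ρ'' : R → D} {m m' m'' : D → D} (i : LInst L R D) (hi : i ∈ code)
      {k : ActKind D} (hex : i.inst.Exec ρ k ρ') (hacts : k.Acts m m') (hdst : i.dst = ℓ')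
      (h : LocalRun code ℓ' ρ' m' ℓ'' ρ'' m'') : LocalRun code i.src ρ m ℓ'' ρ'' m''

open Classical in
-- Other threads contribute only their labels and registers, which stay put, so a local run can be
-- executed without interruption from any state that agrees with its start.
theorem LocalRun.reachable {P : Program T L R D} {t : T} {ℓ ℓ' : L} {ρ ρ' : R → D} {m m' : D → D}
    (h : LocalRun (P t).code ℓ ρ m ℓ' ρ' m') {c : SCState T L R D} (hpc : c.pc t = ℓ)
    (hreg : c.reg t = ρ) (hmem : c.mem = m) (hc : SCReachable P c) :
    SCReachable P ⟨Function.update c.pc t ℓ', Function.update c.reg t ρ', m'⟩ := by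
  induction h generalizing c with
  | refl =>
    subst hpc hreg hmem
    simpa using hc
  | @step ℓ' ℓ'' ρ ρ' ρ'' m m' m'' i hi k hex hacts hdst h ih =>
    subst hreg hmem
    have hstep : SCStep P c ⟨Function.update c.pc t ℓ', Function.update c.reg t ρ', m'⟩ :=
      SCLStep.toSCStep (e := ⟨t, k, some i⟩) ⟨i, ρ', hi, rfl, hpc, hex, hacts, by rw [hdst], rfl⟩
    simpa using ih (c := ⟨Function.update c.pc t ℓ', Function.update c.reg t ρ', m'⟩)
      (by simp) (by simp) rfl (hc.tail hstep)

section

variable {th : Thread L R D} {j : LInst L R D} {ρi : IReg R → IVal D} {mi : IVal D → IVal D}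
  {ρ ρ' : R → D} {m m' : D → D} {k : ActKind D}

theorem mem_instrumentHelper_orig (hj : j ∈ th.code) {i : ILInst L R D} (hi : i ∈ helperOrig j) :
    i ∈ (instrumentHelper th).code := by
  simp only [instrumentHelper, List.mem_append, List.mem_flatMap]
  exact .inl (.inl (.inl ⟨j, hj, hi⟩))

theorem mem_instrumentHelper_move (hj : j ∈ th.code) {i : ILInst L R D} (hi : i ∈ helperMove j) :
    i ∈ (instrumentHelper th).code := by
  simp only [instrumentHelper, List.mem_append, List.mem_flatMap]
  exact .inl (.inl (.inr ⟨j, hj, hi⟩))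

theorem mem_instrumentHelper_copy (hj : j ∈ th.code) {i : ILInst L R D} (hi : i ∈ helperCopy j) :
    i ∈ (instrumentHelper th).code := by
  simp only [instrumentHelper, List.mem_append, List.mem_flatMap]
  exact .inl (.inr ⟨j, hj, hi⟩)

theorem mem_instrumentHelper_check {ℓ : L} (hℓ : ℓ ∈ th.labels) {i : ILInst L R D}
    (hi : i ∈ helperCheck ℓ) : i ∈ (instrumentHelper th).code := by
  simp only [instrumentHelper, List.mem_append, List.mem_flatMap]
  exact .inr ⟨ℓ, hℓ, hi⟩

theorem test_ne_zero {p : IVal D → Prop} {r : IReg R} {ρi : IReg R → IVal D} (h : p (ρi r)) :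
    (test p r).eval ρi ≠ 0 := eval_test_ne_zero.2 h

open Classical in
/-- A helper simulates a step by its original code as long as the flag `hb` is not raised. -/
theorem helper_orig_run (hj : j ∈ th.code) (hex : j.inst.Exec ρ k ρ') (hacts : k.Acts m m')
    (hr : RegRel ρi ρ) (hm : MemRel mi m) (hflag : mi .hbFlag = 0) :
    ∃ ρi' mi', LocalRun (instrumentHelper th).code (.orig j.src) ρi mi (.orig j.dst) ρi' mi' ∧
      RegRel ρi' ρ' ∧ MemRel mi' m' ∧ ∀ a, (∀ a', a ≠ .val a') → mi' a = mi a := by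
  have hr₁ := hr.update_aux (r := .aux) (by simp) (mi .hbFlag)
  obtain ⟨ρi', mi', h1, h2, h3, h4, h5, -⟩ := hex.lift hacts hr₁ hm
  have hmem := fun i hi => mem_instrumentHelper_orig (i := i) hj hi
  simp only [helperOrig, List.mem_cons, List.not_mem_nil, or_false] at hmem
  refine ⟨ρi', mi', ?_, h3, h4, h5⟩
  exact .step _ (hmem _ (.inl rfl)) (.load _ _ _ _) (.ld _ _) rfl <|
    .step _ (hmem _ (.inr (.inl rfl))) (.assert _ _ (test_ne_zero (by simpa using hflag)))
      (.loc _) rfl <|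
    .step _ (hmem _ (.inr (.inr rfl))) h1 h2 rfl (.refl _ _ _)

/-- The memory `mi'` records the access types after an action `k` in the memory `mi`. -/
structure Records (k : ActKind D) (mi mi' : IVal D → IVal D) : Prop where
  other : ∀ a, (∀ b, a ≠ .val b) → (∀ b, a ≠ .hb b) → mi' a = mi a
  mono : ∀ b, (mi (.hb b)).rank ≤ (mi' (.hb b)).rank
  load : ∀ b v, k = .ld b v → 1 ≤ (mi' (.hb b)).rank
  store : ∀ b v, k = .st b v → (mi' (.hb b)).rank = 2

theorem IVal.rank_le_two (v : IVal D) : v.rank ≤ 2 := by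
  cases v <;> simp [IVal.rank]

/-- The result of a simulated step of a helper in the code copy. -/
def CopyRun (th : Thread L R D) (k : ActKind D) (ℓ : ILabel L R D) (ρi : IReg R → IVal D)
    (mi : IVal D → IVal D) (dst : L) (ρ' : R → D) (m' : D → D) : Prop :=
  ∃ ρi' mi', LocalRun (instrumentHelper th).code ℓ ρi mi (.tilde dst) ρi' mi' ∧
    RegRel ρi' ρ' ∧ MemRel mi' m' ∧ Records k mi mi'

open Classical in
/-- A helper moves to its code copy by a load from an address with a store access. -/
theorem helper_moveLoad_run (hj : j ∈ th.code) (hex : j.inst.Exec ρ k ρ') (hacts : k.Acts m m')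
    (hr : RegRel ρi ρ) (hm : MemRel mi m) {a v : D} (hk : k = .ld a v)
    (hrank : (mi (.hb a)).rank = 2) : CopyRun th k (.orig j.src) ρi mi j.dst ρ' m' := by
  obtain ⟨src, inst, dst⟩ := j
  subst hk
  cases hex with
  | load r e _ _ =>
  have hr₁ := hr.update_aux (r := .aux) (by simp) (mi (.hb (e.eval ρ)))
  obtain ⟨ρi', mi', h1, h2, h3, h4, h5, -⟩ := (Inst.Exec.load r e ρ v).lift hacts hr₁ hm
  have hmem := fun i hi => mem_instrumentHelper_move (i := i) hj hi
  simp only [helperMove, List.mem_cons, List.not_mem_nil, or_false] at hmem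
  have hex₁ := Inst.Exec.load .aux e.hb ρi (mi (.hb (e.eval ρ)))
  rw [hr.eval_hb] at hex₁
  -- No access type is written: the address already carries the maximal one.
  refine ⟨ρi', mi', ?_, h3, h4, fun b hb _ => h5 b hb, fun b => (congrArg IVal.rank (h5 _ (by simp))).ge,
    ?_, by simp⟩
  · exact .step _ (hmem _ (.inl rfl)) hex₁ (.ld _ _) rfl <|
      .step _ (hmem _ (.inr (.inl rfl))) (.assert _ _ (test_ne_zero
        (by simpa using IVal.rank_eq_two.1 hrank))) (.loc _) rfl <|
      .step _ (hmem _ (.inr (.inr rfl))) h1 h2 rfl (.refl _ _ _)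
  · rintro b w h
    cases h
    rw [h5 _ (by simp), hrank]
    omega

/-- The type `sta` is maximal, so writing it unconditionally lowers no record. -/
theorem Records.of_sta {a v : D} {mi' mi'' : IVal D → IVal D} (h : ∀ b, (∀ b', b ≠ .val b') → mi' b = mi b)
    (h' : mi'' (.hb a) = .sta) (h'' : ∀ b, b ≠ .hb a → mi'' b = mi' b) :
    Records (.st a v) mi mi'' where
  other b hb hb' := by rw [h'' b (hb' a), h b hb]
  mono b := by
    by_cases hb : b = a
    · subst hb
      rw [h']
      exact IVal.rank_le_two _
    · rw [h'' _ (by simpa using hb), h _ (by simp)]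
  load b w h := by cases h
  store b w h := by
    cases h
    rw [h']
    rfl

open Classical in
/-- A helper moves to its code copy by a store to an address that has been accessed. -/
theorem helper_moveStore_run (hj : j ∈ th.code) (hex : j.inst.Exec ρ k ρ') (hacts : k.Acts m m')
    (hr : RegRel ρi ρ) (hm : MemRel mi m) {a v : D} (hk : k = .st a v)
    (hrank : 1 ≤ (mi (.hb a)).rank) : CopyRun th k (.orig j.src) ρi mi j.dst ρ' m' := by
  obtain ⟨src, inst, dst⟩ := j
  subst hk
  cases hex with
  | store e₁ e₂ _ =>
  have hr₁ := hr.update_aux (r := .aux) (by simp) (mi (.hb (e₁.eval ρ)))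
  obtain ⟨ρi', mi', h1, h2, h3, h4, h5, -⟩ := (Inst.Exec.store e₁ e₂ ρ).lift hacts hr₁ hm
  have hmem := fun i hi => mem_instrumentHelper_move (i := i) hj hi
  simp only [helperMove, List.mem_cons, List.not_mem_nil, or_false] at hmem
  have hex₁ := Inst.Exec.load .aux e₁.hb ρi (mi (.hb (e₁.eval ρ)))
  have hex₂ := Inst.Exec.store e₁.hb (cst .sta) ρi'
  rw [hr.eval_hb] at hex₁
  rw [h3.eval_hb, eval_cst] at hex₂
  refine ⟨ρi', _, ?_, h3, h4.update_aux (by simp) .sta, .of_sta (mi' := mi') h5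
    (Function.update_self _ _ _) fun b hb => Function.update_of_ne hb _ _⟩
  exact .step _ (hmem _ (.inl rfl)) hex₁ (.ld _ _) rfl <|
    .step _ (hmem _ (.inr (.inl rfl))) (.assert _ _ (test_ne_zero (by simpa using hrank)))
      (.loc _) rfl <|
    .step _ (hmem _ (.inr (.inr (.inl rfl)))) h1 h2 rfl <|
    .step _ (hmem _ (.inr (.inr (.inr rfl)))) hex₂ (.st _ _ _) rfl (.refl _ _ _)

open Classical in
theorem Inst.Exec.of_load {r : R} {e : Expr R D} (h : (Inst.load r e).Exec ρ k ρ') :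
    ∃ v, k = .ld (e.eval ρ) v ∧ ρ' = Function.update ρ r v := by
  cases h
  exact ⟨_, rfl, rfl⟩

open Classical in
/-- A helper simulates a step by its code copy. -/
theorem helper_copy_run (hj : j ∈ th.code) (hex : j.inst.Exec ρ k ρ') (hacts : k.Acts m m')
    (hr : RegRel ρi ρ) (hm : MemRel mi m) : CopyRun th k (.tilde j.src) ρi mi j.dst ρ' m' := by
  obtain ⟨src, inst, dst⟩ := j
  have hmem := fun i hi => mem_instrumentHelper_copy (i := i) hj hi
  have hlocal : ∀ {ρi' mi'}, inst.lift.Exec ρi k.lift ρi' → k.lift.Acts mi mi' → k = .loc →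
      (⟨.tilde src, inst.lift, .tilde dst⟩ : ILInst L R D) ∈ (instrumentHelper th).code →
      RegRel ρi' ρ' → MemRel mi' m' → (∀ a, (∀ a', a ≠ .val a') → mi' a = mi a) →
      CopyRun th k (.tilde src) ρi mi dst ρ' m' := by
    rintro ρi' mi' h1 h2 rfl hin h3 h4 h5
    exact ⟨ρi', mi', .step _ hin h1 h2 rfl (.refl _ _ _), h3, h4, fun b hb _ => h5 b hb,
      fun b => (congrArg IVal.rank (h5 _ (by simp))).ge, by simp, by simp⟩
  cases inst with
  | load r e =>
    simp only [helperCopy, List.mem_cons, List.not_mem_nil, or_false] at hmem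
    cases hex with
    | load _ _ _ v =>
    -- The address is saved first because the load may overwrite a register that the address
    -- expression uses.
    have hr₁ := hr.update_aux (r := .aux) (by simp) (.val (e.eval ρ))
    obtain ⟨ρi', mi', h1, h2, h3, h4, h5, h6⟩ := (Inst.Exec.load r e ρ v).lift hacts hr₁ hm
    rw [Function.update_self] at h6
    have hex₁ := Inst.Exec.assign .aux e.lift ρi
    rw [hr.eval_lift] at hex₁
    have hex₂ : (Inst.load (.orig r) (app id .aux)).Exec
        (Function.update ρi .aux (.val (e.eval ρ))) (ActKind.ld (e.eval ρ) v).lift ρi' := by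
      obtain ⟨v', hv, rfl⟩ := h1.of_load
      obtain rfl : .val v = v' := by
        simp only [ActKind.lift, ActKind.ld.injEq] at hv
        exact hv.2
      have := Inst.Exec.load (.orig r) (app id .aux) (Function.update ρi .aux (.val (e.eval ρ)))
        (.val v)
      rwa [eval_app, Function.update_self, id] at this
    have hex₃ := Inst.Exec.load .aux' (app (fun v => .hb v.strip) .aux) ρi' (mi' (.hb (e.eval ρ)))
    rw [eval_app, h6, IVal.strip_val] at hex₃
    have hex₄ := Inst.Exec.store (app (fun v => .hb v.strip) .aux) (app IVal.maxLda .aux')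
      (Function.update ρi' .aux' (mi' (.hb (e.eval ρ))))
    rw [eval_app, eval_app, Function.update_self, Function.update_of_ne (by simp), h6,
      IVal.strip_val] at hex₄
    have hrank := IVal.rank_maxLda (mi' (.hb (e.eval ρ)))
    refine ⟨Function.update ρi' .aux' (mi' (.hb (e.eval ρ))),
      Function.update mi' (.hb (e.eval ρ)) (mi' (.hb (e.eval ρ))).maxLda, ?_,
      h3.update_aux (r := .aux') (by simp) (mi' (.hb (e.eval ρ))), h4.update_aux (by simp) _, fun b hb hb' => ?_,
      fun b => ?_, fun b w h => ?_, by simp⟩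
    · exact .step _ (hmem _ (.inl rfl)) hex₁ (.loc _) rfl <|
        .step _ (hmem _ (.inr (.inl rfl))) hex₂ h2 rfl <|
        .step _ (hmem _ (.inr (.inr (.inl rfl)))) hex₃ (.ld _ _) rfl <|
        .step _ (hmem _ (.inr (.inr (.inr rfl)))) hex₄ (.st _ _ _) rfl (.refl _ _ _)
    · rw [Function.update_of_ne (hb' _), h5 b hb]
    · by_cases hb : b = e.eval ρ
      · subst hb
        rw [Function.update_self, hrank, h5 _ (by simp)]
        have := IVal.rank_le_two (mi (.hb (e.eval ρ)))
        split <;> omega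
      · rw [Function.update_of_ne (by simpa using hb), h5 _ (by simp)]
    · cases h
      rw [Function.update_self, hrank]
      split <;> omega
  | store e₁ e₂ =>
    simp only [helperCopy, List.mem_cons, List.not_mem_nil, or_false] at hmem
    cases hex with
    | store _ _ _ =>
    obtain ⟨ρi', mi', h1, h2, h3, h4, h5, -⟩ := (Inst.Exec.store e₁ e₂ ρ).lift hacts hr hm
    have hex₂ := Inst.Exec.store e₁.hb (cst .sta) ρi'
    rw [h3.eval_hb, eval_cst] at hex₂
    refine ⟨ρi', _, ?_, h3, h4.update_aux (by simp) .sta, .of_sta (mi' := mi') h5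
      (Function.update_self _ _ _) fun b hb => Function.update_of_ne hb _ _⟩
    exact .step _ (hmem _ (.inl rfl)) h1 h2 rfl <|
      .step _ (hmem _ (.inr rfl)) hex₂ (.st _ _ _) rfl (.refl _ _ _)
  | mfence =>
    obtain ⟨ρi', mi', h1, h2, h3, h4, h5, -⟩ := hex.lift hacts hr hm
    cases hex
    exact hlocal h1 h2 rfl (hmem _ (by simp [helperCopy, Inst.lift])) h3 h4 h5
  | assign r e =>
    obtain ⟨ρi', mi', h1, h2, h3, h4, h5, -⟩ := hex.lift hacts hr hm
    cases hex
    exact hlocal h1 h2 rfl (hmem _ (by simp [helperCopy, Inst.lift])) h3 h4 h5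
  | assert e =>
    obtain ⟨ρi', mi', h1, h2, h3, h4, h5, -⟩ := hex.lift hacts hr hm
    cases hex
    exact hlocal h1 h2 rfl (hmem _ (by simp [helperCopy, Inst.lift])) h3 h4 h5

open Classical in
/-- The success check. -/
theorem helper_check_run {ℓ : L} (hℓ : ℓ ∈ th.labels) {x : D} (hx : mi .stAdr = .val x)
    (hrank : 1 ≤ (mi (.hb x)).rank) :
    ∃ ρi', LocalRun (instrumentHelper th).code (.tilde ℓ) ρi mi (.check ℓ 3) ρi'
      (Function.update mi .success .tt) := by
  have hmem := fun i hi => mem_instrumentHelper_check (i := i) hℓ hi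
  simp only [helperCheck, List.mem_cons, List.not_mem_nil, or_false] at hmem
  have hex₁ := Inst.Exec.load .aux (cst .stAdr) ρi (.val x)
  have hacts₁ := ActKind.Acts.ld .stAdr mi
  rw [hx] at hacts₁
  have hex₂ := Inst.Exec.load .aux (app (fun v => .hb v.strip) .aux)
    (Function.update ρi .aux (.val x)) (mi (.hb x))
  rw [eval_app, Function.update_self, IVal.strip_val] at hex₂
  exact ⟨_, .step _ (hmem _ (.inl rfl)) hex₁ hacts₁ rfl <|
    .step _ (hmem _ (.inr (.inl rfl))) hex₂ (.ld _ _) rfl <|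
    .step _ (hmem _ (.inr (.inr (.inl rfl)))) (.assert _ _ (test_ne_zero
      (by simpa using IVal.ne_zero_of_rank hrank))) (.loc _) rfl <|
    .step _ (hmem _ (.inr (.inr (.inr rfl)))) (.store _ _ _) (.st _ _ _) rfl (.refl _ _ _)⟩

end

/-! ### Simulation of the attacker -/

section

variable {P : Program T L R D} {A : Attack P} {j : LInst L R D} {ρi : IReg R → IVal D}
  {mi : IVal D → IVal D} {ρ ρ' : R → D} {m m' : D → D} {k : ActKind D}

theorem mem_instrumentAttacker_copy (hj : j ∈ (P A.attacker).code) {i : ILInst L R D}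
    (hi : i ∈ attackerCopy j) : i ∈ (instrumentAttacker A).code := by
  simp only [instrumentAttacker, List.mem_append, List.mem_flatMap]
  exact .inr ⟨j, hj, hi⟩

/-- The attacker simulates a step by its original code. -/
theorem attacker_orig_run (hj : j ∈ (P A.attacker).code) (hex : j.inst.Exec ρ k ρ')
    (hacts : k.Acts m m') (hr : RegRel ρi ρ) (hm : MemRel mi m) :
    ∃ ρi' mi', LocalRun (instrumentAttacker A).code (.orig j.src) ρi mi (.orig j.dst) ρi' mi' ∧
      RegRel ρi' ρ' ∧ MemRel mi' m' ∧ ∀ a, (∀ a', a ≠ .val a') → mi' a = mi a := by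
  obtain ⟨ρi', mi', h1, h2, h3, h4, h5, -⟩ := hex.lift hacts hr hm
  refine ⟨ρi', mi', .step (⟨.orig j.src, j.inst.lift, .orig j.dst⟩ : ILInst L R D) ?_ h1 h2 rfl (.refl _ _ _),
    h3, h4, h5⟩
  simp only [instrumentAttacker, List.mem_append, List.mem_flatMap]
  exact .inl (.inl (.inl ⟨j, hj, by simp [attackerOrig]⟩))

open Classical in
/-- The attacker simulates the issue of the attack's store. -/
theorem attacker_moveStore_run (hr : RegRel ρi ρ) :
    LocalRun (instrumentAttacker A).code (.orig A.stFrom) ρi mi (.tilde A.stTo) ρi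
      (Function.update (Function.update mi (.delay (A.stAdr.eval ρ)) (.delay (A.stVal.eval ρ)))
        .stAdr (.val (A.stAdr.eval ρ))) := by
  have hmem : ∀ i ∈ attackerMoveStore A, i ∈ (instrumentAttacker A).code := fun i hi => by
    simp only [instrumentAttacker, List.mem_append]
    exact .inl (.inl (.inr hi))
  simp only [attackerMoveStore, List.mem_cons, List.not_mem_nil, or_false] at hmem
  have hex₁ := Inst.Exec.store A.stAdr.delay A.stVal.delay ρi
  have hex₂ := Inst.Exec.store (cst .stAdr) A.stAdr.lift ρi
  rw [hr.eval_delay, hr.eval_delay] at hex₁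
  rw [hr.eval_lift, eval_cst] at hex₂
  exact .step _ (hmem _ (.inl rfl)) hex₁ (.st _ _ _) rfl <|
    .step _ (hmem _ (.inr rfl)) hex₂ (.st _ _ _) rfl (.refl _ _ _)

/-- The auxiliary addresses represent the buffer `β`. -/
def BufRel (mi : IVal D → IVal D) (β : List (D × D)) : Prop :=
  ∀ a, mi (.delay a) = ((bufLookup β a).map .delay).getD 0

open Classical in
/-- The attacker simulates the attack's load. -/
theorem attacker_moveLoad_run (hr : RegRel ρi ρ) {β : List (D × D)} (hβ : BufRel mi β)
    (hlook : bufLookup β (A.ldAdr.eval ρ) = none) :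
    ∃ ρi', LocalRun (instrumentAttacker A).code (.tilde A.ldFrom) ρi mi (.move A.ldInst 3) ρi'
      (Function.update (Function.update mi .hbFlag .tt) (.hb (A.ldAdr.eval ρ)) .lda) := by
  have hmem : ∀ i ∈ attackerMoveLoad A, i ∈ (instrumentAttacker A).code := fun i hi => by
    simp only [instrumentAttacker, List.mem_append]
    exact .inl (.inr hi)
  simp only [attackerMoveLoad, List.mem_cons, List.not_mem_nil, or_false] at hmem
  have hr₁ := hr.update_aux (r := .aux) (by simp) (mi (.delay (A.ldAdr.eval ρ)))
  have hex₁ := Inst.Exec.load .aux A.ldAdr.delay ρi (mi (.delay (A.ldAdr.eval ρ)))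
  rw [hr.eval_delay] at hex₁
  have hex₄ := Inst.Exec.store A.ldAdr.hb (cst .lda)
    (Function.update ρi .aux (mi (.delay (A.ldAdr.eval ρ))))
  rw [hr₁.eval_hb, eval_cst] at hex₄
  refine ⟨_, .step _ (hmem _ (.inl rfl)) hex₁ (.ld _ _) rfl <|
    .step _ (hmem _ (.inr (.inl rfl))) (.assert _ _ (test_ne_zero ?_)) (.loc _) rfl <|
    .step _ (hmem _ (.inr (.inr (.inl rfl)))) (.store _ _ _) (.st _ _ _) rfl <|
    .step _ (hmem _ (.inr (.inr (.inr rfl)))) hex₄ (.st _ _ _) rfl (.refl _ _ _)⟩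
  simp [hβ _, hlook]

/-- The attacker simulates a TSO step by its code copy. -/
theorem attacker_copy_run {c c' : TSOState T L R D} {e : Event T L R D} (hs : TSOStep P c e c')
    (ht : e.thread = A.attacker) (hb : c.buf A.attacker ≠ []) (hst : ∀ a v, e.kind ≠ .st a v)
    (hr : RegRel ρi (c.reg A.attacker)) (hm : MemRel mi c.mem)
    (hβ : BufRel mi (c.buf A.attacker)) :
    ∃ ρi' mi', LocalRun (instrumentAttacker A).code (.tilde (c.pc A.attacker)) ρi mi
        (.tilde (c'.pc A.attacker)) ρi' mi' ∧
      RegRel ρi' (c'.reg A.attacker) ∧ MemRel mi' c'.mem ∧ BufRel mi' (c'.buf A.attacker) ∧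
      c'.mem = c.mem ∧ ∀ a, (∀ b, a ≠ .delay b) → mi' a = mi a := by
  classical
  cases hs with
  | loadBuffer t r e ℓ' v hin hv =>
    subst ht
    have hmem := fun i hi => mem_instrumentAttacker_copy (i := i) hin hi
    simp only [attackerCopy, List.mem_cons, List.not_mem_nil, or_false] at hmem
    have hd : mi (.delay (e.eval (c.reg A.attacker))) = .delay v := by rw [hβ, hv]; rfl
    have hr₁ := hr.update_aux (r := .aux) (by simp) (.delay v)
    have hr₂ := hr₁.update_aux (r := .aux) (by simp) (.delay v)
    have hex₁ := Inst.Exec.load .aux e.delay ρi (.delay v)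
    have hex₃ := Inst.Exec.load .aux e.delay (Function.update ρi .aux (.delay v)) (.delay v)
    have hacts := ActKind.Acts.ld (.delay (e.eval (c.reg A.attacker))) mi
    have hex₄ := Inst.Exec.assign (.orig r) (app (fun v => .val v.strip) .aux)
      (Function.update (Function.update ρi .aux (.delay v)) .aux (.delay v))
    rw [hr.eval_delay] at hex₁
    rw [hr₁.eval_delay] at hex₃
    rw [hd] at hacts
    rw [eval_app, Function.update_self, IVal.strip_delay] at hex₄
    refine ⟨_, mi, .step _ (hmem _ (.inr (.inr (.inr (.inl rfl))))) hex₁ hacts rfl <|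
      .step _ (hmem _ (.inr (.inr (.inr (.inr (.inl rfl))))))
        (.assert _ _ (test_ne_zero (by simp))) (.loc _) rfl <|
      .step _ (hmem _ (.inr (.inr (.inr (.inr (.inr (.inl rfl))))))) hex₃ hacts rfl <|
      .step _ (hmem _ (.inr (.inr (.inr (.inr (.inr (.inr rfl)))))))
        hex₄ (.loc _) ?_ (.refl _ _ _), ?_, ?_, ?_, rfl, fun _ _ => rfl⟩
    · simp [TSOState.goto]
    · simpa [TSOState.goto, TSOState.setReg] using hr₂.update r v
    · exact hm
    · exact hβ
  | loadMemory t r e ℓ' hin hv =>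
    subst ht
    have hmem := fun i hi => mem_instrumentAttacker_copy (i := i) hin hi
    simp only [attackerCopy, List.mem_cons, List.not_mem_nil, or_false] at hmem
    have hd : mi (.delay (e.eval (c.reg A.attacker))) = 0 := by rw [hβ, hv]; rfl
    have hr₁ := hr.update_aux (r := .aux) (by simp) 0
    have hex₁ := Inst.Exec.load .aux e.delay ρi 0
    have hacts₁ := ActKind.Acts.ld (.delay (e.eval (c.reg A.attacker))) mi
    have hex₃ := Inst.Exec.load (.orig r) e.lift (Function.update ρi .aux 0)
      (.val (c.mem (e.eval (c.reg A.attacker))))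
    have hacts₃ := ActKind.Acts.ld (.val (e.eval (c.reg A.attacker))) mi
    rw [hr.eval_delay] at hex₁
    rw [hr₁.eval_lift] at hex₃
    rw [hd] at hacts₁
    rw [hm] at hacts₃
    refine ⟨_, mi, .step _ (hmem _ (.inl rfl)) hex₁ hacts₁ rfl <|
      .step _ (hmem _ (.inr (.inl rfl))) (.assert _ _ (test_ne_zero (by simp))) (.loc _) rfl <|
      .step _ (hmem _ (.inr (.inr (.inl rfl)))) hex₃ hacts₃ ?_ (.refl _ _ _),
      ?_, ?_, ?_, rfl, fun _ _ => rfl⟩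
    · simp [TSOState.goto]
    · simpa [TSOState.goto, TSOState.setReg] using hr₁.update r _
    · exact hm
    · exact hβ
  | issue t e₁ e₂ ℓ' hin =>
    subst ht
    have hmem := fun i hi => mem_instrumentAttacker_copy (i := i) hin hi
    simp only [attackerCopy, List.mem_cons, List.not_mem_nil, or_false] at hmem
    have hex₁ := Inst.Exec.store e₁.delay e₂.delay ρi
    rw [hr.eval_delay, hr.eval_delay] at hex₁
    refine ⟨ρi, _, .step _ (hmem _ rfl) hex₁ (.st _ _ _) ?_ (.refl _ _ _), ?_, ?_, ?_, rfl,
      fun a ha => Function.update_of_ne (ha _) _ _⟩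
    · simp [TSOState.goto]
    · exact hr
    · exact hm.update_aux (by simp) _
    · intro a
      simpa [TSOState.goto, TSOState.setBuf] using delay_update hβ _ _ a
  | flush t a v β hb => exact absurd rfl (hst _ _)
  -- A fence requires an empty buffer, which the pending store of the attack rules out; hence the
  -- copy can do without fences.
  | mfence t ℓ' hin hb' =>
    subst ht
    exact absurd hb' hb
  | assign t r e ℓ' hin =>
    subst ht
    have hmem := fun i hi => mem_instrumentAttacker_copy (i := i) hin hi
    simp only [attackerCopy, List.mem_cons, List.not_mem_nil, or_false] at hmem
    have hex := Inst.Exec.assign (.orig r) e.lift ρi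
    rw [hr.eval_lift] at hex
    refine ⟨_, mi, .step _ (hmem _ rfl) hex (.loc _) ?_ (.refl _ _ _),
      ?_, ?_, ?_, rfl, fun _ _ => rfl⟩
    · simp [TSOState.goto]
    · simpa [TSOState.goto, TSOState.setReg] using hr.update r _
    · exact hm
    · exact hβ
  | assert t e ℓ' hin hne =>
    subst ht
    have hmem := fun i hi => mem_instrumentAttacker_copy (i := i) hin hi
    simp only [attackerCopy, List.mem_cons, List.not_mem_nil, or_false] at hmem
    refine ⟨ρi, mi, .step _ (hmem _ rfl) (.assert _ _ ?_) (.loc _) ?_ (.refl _ _ _),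
      hr, hm, hβ, rfl, fun _ _ => rfl⟩
    · simpa [hr.eval_lift] using hne
    · simp [TSOState.goto]

end

/-! ### Single steps and flushes within TSO runs. -/

theorem TSOStep.of_load_inst {P : Program T L R D} {c c' : TSOState T L R D} {e : Event T L R D}
    (h : TSOStep P c e c') {ℓ ℓ' : L} {r : R} {adr : Expr R D}
    (he : e.inst = some ⟨ℓ, .load r adr, ℓ'⟩) :
    c.pc e.thread = ℓ ∧ (∃ v, e.kind = .ld (adr.eval (c.reg e.thread)) v) ∧
      c'.mem = c.mem ∧ c'.buf = c.buf := by
  cases h <;> simp only [Option.some.injEq, LInst.mk.injEq, Inst.load.injEq, reduceCtorEq,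
    false_and, and_false] at he
  all_goals
    obtain ⟨rfl, ⟨rfl, rfl⟩, rfl⟩ := he
    exact ⟨rfl, ⟨_, rfl⟩, rfl, rfl⟩

theorem TSOStep.of_store_inst {P : Program T L R D} {c c' : TSOState T L R D} {e : Event T L R D}
    (h : TSOStep P c e c') {ℓ ℓ' : L} {adr val : Expr R D}
    (he : e.inst = some ⟨ℓ, .store adr val, ℓ'⟩) :
    c.pc e.thread = ℓ ∧ c'.pc e.thread = ℓ' ∧ c'.reg = c.reg ∧ c'.mem = c.mem ∧
      c'.buf e.thread =
        c.buf e.thread ++ [(adr.eval (c.reg e.thread), val.eval (c.reg e.thread))] := by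
  classical
  cases h <;> simp only [Option.some.injEq, LInst.mk.injEq, Inst.store.injEq, reduceCtorEq,
    false_and, and_false] at he
  obtain ⟨rfl, ⟨rfl, rfl⟩, rfl⟩ := he
  refine ⟨rfl, ?_, rfl, rfl, ?_⟩ <;> simp [TSOState.goto, TSOState.setBuf]

/-- The entries of a buffer are flushed by a run to a state with empty buffers. -/
theorem TSORun.exists_store {P : Program T L R D} {c c' : TSOState T L R D}
    {τ : List (Event T L R D)} (h : TSORun P c τ c') {t : T} (hb : c'.buf t = []) {q : D × D}
    (hq : q ∈ c.buf t) : ∃ e ∈ τ, e.thread = t ∧ e.kind = .st q.1 q.2 := by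
  classical
  induction h with
  | nil => simp [hb] at hq
  | @cons c c' c'' a τ h hτ ih =>
    by_cases hq' : q ∈ c'.buf t
    · obtain ⟨e, he, h'⟩ := ih hb hq'
      exact ⟨e, List.mem_cons_of_mem _ he, h'⟩
    · have ht : a.thread = t := by
        by_contra hne
        rw [(h.frame (Ne.symm hne)).2.2] at hq'
        exact hq' hq
      refine ⟨a, List.mem_cons_self, ht, ?_⟩
      subst ht
      cases h with
      | flush t a v β hβ =>
        rw [hβ] at hq
        simp only [TSOState.setBuf, Function.update_self] at hq'
        rcases List.mem_cons.1 hq with rfl | hq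
        · rfl
        · exact absurd hq hq'
      | issue =>
        simp only [TSOState.goto, TSOState.setBuf, Function.update_self] at hq'
        exact absurd (List.mem_append_left _ hq) hq'
      | _ => exact absurd hq hq'

theorem TSORun.exists_step {P : Program T L R D} {τ : List (Event T L R D)}
    {c₀ cₑ : TSOState T L R D} (h : TSORun P c₀ τ cₑ) {k : ℕ} {e : Event T L R D}
    (he : τ[k]? = some e) :
    ∃ c c', TSORun P c₀ (τ.take k) c ∧ TSOStep P c e c' ∧ TSORun P c (τ.drop k) cₑ := by
  rw [← List.take_append_drop k τ] at h
  obtain ⟨c, h1, h2⟩ := h.of_append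
  obtain ⟨hk, rfl⟩ := List.getElem?_eq_some_iff.1 he
  have h3 := h2
  rw [List.drop_eq_getElem_cons hk] at h3
  cases h3 with
  | cons h3 _ => exact ⟨c, _, h1, h3, h2⟩

/-! ### Happens-before in witnesses -/

section Witness

variable {P : Program T L R D} {A : Attack P} {τ τ₁ τ₂ τ₃ τ₄ : List (Event T L R D)}
  {isu ld st : Event T L R D} {i l s : ℕ}

namespace IsTSOWitness

theorem getElem?_isu (W : IsTSOWitness A τ τ₁ τ₂ τ₃ τ₄ isu ld st i l s) : τ[i]? = some isu := by
  rw [W.hτ, W.hi]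
  simp

theorem drop_l (W : IsTSOWitness A τ τ₁ τ₂ τ₃ τ₄ isu ld st i l s) :
    τ.drop l = ld :: (τ₃ ++ st :: τ₄) := by
  have : τ = (τ₁ ++ [isu] ++ τ₂) ++ (ld :: (τ₃ ++ st :: τ₄)) := by rw [W.hτ]; simp
  rw [this]
  refine List.drop_left' ?_
  rw [W.hl, W.hi]
  simp only [List.length_append, List.length_singleton]

theorem getElem?_ld (W : IsTSOWitness A τ τ₁ τ₂ τ₃ τ₄ isu ld st i l s) : τ[l]? = some ld := by
  have := congrArg (·[0]?) W.drop_l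
  simpa using this

theorem getElem?_st (W : IsTSOWitness A τ τ₁ τ₂ τ₃ τ₄ isu ld st i l s) : τ[s]? = some st := by
  have := congrArg (·[1 + τ₃.length]?) W.drop_l
  rw [List.getElem?_drop, ← Nat.add_assoc, ← W.hs, Nat.add_comm 1] at this
  simpa using this

theorem lt_length (W : IsTSOWitness A τ τ₁ τ₂ τ₃ τ₄ isu ld st i l s) : s < τ.length :=
  (List.getElem?_eq_some_iff.1 W.getElem?_st).1

theorem i_lt_l (W : IsTSOWitness A τ τ₁ τ₂ τ₃ τ₄ isu ld st i l s) : i < l := by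
  have := W.hl
  omega

theorem l_lt_s (W : IsTSOWitness A τ τ₁ τ₂ τ₃ τ₄ isu ld st i l s) : l < s := by
  have := W.hs
  omega

theorem thread_ne (W : IsTSOWitness A τ τ₁ τ₂ τ₃ τ₄ isu ld st i l s) {k : ℕ} (h : l < k)
    (h' : k < s) {e : Event T L R D} (he : τ[k]? = some e) : e.thread ≠ A.attacker := by
  obtain ⟨j, rfl⟩ := Nat.exists_eq_add_of_lt h
  have := congrArg (·[j + 1]?) W.drop_l
  have hs := W.hs
  rw [List.getElem?_drop, ← Nat.add_assoc, he, List.getElem?_cons_succ,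
    List.getElem?_append_left (by omega)] at this
  exact W.ld_last e (List.mem_of_getElem? this.symm)

theorem storeAt_st (W : IsTSOWitness A τ τ₁ τ₂ τ₃ τ₄ isu ld st i l s) :
    ∃ a, StoreAt τ s A.attacker a := W.isu_st.2.1

theorem loadAt_ld (W : IsTSOWitness A τ τ₁ τ₂ τ₃ τ₄ isu ld st i l s) :
    ∃ a, LoadAt τ l A.attacker a := by
  obtain ⟨cₑ, hrun, -⟩ := W.computation
  obtain ⟨c, c', -, hs, -⟩ := hrun.exists_step W.getElem?_ld
  obtain ⟨-, ⟨v, hk⟩, -⟩ := hs.of_load_inst W.ld_inst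
  exact ⟨_, ld, v, W.getElem?_ld, W.ld_thread, hk⟩

/-- Between positions `l` and `s` the attacker acts only at the two ends, and `st` entered program
order at `i < l`, before `ld`. -/
theorem not_progOrder (W : IsTSOWitness A τ τ₁ τ₂ τ₃ τ₄ isu ld st i l s) {m n p q : ℕ}
    (hm : l ≤ m) (hmn : m < n) (hn : n ≤ s) (hp : NodeAt τ A.attacker m p)
    (hq : NodeAt τ A.attacker n q) : ¬ p < q := by
  have thread : ∀ {n p}, NodeAt τ A.attacker n p → ThreadAt τ n A.attacker := by
    rintro n p (⟨-, ⟨a, e, v, he, ht, -⟩, -⟩ | ⟨-, h, -⟩)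
    · exact ⟨e, he, ht⟩
    · exact h
  have hlm : m = l := by
    by_contra hne
    obtain ⟨e, he, ht⟩ := thread hp
    exact W.thread_ne (by omega) (by omega) he ht
  have hns : n = s := by
    by_contra hne
    obtain ⟨e, he, ht⟩ := thread hq
    exact W.thread_ne (by omega) (by omega) he ht
  subst hlm hns
  obtain ⟨a, hl⟩ := W.loadAt_ld
  obtain ⟨b, hs⟩ := W.storeAt_st
  have hp' : m = p := by
    rcases hp with ⟨-, ⟨_, h⟩, -⟩ | h
    · exact absurd h hl.not_store
    · exact h.1
  have hq' : q = i := by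
    rcases hq with h | h
    · exact h.issue_unique W.isu_st
    · exact absurd ⟨b, hs⟩ h.2.2.2
  have := W.i_lt_l
  omega

/-- The dependence of the action at `n` on an earlier one after the load of the attack. -/
theorem dependence (W : IsTSOWitness A τ τ₁ τ₂ τ₃ τ₄ isu ld st i l s) {m n : ℕ} (hm : l ≤ m)
    (hmn : m < n) (hn : n ≤ s) (h : HappensBefore τ m n) :
    (∃ t, t ≠ A.attacker ∧ l < m ∧ ThreadAt τ m t ∧ ¬ IssueAt τ m t ∧ ThreadAt τ n t) ∨
      ∃ a t t', (StoreAt τ m t a ∧ (LoadAt τ n t' a ∨ StoreAt τ n t' a)) ∨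
        (LoadAt τ m t a ∧ StoreAt τ n t' a) := by
  rcases h with ⟨t, p, q, hp, hq, hpq⟩ | ⟨-, a, t, t', h1, h2⟩ | ⟨t, a, h1, h2, -⟩ | h
  · have thread : ∀ {n p}, NodeAt τ t n p → ThreadAt τ n t ∧ ¬ IssueAt τ n t := by
      rintro n p (⟨-, ⟨a, h⟩, -⟩ | ⟨-, h, h', -⟩)
      · refine ⟨?_, h.not_issue⟩
        obtain ⟨e, v, he, ht, -⟩ := h
        exact ⟨e, he, ht⟩
      · exact ⟨h, h'⟩
    have ht : t ≠ A.attacker := by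
      rintro rfl
      exact W.not_progOrder hm hmn hn hp hq hpq
    obtain ⟨h1, h2⟩ := thread hp
    refine .inl ⟨t, ht, ?_, h1, h2, (thread hq).1⟩
    by_contra hlt
    obtain rfl : m = l := by omega
    obtain ⟨e, he, ht'⟩ := h1
    rw [W.getElem?_ld] at he
    cases he
    exact ht (ht'.symm.trans W.ld_thread)
  · exact .inr ⟨a, t, t', .inl ⟨h1, .inr h2⟩⟩
  · obtain ⟨t', h2⟩ := h2.1
    exact .inr ⟨a, t', t, .inl ⟨h2, .inl h1⟩⟩
  · rcases h with ⟨m', ⟨t, a, h1, h2, -⟩, -, b, t₁, t₂, h3, h4⟩ | ⟨-, a, t, t', h1, h2⟩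
    · obtain ⟨t', e, v, he, -, hk⟩ := h2.1
      obtain ⟨e', v', he', -, hk'⟩ := h3
      rw [he] at he'
      cases he'
      rw [hk] at hk'
      cases hk'
      exact .inr ⟨a, t, t₂, .inr ⟨h1, h4⟩⟩
    · exact .inr ⟨a, t, t', .inr ⟨h1, h2⟩⟩

/-- This is the last edge of the path from `ld`. It starts at or behind `ld`, because positions
increase along the path. -/
theorem exists_dependence (W : IsTSOWitness A τ τ₁ τ₂ τ₃ τ₄ isu ld st i l s) {n : ℕ} (hl : l < n)
    (hn : n ≤ s) (hi : ∀ t, ¬ IssueAt τ n t) :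
    ∃ m, l ≤ m ∧ m < n ∧
      ((∃ t, t ≠ A.attacker ∧ l < m ∧ ThreadAt τ m t ∧ ¬ IssueAt τ m t ∧ ThreadAt τ n t) ∨
      ∃ a t t', (StoreAt τ m t a ∧ (LoadAt τ n t' a ∨ StoreAt τ n t' a)) ∨
        (LoadAt τ m t a ∧ StoreAt τ n t' a)) := by
  obtain ⟨m, hlm, hmn, hhb⟩ := Relation.TransGen.tail'_iff.1 (W.hb_path n hl hn hi)
  have hle : l ≤ m := by
    clear hhb hmn
    induction hlm with
    | refl => exact le_rfl
    | tail _ h ih => exact ih.trans h.1.le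
  exact ⟨m, hle, hmn, W.dependence hle hmn hn hhb⟩

/-- Consider the first edge of the path from `ld` to `st`. Program order is excluded, and store
order and source start at a store, so it is a conflict. With equal addresses, `st` would be visible
to the load, which was executed after `isu`; its source would lie at `s` or later, and the
overwriting store behind `s`, outside the path. -/
theorem address_ne (W : IsTSOWitness A τ τ₁ τ₂ τ₃ τ₄ isu ld st i l s) {a b : D}
    (ha : LoadAt τ l A.attacker a) (hb : StoreAt τ s A.attacker b) : a ≠ b := by
  rintro rfl
  obtain ⟨n, ⟨hln, hhb⟩, hns⟩ :=
    Relation.TransGen.head'_iff.1 (W.hb_path s W.l_lt_s le_rfl fun _ => hb.not_issue)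
  have hle : n ≤ s := by
    clear hhb hln
    induction hns using Relation.ReflTransGen.head_induction_on with
    | refl => exact le_rfl
    | head h _ ih => exact h.1.le.trans ih
  rcases hhb with ⟨t, p, q, hp, hq, hpq⟩ | ⟨-, _, _, _, h, -⟩ | ⟨_, _, -, h, -⟩ | h
  · obtain rfl : t = A.attacker := by
      obtain ⟨e, v, he, ht, -⟩ := ha
      rcases hp with ⟨-, ⟨_, e', _, he', ht', -⟩, -⟩ | ⟨-, ⟨e', he', ht'⟩, -⟩ <;>
      · rw [he] at he'
        cases he'
        exact ht'.symm.trans ht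
    exact W.not_progOrder le_rfl hln hle hp hq hpq
  · exact ha.not_store h
  · obtain ⟨_, h⟩ := h.1
    exact ha.not_store h
  · obtain ⟨s', hsrc, hv, hss⟩ := exists_source ha (s := s)
      ⟨⟨_, hb⟩, .inr ⟨i, W.isu_st, hb, W.i_lt_l⟩⟩
    rcases h with ⟨s'', ⟨t, a', h1, -, h3⟩, h4⟩ | h
    · obtain ⟨rfl, rfl⟩ := h1.unique ha
      have := h3 s' hv
      have := h4.1
      omega
    · exact h.1 _ hsrc

/-- The load of the attack does not read from the buffer of the attacker. -/
theorem lookup_eq_none (W : IsTSOWitness A τ τ₁ τ₂ τ₃ τ₄ isu ld st i l s)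
    {c cₑ : TSOState T L R D} (hrun : TSORun P c (τ.drop l) cₑ) (hₑ : cₑ.buf A.attacker = []) {a v : D}
    (hk : ld.kind = .ld a v) : bufLookup (c.buf A.attacker) a = none := by
  rw [bufLookup_eq_none]
  intro q hq
  obtain ⟨e, he, ht, hek⟩ := hrun.exists_store hₑ hq
  rw [W.drop_l, List.mem_cons, List.mem_append, List.mem_cons] at he
  rcases he with rfl | he | rfl | he
  · rw [hk] at hek
    cases hek
  · exact absurd ht (W.ld_last e he)
  · exact (W.address_ne ⟨ld, v, W.getElem?_ld, W.ld_thread, hk⟩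
      ⟨e, q.2, W.getElem?_st, ht, hek⟩).symm
  · exact W.rest_addresses e he _ _ _ _ hek hk

end IsTSOWitness

end Witness

/-! ### From witnesses to goal configurations -/

section

variable {P : Program T L R D} {A : Attack P} {lab lab' : L → ILabel L R D}
  {c c' : TSOState T L R D} {s s' : SCState T L R D}
  {d d' : SCState T (ILabel L R D) (IReg R) (IVal D)} {t : T} {e : Event T L R D}

/-- The instrumented state `d` simulates the thread `t` of `c`, by the code with labels `lab`. -/
structure SimAt (P : Program T L R D) (lab : L → ILabel L R D) (c : TSOState T L R D)
    (s : SCState T L R D) (d : SCState T (ILabel L R D) (IReg R) (IVal D)) (t : T) : Prop where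
  lag : Lagging P c s t
  reg : RegRel (d.reg t) (s.reg t)
  pc : d.pc t = lab (s.pc t)
  label : s.pc t ∈ (P t).labels

theorem SimAt.frame (h : SimAt P lab c s d t)
    (hc : c'.pc t = c.pc t ∧ c'.reg t = c.reg t ∧ c'.buf t = c.buf t)
    (hs : s'.pc t = s.pc t ∧ s'.reg t = s.reg t)
    (hd : d'.pc t = d.pc t ∧ d'.reg t = d.reg t) : SimAt P lab c' s' d' t where
  lag := h.lag.frame hc hs
  reg := by rw [hd.2, hs.2]; exact h.reg
  pc := by rw [hd.1, hs.1]; exact h.pc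
  label := by rw [hs.1]; exact h.label

/-- Simulation of a step of a thread that does not delay stores. -/
theorem SimAt.step (Q : (D → D) → (IVal D → IVal D) → Prop) (h : SimAt P lab c s d e.thread)
    (hm : s.mem = c.mem) (hs : TSOStep P c e c')
    (hbuf : c.buf e.thread ≠ [] → ∃ a v, e.kind = .st a v) (hd : SCReachable A.instrument d)
    (hrun : ∀ j ∈ (P e.thread).code, ∀ ρ' m', j.inst.Exec (s.reg e.thread) e.kind ρ' →
      e.kind.Acts s.mem m' → ∃ ρi' mi', LocalRun (A.instrument e.thread).code (lab j.src)
        (d.reg e.thread) d.mem (lab' j.dst) ρi' mi' ∧ RegRel ρi' ρ' ∧ Q m' mi') :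
    (e.kind = .isu ∧ SimAt P lab c' s d e.thread ∧ s.mem = c'.mem) ∨
      ∃ s' d', SCReachable A.instrument d' ∧ SimAt P lab' c' s' d' e.thread ∧ s'.mem = c'.mem ∧
        Q s'.mem d'.mem ∧ (∀ u, u ≠ e.thread → s'.pc u = s.pc u ∧ s'.reg u = s.reg u) ∧
        ∀ u, u ≠ e.thread → d'.pc u = d.pc u ∧ d'.reg u = d.reg u := by
  classical
  rcases h.lag.step hm hs hbuf with ⟨h1, h2, h3⟩ | ⟨⟨t, k, io⟩, s', hstep, ht, hk, h2, h3⟩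
  · exact .inl ⟨h1, ⟨h2, h.reg, h.pc, h.label⟩, h3⟩
  · right
    dsimp only at ht hk
    subst ht hk
    obtain ⟨j, ρ', hact⟩ := id hstep
    obtain ⟨ρi', mi', hr, hreg, hQ⟩ := hrun j hact.mem_code ρ' s'.mem hact.exec hact.acts
    refine ⟨s', _, hr.reachable (by rw [h.pc, hact.src]) rfl rfl hd, ⟨h2, ?_, ?_, ?_⟩, h3, hQ,
      fun u hu => hstep.frame hu, fun u hu =>
        ⟨Function.update_of_ne hu _ _, Function.update_of_ne hu _ _⟩⟩
    · simpa [hact.reg] using hreg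
    · simp [hact.pc]
    -- The success check exists only at labels of the thread, so membership has to be carried along.
    · rw [hact.pc, Function.update_self]
      exact List.mem_cons_of_mem _ (List.mem_flatMap.2 ⟨j, hact.mem_code, by simp⟩)

/-- Before the load of the attack, the threads in `U` are simulated by their original code. -/
structure EarlySim (A : Attack P) (U : T → Prop) (c : TSOState T L R D) (s : SCState T L R D)
    (d : SCState T (ILabel L R D) (IReg R) (IVal D)) : Prop where
  reach : SCReachable A.instrument d
  mem : s.mem = c.mem
  memRel : MemRel d.mem s.mem
  flag : d.mem .hbFlag = 0
  sim : ∀ t, U t → SimAt P .orig c s d t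

theorem EarlySim.initial (A : Attack P) (U : T → Prop) :
    EarlySim A U (.initial P) (.initial P) (.initial A.instrument) where
  reach := .refl
  mem := rfl
  memRel _ := rfl
  flag := rfl
  sim t _ := ⟨⟨rfl, .inl ⟨rfl, rfl⟩⟩, fun _ => rfl, by
    by_cases ht : t = A.attacker
    · subst ht
      simp [SCState.initial, instrument_attacker, instrumentAttacker]
    · simp [SCState.initial, instrument_helper A ht, instrumentHelper], List.mem_cons_self⟩

/-- As long as the flag is down, original code can be followed. The untouched auxiliary memory is
reported because the image of the attacker's buffer and `stAdr` are stored there. -/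
theorem EarlySim.step {U : T → Prop} (h : EarlySim A U c s d) (hs : TSOStep P c e c')
    (hU : U e.thread) (hbuf : c.buf e.thread ≠ [] → ∃ a v, e.kind = .st a v) :
    ∃ s' d', EarlySim A U c' s' d' ∧ (∀ a, (∀ b, a ≠ .val b) → d'.mem a = d.mem a) ∧
      ∀ u, u ≠ e.thread → d'.pc u = d.pc u ∧ d'.reg u = d.reg u := by
  rcases (h.sim _ hU).step (A := A) (lab' := .orig)
    (fun m' mi' => MemRel mi' m' ∧ ∀ a, (∀ b, a ≠ .val b) → mi' a = d.mem a) h.mem hs hbuf h.reach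
    (fun j hj ρ' m' hex hacts => by
      by_cases ht : e.thread = A.attacker
      · have := attacker_orig_run (A := A) (ht ▸ hj) hex hacts (h.sim _ hU).reg h.memRel
        rwa [← instrument_attacker, ← ht] at this
      · rw [instrument_helper A ht]
        exact helper_orig_run hj hex hacts (h.sim _ hU).reg h.memRel h.flag) with
    ⟨-, h1, h2⟩ | ⟨s', d', h1, h2, h3, h4, h5, h6⟩
  · refine ⟨s, d, ⟨h.reach, h2, h.memRel, h.flag, fun t ht => ?_⟩, fun _ _ => rfl,
      fun _ _ => ⟨rfl, rfl⟩⟩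
    by_cases hte : t = e.thread
    · rwa [hte]
    · exact (h.sim t ht).frame (hs.frame hte) ⟨rfl, rfl⟩ ⟨rfl, rfl⟩
  · refine ⟨s', d', ⟨h1, h3, h4.1, (h4.2 _ (by simp)).trans h.flag, fun t ht => ?_⟩, h4.2, h6⟩
    by_cases hte : t = e.thread
    · rwa [hte]
    · exact (h.sim t ht).frame (hs.frame hte) (h5 t hte) (h6 t hte)

/-- The attacker between the issue of the attack's store to `x` and the attack's load. -/
structure DelayingSim (A : Attack P) (x : D) (c : TSOState T L R D)
    (d : SCState T (ILabel L R D) (IReg R) (IVal D)) : Prop where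
  reg : RegRel (d.reg A.attacker) (c.reg A.attacker)
  pc : d.pc A.attacker = .tilde (c.pc A.attacker)
  adr : d.mem .stAdr = .val x
  buf : BufRel d.mem (c.buf A.attacker)
  head : ∃ v β, c.buf A.attacker = (x, v) :: β

/-- Issues append at the end and only a store action removes the head, so the entry of the attack's
store stays in front until `st` and identifies its address. -/
theorem TSOStep.head_buf (hs : TSOStep P c e c') (hst : ∀ a v, e.kind ≠ .st a v) {x v : D}
    {β : List (D × D)} (h : c.buf e.thread = (x, v) :: β) :
    ∃ β', c'.buf e.thread = (x, v) :: β' := by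
  classical
  cases hs with
  | flush => exact absurd rfl (hst _ _)
  | issue t e₁ e₂ ℓ' hin =>
    dsimp only at h
    exact ⟨β ++ [(e₁.eval (c.reg t), e₂.eval (c.reg t))], by
      simp [TSOState.goto, TSOState.setBuf, h]⟩
  | _ => exact ⟨β, h⟩

open Classical in
/-- Steps between the issue of the attack's store and the attack's load. -/
theorem DelayingSim.step {x : D} (h : EarlySim A (· ≠ A.attacker) c s d) (hx : DelayingSim A x c d)
    (hs : TSOStep P c e c') (hst : e.thread = A.attacker → ∀ a v, e.kind ≠ .st a v)
    (hbuf : e.thread ≠ A.attacker → c.buf e.thread ≠ [] → ∃ a v, e.kind = .st a v) :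
    ∃ s' d', EarlySim A (· ≠ A.attacker) c' s' d' ∧ DelayingSim A x c' d' := by
  obtain ⟨v, β, hβ⟩ := hx.head
  by_cases ht : e.thread = A.attacker
  · obtain ⟨ρi', mi', h1, h2, h3, h4, h5, h6⟩ := attacker_copy_run (A := A) hs ht (by simp [hβ])
      (hst ht) hx.reg (h.mem ▸ h.memRel) hx.buf
    rw [← instrument_attacker] at h1
    have hd := h1.reachable hx.pc rfl rfl h.reach
    refine ⟨s, _, ⟨hd, h.mem.trans h5.symm, ?_, (h6 _ (by simp)).trans h.flag, fun u hu => ?_⟩,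
      ⟨?_, ?_, (h6 _ (by simp)).trans hx.adr, h4, ?_⟩⟩
    · rw [h.mem, ← h5]
      exact h3
    · exact (h.sim u hu).frame (hs.frame (by rwa [ht])) ⟨rfl, rfl⟩
        ⟨Function.update_of_ne hu _ _, Function.update_of_ne hu _ _⟩
    · simpa using h2
    · simp
    · rw [← ht] at hβ ⊢
      exact ⟨v, hs.head_buf (hst ht) hβ⟩
  · obtain ⟨s', d', h1, h2, h3⟩ := h.step hs ht (hbuf ht)
    have hc := hs.frame (Ne.symm ht)
    have hd := h3 _ (Ne.symm ht)
    refine ⟨s', d', h1, ⟨?_, ?_, (h2 _ (by simp)).trans hx.adr, fun a => ?_, ?_⟩⟩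
    · rw [hd.2, hc.2.1]
      exact hx.reg
    · rw [hd.1, hc.1]
      exact hx.pc
    · rw [h2 _ (by simp), hc.2.2]
      exact hx.buf a
    · rw [hc.2.2]
      exact hx.head

/-- The simulation after the load at position `l` of `τ`, up to position `k`. -/
structure LateSim (A : Attack P) (x : D) (τ : List (Event T L R D)) (l k : ℕ) (c : TSOState T L R D)
    (s : SCState T L R D) (d : SCState T (ILabel L R D) (IReg R) (IVal D)) : Prop where
  reach : SCReachable A.instrument d
  mem : s.mem = c.mem
  memRel : MemRel d.mem s.mem
  adr : d.mem .stAdr = .val x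
  head : ∃ v β, c.buf A.attacker = (x, v) :: β
  sim : ∀ t, t ≠ A.attacker → SimAt P .orig c s d t ∨ SimAt P .tilde c s d t
  moved : ∀ m t, l < m → m < k → t ≠ A.attacker → ThreadAt τ m t → ¬ IssueAt τ m t →
    SimAt P .tilde c s d t
  load : ∀ m t a, l ≤ m → m < k → LoadAt τ m t a → 1 ≤ (d.mem (.hb a)).rank
  store : ∀ m t a, l ≤ m → m < k → StoreAt τ m t a → (d.mem (.hb a)).rank = 2

end

/-! ### Helpers after the load of the attack. -/

section Witness

variable {P : Program T L R D} {A : Attack P} {τ τ₁ τ₂ τ₃ τ₄ : List (Event T L R D)}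
  {isu ld st : Event T L R D} {i l s₀ : ℕ} {x : D} {k : ℕ} {c c' : TSOState T L R D}
  {s : SCState T L R D} {d : SCState T (ILabel L R D) (IReg R) (IVal D)} {e : Event T L R D}

/-- The helper that acts next can be simulated by a step that records its access type. -/
theorem LateSim.run (W : IsTSOWitness A τ τ₁ τ₂ τ₃ τ₄ isu ld st i l s₀)
    (h : LateSim A x τ l k c s d) (hl : l < k) (hk : k < s₀) (he : τ[k]? = some e)
    (hisu : e.kind ≠ .isu) :
    ∃ lab : L → ILabel L R D, SimAt P lab c s d e.thread ∧
      ∀ j ∈ (P e.thread).code, ∀ ρ' m', j.inst.Exec (s.reg e.thread) e.kind ρ' →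
        e.kind.Acts s.mem m' →
        CopyRun (P e.thread) e.kind (lab j.src) (d.reg e.thread) d.mem j.dst ρ' m' := by
  have ht := W.thread_ne hl hk he
  by_cases htilde : SimAt P .tilde c s d e.thread
  · exact ⟨.tilde, htilde, fun j hj ρ' m' hex hacts =>
      helper_copy_run hj hex hacts htilde.reg h.memRel⟩
  have horig := (h.sim _ ht).resolve_right htilde
  refine ⟨.orig, horig, fun j hj ρ' m' hex hacts => ?_⟩
  -- A helper still in its original code depends on an earlier action. A shared thread would have
  -- put it into the copy already; in the other cases the recorded type is exactly what the move
  -- tests.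
  obtain ⟨m, hlm, hmk, ⟨t, h1, h2, h3, h4, e', h5, rfl⟩ | ⟨a, t, t', ⟨h1, h2 | h2⟩ | ⟨h1, h2⟩⟩⟩ :=
    W.exists_dependence hl hk.le (fun t ⟨e', he', _, hk'⟩ => by
      rw [he] at he'
      cases he'
      exact hisu hk')
  · rw [he] at h5
    cases h5
    exact absurd (h.moved m _ h2 hmk h1 h3 h4) htilde
  · obtain ⟨e', v, he', -, hkind⟩ := h2
    rw [he] at he'
    cases he'
    exact helper_moveLoad_run hj hex hacts horig.reg h.memRel hkind (h.store m t a hlm hmk h1)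
  · obtain ⟨e', v, he', -, hkind⟩ := h2
    rw [he] at he'
    cases he'
    have := h.store m t a hlm hmk h1
    exact helper_moveStore_run hj hex hacts horig.reg h.memRel hkind (by omega)
  · obtain ⟨e', v, he', -, hkind⟩ := h2
    rw [he] at he'
    cases he'
    exact helper_moveStore_run hj hex hacts horig.reg h.memRel hkind (h.load m t a hlm hmk h1)

/-- An issue is no node of its own and is matched by no instrumented step. Any other action is
matched by an uninterrupted run that ends in the copy and records the access, so recorded types
cannot become stale in between. -/
theorem LateSim.step (W : IsTSOWitness A τ τ₁ τ₂ τ₃ τ₄ isu ld st i l s₀)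
    (h : LateSim A x τ l k c s d) (hl : l < k) (hk : k < s₀) (he : τ[k]? = some e)
    (hs : TSOStep P c e c') (hbuf : c.buf e.thread ≠ [] → ∃ a v, e.kind = .st a v) :
    ∃ s' d', LateSim A x τ l (k + 1) c' s' d' := by
  have ht := W.thread_ne hl hk he
  have hhead : ∃ v β, c'.buf A.attacker = (x, v) :: β := by
    rw [(hs.frame (Ne.symm ht)).2.2]
    exact h.head
  by_cases hisu : e.kind = .isu
  · have key : ∀ lab : L → ILabel L R D, SimAt P lab c s d e.thread →
        SimAt P lab c' s d e.thread ∧ s.mem = c'.mem := by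
      intro lab hsim
      rcases hsim.lag.step h.mem hs hbuf with ⟨-, h1, h2⟩ | ⟨e', s', ⟨i, ρ, hact⟩, -, hk', -⟩
      · exact ⟨⟨h1, hsim.reg, hsim.pc, hsim.label⟩, h2⟩
      · have := hact.exec
        rw [hk', hisu] at this
        generalize i.inst = inst at this
        cases this
    have hmem : s.mem = c'.mem := by
      rcases h.sim _ ht with h' | h' <;> exact (key _ h').2
    have hsim : ∀ (lab : L → ILabel L R D) t, SimAt P lab c s d t → SimAt P lab c' s d t := by
      intro lab t h'
      by_cases hte : t = e.thread
      · subst hte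
        exact (key lab h').1
      · exact h'.frame (hs.frame hte) ⟨rfl, rfl⟩ ⟨rfl, rfl⟩
    refine ⟨s, d, h.reach, hmem, h.memRel, h.adr, hhead,
      fun t ht => (h.sim t ht).imp (hsim _ _) (hsim _ _), fun m t hlm hmk ht' h1 h2 => ?_,
      fun m t a hlm hmk h1 => ?_, fun m t a hlm hmk h1 => ?_⟩
    · rcases Nat.lt_succ_iff_lt_or_eq.1 hmk with hmk | rfl
      · exact hsim _ _ (h.moved m t hlm hmk ht' h1 h2)
      · obtain ⟨e', he', rfl⟩ := h1
        rw [he] at he'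
        cases he'
        exact absurd ⟨e, he, rfl, hisu⟩ h2
    · rcases Nat.lt_succ_iff_lt_or_eq.1 hmk with hmk | rfl
      · exact h.load m t a hlm hmk h1
      · exact absurd ⟨e, he, rfl, hisu⟩ h1.not_issue
    · rcases Nat.lt_succ_iff_lt_or_eq.1 hmk with hmk | rfl
      · exact h.store m t a hlm hmk h1
      · exact absurd ⟨e, he, rfl, hisu⟩ h1.not_issue
  obtain ⟨lab, hlab, hrun⟩ := h.run W hl hk he hisu
  obtain ⟨h1, -⟩ | ⟨s', d', h1, h2, h3, h4, h5, h6⟩ := hlab.step (A := A) (lab' := .tilde)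
    (fun m' mi' => MemRel mi' m' ∧ Records e.kind d.mem mi') h.mem hs hbuf h.reach
    (by rwa [instrument_helper A ht])
  · exact absurd h1 hisu
  have hsim : ∀ (lab : L → ILabel L R D) t, t ≠ e.thread → SimAt P lab c s d t →
      SimAt P lab c' s' d' t :=
    fun lab t hte h' => h'.frame (hs.frame hte) (h5 t hte) (h6 t hte)
  refine ⟨s', d', h1, h3, h4.1, (h4.2.other _ (by simp) (by simp)).trans h.adr, hhead,
    fun t ht => ?_, fun m t hlm hmk ht' h1 h2 => ?_, fun m t a hlm hmk h1 => ?_,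
    fun m t a hlm hmk h1 => ?_⟩
  · by_cases hte : t = e.thread
    · subst hte
      exact .inr h2
    · exact (h.sim t ht).imp (hsim _ _ hte) (hsim _ _ hte)
  · by_cases hte : t = e.thread
    · subst hte
      assumption
    · rcases Nat.lt_succ_iff_lt_or_eq.1 hmk with hmk | rfl
      · exact hsim _ _ hte (h.moved m t hlm hmk ht' h1 h2)
      · obtain ⟨e', he', rfl⟩ := h1
        rw [he] at he'
        cases he'
        exact absurd rfl hte
  · rcases Nat.lt_succ_iff_lt_or_eq.1 hmk with hmk | rfl
    · exact (h.load m t a hlm hmk h1).trans (h4.2.mono a)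
    · obtain ⟨e', v, he', -, hkind⟩ := h1
      rw [he] at he'
      cases he'
      exact h4.2.load a v hkind
  · rcases Nat.lt_succ_iff_lt_or_eq.1 hmk with hmk | rfl
    -- Rank `2` is kept: ranks never decrease and never exceed `2`.
    · have := h.store m t a hlm hmk h1
      have := h4.2.mono a
      have := (d'.mem (.hb a)).rank_le_two
      omega
    · obtain ⟨e', v, he', -, hkind⟩ := h1
      rw [he] at he'
      cases he'
      exact h4.2.store a v hkind

/-- The attacker has not issued delayed stores before the store of the attack. -/
theorem IsTSOWitness.store_of_pending (W : IsTSOWitness A τ τ₁ τ₂ τ₃ τ₄ isu ld st i l s₀)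
    {cₑ : TSOState T L R D} (hₑ : ∀ t, cₑ.buf t = []) (h : TSORun P (.initial P) (τ.take k) c)
    (h' : TSORun P c (τ.drop k) cₑ) (he : τ[k]? = some e)
    (hki : e.thread = A.attacker → k ≤ i) (hb : c.buf e.thread ≠ []) :
    ∃ a v, e.kind = .st a v := by
  refine h.store_of_pending h' (hₑ _) he hb fun p q hp hpq => ?_
  by_cases ht : e.thread = A.attacker
  · rw [ht] at hpq ⊢
    exact W.first_delayed p q (hp.trans_le (hki ht)) hpq
  · exact W.helpers_undelayed _ p q ht hpq

theorem IsTSOWitness.isu_kind (W : IsTSOWitness A τ τ₁ τ₂ τ₃ τ₄ isu ld st i l s₀) :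
    isu.thread = A.attacker ∧ isu.kind = .isu := by
  obtain ⟨e, he, h⟩ := W.isu_st.1
  rw [W.getElem?_isu] at he
  cases he
  exact h

/-- A pending store at `i` would be undelayed, so the next action of the attacker would have to
perform it; but that action is an issue. -/
theorem IsTSOWitness.buf_isu (W : IsTSOWitness A τ τ₁ τ₂ τ₃ τ₄ isu ld st i l s₀)
    {cₑ : TSOState T L R D} (hₑ : ∀ t, cₑ.buf t = []) (h : TSORun P (.initial P) (τ.take i) c)
    (h' : TSORun P c (τ.drop i) cₑ) : c.buf A.attacker = [] := by
  by_contra hb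
  obtain ⟨ht, hk⟩ := W.isu_kind
  rw [← ht] at hb
  obtain ⟨a, v, hst⟩ := W.store_of_pending hₑ h h' W.getElem?_isu (fun _ => le_rfl) hb
  rw [hk] at hst
  cases hst

/-- The attacker performs no store between the issue of the attack's store and that store. -/
theorem IsTSOWitness.not_store (W : IsTSOWitness A τ τ₁ τ₂ τ₃ τ₄ isu ld st i l s₀)
    (h : TSORun P (.initial P) (τ.take i) c) (hb : c.buf A.attacker = []) (hi : i ≤ k) (hk : k < s₀)
    (he : τ[k]? = some e) (ht : e.thread = A.attacker) (a v : D) : e.kind ≠ .st a v := by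
  classical
  -- The issues before `i` are as many as the attacker's stores before `s₀`. With an empty buffer at
  -- `i`, all of these stores lie before `i`, so one more at `k` is too many.
  intro hst
  have h1 := h.buffer_length A.attacker
  have h2 := (isIssueOf_iff.1 W.isu_st).2.2
  rw [hb] at h1
  have h0 : ((TSOState.initial P).buf A.attacker).length = 0 := rfl
  simp only [h0, List.length_nil, Nat.add_zero] at h1
  have h3 := countP_take_succ_of_getElem?
    (p := fun e : Event T L R D => decide (e.IsStore A.attacker)) he
  have h4 := countP_take_le (fun e : Event T L R D => decide (e.IsStore A.attacker)) τ
    (m := k + 1) (n := s₀) (by omega)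
  have h5 := countP_take_le (fun e : Event T L R D => decide (e.IsStore A.attacker)) τ hi
  have h6 : e.IsStore A.attacker := ⟨ht, a, v, hst⟩
  simp only [h6, decide_true, if_true] at h3
  unfold stores at *
  omega

end Witness

theorem TSORun.next {P : Program T L R D} {τ : List (Event T L R D)} {c₀ c cₑ : TSOState T L R D}
    {k : ℕ} {e : Event T L R D} (h₀ : TSORun P c₀ (τ.take k) c) (h : TSORun P c (τ.drop k) cₑ)
    (he : τ[k]? = some e) :
    ∃ c', TSOStep P c e c' ∧ TSORun P c₀ (τ.take (k + 1)) c' ∧ TSORun P c' (τ.drop (k + 1)) cₑ := by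
  have ht := List.take_add_one (l := τ) (i := k)
  rw [he] at ht
  obtain ⟨hk, rfl⟩ := List.getElem?_eq_some_iff.1 he
  rw [List.drop_eq_getElem_cons hk] at h
  cases h with
  | cons h hτ =>
    refine ⟨_, h, ?_, hτ⟩
    rw [ht]
    exact h₀.append (.single h)

/-! ### Issue, load and store of the attack, and the goal configuration. -/

section Witness

variable {P : Program T L R D} {A : Attack P} {τ τ₁ τ₂ τ₃ τ₄ : List (Event T L R D)}
  {isu ld st : Event T L R D} {i l s₀ : ℕ} {c c' : TSOState T L R D} {s : SCState T L R D}
  {d : SCState T (ILabel L R D) (IReg R) (IVal D)} {x : D}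

open Classical in
-- From here on the SC state follows the helpers only; the attacker's label, registers and buffer
-- are compared with the TSO state directly.
theorem IsTSOWitness.issue_sim (W : IsTSOWitness A τ τ₁ τ₂ τ₃ τ₄ isu ld st i l s₀)
    (h : EarlySim A (fun _ => True) c s d) (hβ : BufRel d.mem []) (hs : TSOStep P c isu c')
    (hb : c.buf A.attacker = []) :
    ∃ x s d', EarlySim A (· ≠ A.attacker) c' s d' ∧ DelayingSim A x c' d' := by
  obtain ⟨hpc, hpc', hreg, hmem, hbuf⟩ := hs.of_store_inst W.isu_inst
  have hf := fun u hu => hs.frame (t := u) hu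
  rw [W.isu_kind.1] at hpc hpc' hbuf hf
  obtain ⟨hlag, hr, hd, -⟩ := h.sim A.attacker trivial
  -- With an empty buffer the SC state does not lag behind.
  have hsc : s.pc A.attacker = c.pc A.attacker := by
    rcases hlag.2 with ⟨-, h⟩ | ⟨_, _, -, h⟩
    · exact h
    · rw [h] at hb
      cases hb
  rw [hsc, hpc] at hd
  rw [hlag.1] at hr
  have hrun := attacker_moveStore_run (A := A) (mi := d.mem) hr
  rw [← instrument_attacker] at hrun
  rw [hb, List.nil_append] at hbuf
  refine ⟨A.stAdr.eval (c.reg A.attacker), s, _, ⟨hrun.reachable hd rfl rfl h.reach,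
    h.mem.trans hmem.symm, (h.memRel.update_aux (by simp) _).update_aux (by simp) _, ?_,
    fun u hu => ?_⟩, ⟨?_, ?_, ?_, ?_, ?_⟩⟩
  · simpa using h.flag
  · exact (h.sim u trivial).frame (hf u hu) ⟨rfl, rfl⟩
      ⟨Function.update_of_ne hu _ _, Function.update_of_ne hu _ _⟩
  · simpa [hreg] using hr
  · simp [hpc']
  · simp
  · intro a
    have := delay_update hβ (A.stAdr.eval (c.reg A.attacker)) (A.stVal.eval (c.reg A.attacker)) a
    rw [List.nil_append] at this
    rw [hbuf, ← this]
    dsimp only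
    rw [Function.update_of_ne (by simp)]
  · exact ⟨_, _, hbuf⟩

open Classical in
-- The test of the delay cell succeeds by `lookup_eq_none`. The recorded access type `lda` starts
-- the bookkeeping; no helper has to have moved yet.
theorem IsTSOWitness.load_sim (W : IsTSOWitness A τ τ₁ τ₂ τ₃ τ₄ isu ld st i l s₀)
    (h : EarlySim A (· ≠ A.attacker) c s d) (hx : DelayingSim A x c d) (hs : TSOStep P c ld c')
    {cₑ : TSOState T L R D} (hₑ : ∀ t, cₑ.buf t = []) (hrun : TSORun P c (τ.drop l) cₑ) :
    ∃ s d', LateSim A x τ l (l + 1) c' s d' := by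
  obtain ⟨hpc, ⟨v, hk⟩, hmem, hbuf⟩ := hs.of_load_inst W.ld_inst
  have hf := fun u hu => hs.frame (t := u) hu
  rw [W.ld_thread] at hpc hk hf
  have hd := hx.pc
  rw [hpc] at hd
  obtain ⟨ρi', hr⟩ := attacker_moveLoad_run (A := A) hx.reg hx.buf
    (W.lookup_eq_none hrun (hₑ _) hk)
  rw [← instrument_attacker] at hr
  have hload : LoadAt τ l A.attacker (A.ldAdr.eval (c.reg A.attacker)) :=
    ⟨ld, v, W.getElem?_ld, W.ld_thread, hk⟩
  refine ⟨s, _, hr.reachable hd rfl rfl h.reach, h.mem.trans hmem.symm,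
    (h.memRel.update_aux (by simp) _).update_aux (by simp) _, ?_, ?_, fun u hu => .inl ?_,
    fun m t h1 h2 => by omega, fun m t a h1 h2 h3 => ?_, fun m t a h1 h2 h3 => ?_⟩
  · simpa using hx.adr
  · rw [hbuf]
    exact hx.head
  · exact (h.sim u hu).frame (hf u hu) ⟨rfl, rfl⟩
      ⟨Function.update_of_ne hu _ _, Function.update_of_ne hu _ _⟩
  · obtain rfl : m = l := by omega
    obtain ⟨-, rfl⟩ := h3.unique hload
    simp [IVal.rank]
  · obtain rfl : m = l := by omega
    exact absurd h3 hload.not_store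

open Classical in
-- The last edge into `st` cannot be program order of a helper, so it comes from an access to the
-- address of `st`. That access is not `ld`, whose address differs, hence it belongs to a helper,
-- which is now in its copy and finds a nonzero access type.
theorem IsTSOWitness.goal_of_lateSim (W : IsTSOWitness A τ τ₁ τ₂ τ₃ τ₄ isu ld st i l s₀)
    (h : LateSim A x τ l s₀ c s d) (hs : TSOStep P c st c') :
    ∃ d', SCReachable A.instrument d' ∧ IsGoal d' := by
  obtain ⟨b, hb⟩ := W.storeAt_st
  obtain ⟨e, v, he, ht, hk⟩ := id hb
  rw [W.getElem?_st] at he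
  cases he
  -- A flush removes the oldest entry of the buffer, which is the one issued by `isu`.
  obtain rfl : b = x := by
    obtain ⟨w, β, hβ⟩ := h.head
    cases hs <;> simp only [reduceCtorEq, ActKind.st.injEq] at hk
    rename_i hβ'
    dsimp only at ht
    rw [ht, hβ] at hβ'
    cases hβ'
    exact hk.1.symm
  -- a helper that has accessed the address of the store
  have key : ∀ m t, l < m → m < s₀ → ThreadAt τ m t → ¬ IssueAt τ m t →
      1 ≤ (d.mem (.hb b)).rank → ∃ d', SCReachable A.instrument d' ∧ IsGoal d' := by
    intro m t hlm hms htm hi hrank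
    have hta : t ≠ A.attacker := by
      obtain ⟨e, he, rfl⟩ := htm
      exact W.thread_ne hlm hms he
    have hsim := h.moved m t hlm hms hta htm hi
    obtain ⟨ρi', hr⟩ := helper_check_run (th := P t) (ρi := d.reg t) hsim.label h.adr hrank
    rw [← instrument_helper A hta] at hr
    exact ⟨_, hr.reachable hsim.pc rfl rfl h.reach, by simp [IsGoal]⟩
  obtain ⟨m, hlm, hms, ⟨t, h1, -, -, -, e, h5, rfl⟩ | ⟨a, t, t', ⟨h1, h2⟩ | ⟨h1, h2⟩⟩⟩ :=
    W.exists_dependence W.l_lt_s le_rfl fun _ => hb.not_issue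
  · rw [W.getElem?_st] at h5
    cases h5
    exact absurd ht h1
  · have h2 := h2.resolve_left fun h2 => h2.not_store hb
    obtain rfl : a = b := by
      obtain ⟨e, w, he, -, hk'⟩ := h2
      rw [W.getElem?_st] at he
      cases he
      rw [hk] at hk'
      cases hk'
      rfl
    have hne : l ≠ m := by
      rintro rfl
      obtain ⟨_, h⟩ := W.loadAt_ld
      exact h.not_store h1
    have := h.store m t a hlm hms h1
    have hi : ¬ IssueAt τ m t := h1.not_issue
    obtain ⟨e, w, he, ht', -⟩ := h1
    exact key m t (by omega) hms ⟨e, he, ht'⟩ hi (by omega)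
  · obtain rfl : a = b := by
      obtain ⟨e, w, he, -, hk'⟩ := h2
      rw [W.getElem?_st] at he
      cases he
      rw [hk] at hk'
      cases hk'
      rfl
    have hne : l ≠ m := by
      rintro rfl
      obtain ⟨a', h'⟩ := W.loadAt_ld
      obtain ⟨rfl, rfl⟩ := h1.unique h'
      exact W.address_ne h' hb rfl
    have := h.load m t a hlm hms h1
    have hi : ¬ IssueAt τ m t := h1.not_issue
    obtain ⟨e, w, he, ht', -⟩ := h1
    exact key m t (by omega) hms ⟨e, he, ht'⟩ hi this

/-- The three stretches before `isu`, up to `ld` and up to `st` are followed with the invariants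
`EarlySim`, `DelayingSim` and `LateSim`, and the three distinguished actions lead from one to the
next. -/
theorem IsTSOWitness.exists_goal (W : IsTSOWitness A τ τ₁ τ₂ τ₃ τ₄ isu ld st i l s₀) :
    ∃ d, SCReachable A.instrument d ∧ IsGoal d := by
  obtain ⟨cₑ, hrun, hₑ⟩ := W.computation
  have hil := W.i_lt_l
  have hls := W.l_lt_s
  have hlen := W.lt_length
  obtain ⟨c, hc, hc', s, d, h, hβ⟩ := TSORun.induction (P := P) (τ := τ) (c₀ := .initial P) (cₑ := cₑ)
    (fun _ c => ∃ s d, EarlySim A (fun _ => True) c s d ∧ BufRel d.mem []) (Nat.zero_le i)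
    (by omega) ⟨_, .nil _, hrun, _, _, .initial A _, fun _ => rfl⟩
    -- Here the attacker is simulated like a helper: before `isu` none of its stores is delayed.
    (fun k c c' e _ hk he h1 h2 hs ⟨s, d, h, hβ⟩ => by
      obtain ⟨s', d', h', hd', -⟩ := h.step hs trivial
        (W.store_of_pending hₑ h1 h2 he fun _ => hk.le)
      exact ⟨s', d', h', fun a => by rw [hd' _ (by simp), hβ a]⟩)
  have hbuf := W.buf_isu hₑ hc hc'
  obtain ⟨c₁, hs, hc₁, hc₁'⟩ := hc.next hc' W.getElem?_isu
  obtain ⟨c₂, hc₂, hc₂', x, s, d, h, hx⟩ := TSORun.induction (P := P) (τ := τ)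
    (c₀ := .initial P) (cₑ := cₑ)
    (fun _ c => ∃ x s d, EarlySim A (· ≠ A.attacker) c s d ∧ DelayingSim A x c d)
    (k₁ := i + 1) (k₂ := l) hil (by omega) ⟨c₁, hc₁, hc₁', W.issue_sim h hβ hs hbuf⟩
    (fun k c' c'' e hik hkl he h1 h2 hs ⟨x, s, d, h, hx⟩ => by
      obtain ⟨s', d', h'⟩ := hx.step h hs
        (W.not_store hc hbuf (k := k) (by omega) (by omega) he)
        fun ht => W.store_of_pending hₑ h1 h2 he fun ht' => absurd ht' ht
      exact ⟨x, s', d', h'⟩)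
  obtain ⟨c₃, hs, hc₃, hc₃'⟩ := hc₂.next hc₂' W.getElem?_ld
  obtain ⟨c₄, hc₄, hc₄', s, d, h⟩ := TSORun.induction (P := P) (τ := τ)
    (c₀ := .initial P) (cₑ := cₑ) (fun k c => ∃ s d, LateSim A x τ l k c s d)
    (k₁ := l + 1) (k₂ := s₀) hls hlen.le ⟨c₃, hc₃, hc₃', W.load_sim h hx hs hₑ hc₂'⟩
    (fun k c' c'' e hlk hks he h1 h2 hs ⟨s, d, h⟩ =>
      h.step W hlk hks he hs (W.store_of_pending hₑ h1 h2 he fun ht =>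
        absurd ht (W.thread_ne hlk hks he)))
  obtain ⟨c₅, hs, -, -⟩ := hc₄.next hc₄' W.getElem?_st
  exact W.goal_of_lateSim h hs

end Witness

theorem Attack.goal_of_feasible {P : Program T L R D} {A : Attack P} (h : A.Feasible) :
    ∃ d, SCReachable A.instrument d ∧ IsGoal d := by
  obtain ⟨τ, τ₁, τ₂, τ₃, τ₄, isu, ld, st, i, l, s, W⟩ := h
  exact W.exists_goal

/-! ### The size of the instrumented program -/

/-- The number of symbols of a piece of code. -/
def codeSize {L R D : Type*} (code : List (LInst L R D)) : ℕ := (code.map LInst.size).sum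

theorem codeSize_append {L R D : Type*} (code code' : List (LInst L R D)) :
    codeSize (code ++ code') = codeSize code + codeSize code' := by
  simp [codeSize]

theorem codeSize_flatMap_le {α L R D : Type*} {f : α → List (LInst L R D)} {w : α → ℕ} {K : ℕ}
    {l : List α} (h : ∀ i, codeSize (f i) ≤ K * w i) :
    codeSize (l.flatMap f) ≤ K * (l.map w).sum := by
  induction l with
  | nil => simp [codeSize]
  | cons a l ih =>
    rw [List.flatMap_cons, codeSize_append, List.map_cons, List.sum_cons, Nat.mul_add]
    exact Nat.add_le_add (h a) ih

theorem size_le_codeSize {code : List (LInst L R D)} {i : LInst L R D} (h : i ∈ code) :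
    i.size ≤ codeSize code :=
  List.single_le_sum (by simp) _ (List.mem_map_of_mem h)

@[simp] theorem Expr.size_lift (e : Expr R D) : e.lift.size = e.size := by
  simp [Expr.size, Expr.lift]

@[simp] theorem Expr.size_delay (e : Expr R D) : e.delay.size = e.size := by
  simp [Expr.size, Expr.delay]

@[simp] theorem Expr.size_hb (e : Expr R D) : e.hb.size = e.size := by
  simp [Expr.size, Expr.hb]

@[simp] theorem size_cst (v : IVal D) : (cst v : Expr (IReg R) (IVal D)).size = 1 := rfl

@[simp] theorem size_app (f : IVal D → IVal D) (r : IReg R) : (app f r).size = 2 := rfl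

@[simp] theorem size_test (p : IVal D → Prop) (r : IReg R) : (test p r).size = 2 := rfl

@[simp] theorem Inst.size_lift (i : Inst R D) : i.lift.size = i.size := by
  cases i <;> simp [Inst.lift, Inst.size]

theorem codeSize_attackerOrig_le (i : LInst L R D) : codeSize (attackerOrig i) ≤ 20 * i.size := by
  simp only [codeSize, attackerOrig, LInst.size, Inst.size_lift, List.map_cons, List.map_nil,
    List.sum_cons, List.sum_nil]
  omega

theorem codeSize_attackerCopy_le (i : LInst L R D) : codeSize (attackerCopy i) ≤ 20 * i.size := by
  obtain ⟨src, inst, dst⟩ := i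
  cases inst <;> simp only [codeSize, attackerCopy, LInst.size, Inst.size, List.map_cons, List.map_nil,
    List.sum_cons, List.sum_nil, Expr.size_lift, Expr.size_delay, size_test, size_app] <;> omega

theorem codeSize_helperOrig_le (i : LInst L R D) : codeSize (helperOrig i) ≤ 20 * i.size := by
  simp only [codeSize, helperOrig, LInst.size, Inst.size_lift, List.map_cons, List.map_nil,
    List.sum_cons, List.sum_nil]
  simp only [Inst.size, size_cst, size_test]
  omega

theorem codeSize_helperMove_le (i : LInst L R D) : codeSize (helperMove i) ≤ 20 * i.size := by
  obtain ⟨src, inst, dst⟩ := i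
  cases inst <;> simp [codeSize, helperMove, LInst.size, Inst.size] <;> omega

theorem codeSize_helperCopy_le (i : LInst L R D) : codeSize (helperCopy i) ≤ 20 * i.size := by
  obtain ⟨src, inst, dst⟩ := i
  cases inst <;> simp [codeSize, helperCopy, LInst.size, Inst.size] <;> omega

theorem codeSize_helperCheck (ℓ : L) : codeSize (helperCheck ℓ : List (ILInst L R D)) = 21 := by
  simp [codeSize, helperCheck, LInst.size, Inst.size]

theorem codeSize_attackerMoveStore_le {P : Program T L R D} (A : Attack P) :
    codeSize (attackerMoveStore A) ≤ 20 * A.stInst.size := by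
  simp [codeSize, attackerMoveStore, LInst.size, Inst.size, Attack.stInst]
  omega

theorem codeSize_attackerMoveLoad_le {P : Program T L R D} (A : Attack P) :
    codeSize (attackerMoveLoad A) ≤ 20 * A.ldInst.size := by
  simp [codeSize, attackerMoveLoad, LInst.size, Inst.size, Attack.ldInst]
  omega

theorem Thread.length_labels_le (th : Thread L R D) : th.labels.length ≤ 1 + codeSize th.code := by
  have : ∀ code : List (LInst L R D),
      (code.flatMap fun i => [i.src, i.dst]).length ≤ codeSize code := by
    intro code
    induction code with
    | nil => simp
    | cons i code ih =>
      have h : codeSize (i :: code) = i.size + codeSize code := by simp [codeSize]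
      rw [List.flatMap_cons, List.length_append, h]
      -- An instruction has size at least `2`, which pays for its two labels.
      exact Nat.add_le_add (Nat.le_add_right 2 _) ih
  have := this th.code
  rw [Thread.labels, List.length_cons]
  omega

/-- Three translations cost a factor of at most `20` each, and each label costs `21`, with at most
one label more than the code size; `100` leaves room for the additive constants. -/
theorem size_instrumentHelper_le (th : Thread L R D) :
    (instrumentHelper th).size ≤ 100 * th.size := by
  have h1 := codeSize_flatMap_le (l := th.code) codeSize_helperOrig_le
  have h2 := codeSize_flatMap_le (l := th.code) codeSize_helperMove_le
  have h3 := codeSize_flatMap_le (l := th.code) codeSize_helperCopy_le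
  have h4 := codeSize_flatMap_le (l := th.labels) (w := fun _ => 1)
    (f := (helperCheck : L → List (ILInst L R D))) (K := 21) fun ℓ => (codeSize_helperCheck ℓ).le
  have h5 := th.length_labels_le
  have h6 : (th.labels.map fun _ => 1).sum = th.labels.length := by simp
  change 1 + codeSize (instrumentHelper th).code ≤ 100 * (1 + codeSize th.code)
  change _ ≤ _ * codeSize th.code at h1 h2 h3
  rw [instrumentHelper, codeSize_append, codeSize_append, codeSize_append]
  omega

/-- The two special blocks are charged to the instructions of the attack, which occur in the code,
so four factors of `20` suffice. -/
theorem size_instrumentAttacker_le {P : Program T L R D} (A : Attack P) :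
    (instrumentAttacker A).size ≤ 100 * (P A.attacker).size := by
  have h1 := codeSize_flatMap_le (l := (P A.attacker).code) codeSize_attackerOrig_le
  have h2 := codeSize_flatMap_le (l := (P A.attacker).code) codeSize_attackerCopy_le
  have h3 := codeSize_attackerMoveStore_le A
  have h4 := codeSize_attackerMoveLoad_le A
  have h5 := size_le_codeSize A.st_mem
  have h6 := size_le_codeSize A.ld_mem
  change A.stInst.size ≤ _ at h5
  change A.ldInst.size ≤ _ at h6
  change 1 + codeSize (instrumentAttacker A).code ≤ 100 * (1 + codeSize (P A.attacker).code)
  change _ ≤ _ * codeSize (P A.attacker).code at h1 h2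
  rw [instrumentAttacker, codeSize_append, codeSize_append, codeSize_append]
  omega

theorem Attack.size_instrument_le [Fintype T] {P : Program T L R D} (A : Attack P) :
    Program.size A.instrument ≤ 100 * Program.size P := by
  unfold Program.size
  rw [Finset.mul_sum]
  refine Finset.sum_le_sum fun t _ => ?_
  by_cases ht : t = A.attacker
  · subst ht
    rw [instrument_attacker]
    exact size_instrumentAttacker_le A
  · rw [instrument_helper A ht]
    exact size_instrumentHelper_le (P t)

end TSORobustness

/-- There is a universal constant `C` such that, for every program `P` and every attack `A` in `P`,
the attack is feasible iff the instrumented program reaches a goal configuration under SC, and the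
instrumented program is at most `C` times as large as `P`. -/
theorem mainTheorem2 :
    ∃ C : ℕ, ∀ (T L R D : Type*) [Fintype T] [Zero D]
      (P : TSORobustness.Program T L R D) (A : TSORobustness.Attack P),
      (A.Feasible ↔
        ∃ c, TSORobustness.SCReachable A.instrument c ∧ TSORobustness.IsGoal c) ∧
      TSORobustness.Program.size A.instrument ≤ C * TSORobustness.Program.size P :=
  ⟨100, fun _ _ _ _ _ _ _ A => ⟨⟨fun h => TSORobustness.Attack.goal_of_feasible h,
    fun ⟨_, hc, hg⟩ => A.feasible_of_goal hc hg⟩, A.size_instrument_le⟩⟩
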